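/- Let $N\ge 2$ and let $\Omega\subset\mathbb R^N$ be a bounded open set (no regularity of the boundary is needed). For $s\in(0,1)$ let $c_{N,s}=\frac12\Big(\int_{\mathbb R^N}\frac{1-\cos\zeta_1}{|\zeta|^{N+2s}}\,d\zeta\Big)^{-1}$ and, for measurable $u,v:\mathbb R^N\to\mathbb R$, $$[u]_s^2=c_{N,s}\iint_{\mathbb R^{2N}}\frac{|u(x)-u(y)|^2}{|x-y|^{N+2s}}\,dx\,dy,\qquad \mathcal E_s(u,v)=c_{N,s}\iint_{\mathbb R^{2N}}\frac{(u(x)-u(y))(v(x)-v(y))}{|x-y|^{N+2s}}\,dx\,dy ;$$ further $[u]_0=\|u\|_{L^2(\mathbb R^N)}$, $\mathcal E_0(u,v)=\int_{\mathbb R^N} uv\,dx$, $[u]_1=\|\nabla u\|_{L^2(\mathbb R^N)}$, $\mathcal E_1(u,v)=\int_{\mathbb R^N}\nabla u\cdot\nabla v\,dx$ (weak gradients). There exists $\gamma_0>0$, depending only on $N$ and $\Omega$, such that the following holds. Let $\mu^+,\mu^-$ be finite nonnegative Borel measures on $[0,1]$ and let $\bar s\in(0,1]$, $\gamma\in[0,\gamma_0]$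 be such that $$\mu^+([\bar s,1])>0,\qquad \mu^-|_{[\bar s,1]}=0,\qquad \mu^-([0,\bar s])\le\gamma\,\mu^+([\bar s,1]),$$ and write $\mu=\mu^+-\mu^-$. Let $X_0(\Omega)$ be the space of measurable $u:\mathbb R^N\to\mathbb R$ (up to a.e. equality) with $u=0$ a.e. in $\mathbb R^N\setminus\Omega$ and $\int_{[0,1]}[u]_s^2\,d\mu^+(s)<\infty$, normed by $\|u\|_{X_0(\Omega)}=\big(\int_{[0,1]}[u]_s^2\,d\mu^+(s)\big)^{1/2}$, and put $$\langle u,v\rangle=\int_{[0,1]}\mathcal E_s(u,v)\,d\mu^+(s),\qquad (u,v)=\int_{[0,\bar s]}\mathcal E_s(u,v)\,d\mu^-(s),\qquad \|u\|^2=\langle u,u\rangle-(u,u).$$ Let $\sigma(A_\mu)$ be the set of $\lambda\in\mathbb R$ for which there is $u\in X_0(\Omega)\setminus\{0\}$ with $\langle u,v\rangle-(u,v)=\lambda\int_\Omega uv\,dx$ for all $v\in X_0(\Omega)$. Let $f:\Omega\times\mathbb R\to\mathbb R$ be a Carathéodory function such that - $(f_1)$ for every $\tau>0$ the function $x\mapsto\sup_{|t|\le\tau}|f(x,t)|$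 belongs to $L^\infty(\Omega)$; - $(f_2)$ $\lim_{|t|\to\infty} f(x,t)/t=0$ uniformly for a.e. $x\in\Omega$, put $F(x,t)=\int_0^t f(x,\tau)\,d\tau$, and let $\bar\lambda\in\mathbb R\setminus\sigma(A_\mu)$. Then the functional $$J(u)=\tfrac12\|u\|^2-\tfrac{\bar\lambda}2\int_\Omega u^2\,dx-\int_\Omega F(x,u)\,dx,\qquad u\in X_0(\Omega),$$ is of class $C^1$ on $X_0(\Omega)$ and satisfies the Palais–Smale condition at every level $c\in\mathbb R$: every sequence $(u_n)$ in $X_0(\Omega)$ with $J(u_n)\to c$ and $J'(u_n)\to0$ in the dual of $X_0(\Omega)$ has a subsequence that converges in $X_0(\Omega)$. -/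

import Mathlib

open MeasureTheory Set Filter Topology
open scoped ENNReal NNReal ContDiff

namespace Superposition

noncomputable section

/-- The normalization constant `c_{N,s}`, `0 < s < 1`, of the Gagliardo seminorm, i.e. one half of
`(∫ (1 - cos ζ₁) / |ζ|^(N+2s) dζ)⁻¹`; with this choice `[u]_s² = ‖(-Δ)^{s/2} u‖²_{L²}`. -/
def normConst (N : ℕ) [NeZero N] (s : ℝ) : ℝ :=
  (1 / 2) * (∫ ζ : EuclideanSpace ℝ (Fin N),
    (1 - Real.cos (ζ 0)) / ‖ζ‖ ^ ((N : ℝ) + 2 * s))⁻¹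

/-- `G` is the weak (distributional) gradient of `u` on `ℝ^N`. -/
def IsWeakGradient {N : ℕ} (u : EuclideanSpace ℝ (Fin N) → ℝ)
    (G : EuclideanSpace ℝ (Fin N) → EuclideanSpace ℝ (Fin N)) : Prop :=
  LocallyIntegrable u volume ∧ LocallyIntegrable G volume ∧
    ∀ φ : EuclideanSpace ℝ (Fin N) → ℝ, ContDiff ℝ ∞ φ → HasCompactSupport φ →
      ∀ e : EuclideanSpace ℝ (Fin N),
        ∫ x, u x * fderiv ℝ φ x e = - ∫ x, inner ℝ (G x) e * φ x

open Classical in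
/-- The weak gradient (zero if there is none). -/
def weakGradient {N : ℕ} (u : EuclideanSpace ℝ (Fin N) → ℝ) :
    EuclideanSpace ℝ (Fin N) → EuclideanSpace ℝ (Fin N) :=
  if h : ∃ G, IsWeakGradient u G then h.choose else 0

/-- The seminorm `[u]_s`, `s ∈ [0,1]`, with values in `[0,∞]`. For `s = 0` it is the `L²` norm of
`u`, for `s = 1` the `L²` norm of the weak gradient (`∞` if there is none; it is unique up to null
sets, so that the infimum runs over one value at most). -/
def gagliardo {N : ℕ} [NeZero N] (s : ℝ) (u : EuclideanSpace ℝ (Fin N) → ℝ) : ℝ≥0∞ :=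
  if s = 0 then eLpNorm u 2 volume
  else if s = 1 then ⨅ G, ⨅ _ : IsWeakGradient u G, eLpNorm G 2 volume
  else (ENNReal.ofReal (normConst N s) *
    ∫⁻ x, ∫⁻ y, ENNReal.ofReal (|u x - u y| ^ 2 / ‖x - y‖ ^ ((N : ℝ) + 2 * s))) ^ (1 / 2 : ℝ)

/-- The bilinear form of which `[u]_s²` is the quadratic form. -/
def gagliardoForm {N : ℕ} [NeZero N] (s : ℝ) (u v : EuclideanSpace ℝ (Fin N) → ℝ) : ℝ :=
  if s = 0 then ∫ x, u x * v x
  else if s = 1 then ∫ x, inner ℝ (weakGradient u x) (weakGradient v x)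
  else normConst N s *
    ∫ x, ∫ y, (u x - u y) * (v x - v y) / ‖x - y‖ ^ ((N : ℝ) + 2 * s)

/-- `(∫_{[0,1]} [u]_s² dμ(s))^{1/2}` with values in `[0,∞]`. -/
def energyNorm {N : ℕ} [NeZero N] (μ : Measure unitInterval)
    (u : EuclideanSpace ℝ (Fin N) → ℝ) : ℝ≥0∞ :=
  (∫⁻ s : unitInterval, gagliardo (s : ℝ) u ^ (2 : ℝ) ∂μ) ^ (1 / 2 : ℝ)

variable {N : ℕ}

local notation "𝔼" => EuclideanSpace ℝ (Fin N)

theorem IsWeakGradient.congr {u v : 𝔼 → ℝ} {G : 𝔼 → 𝔼} (h : u =ᵐ[volume] v)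
    (hu : IsWeakGradient u G) : IsWeakGradient v G := by
  refine ⟨hu.1.congr h, hu.2.1, fun φ hφ hc e => ?_⟩
  rw [← hu.2.2 φ hφ hc e]
  refine integral_congr_ae ?_
  filter_upwards [h] with x hx
  rw [hx]

theorem IsWeakGradient.integrable_left {u : 𝔼 → ℝ} {G : 𝔼 → 𝔼} (hu : IsWeakGradient u G)
    {φ : 𝔼 → ℝ} (hφ : ContDiff ℝ ∞ φ) (hc : HasCompactSupport φ) (e : 𝔼) :
    Integrable (fun x => u x * fderiv ℝ φ x e) := by
  have h1 : Continuous (fun x => fderiv ℝ φ x e) :=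
    (hφ.continuous_fderiv (by simp)).clm_apply continuous_const
  have h2 : HasCompactSupport (fun x => fderiv ℝ φ x e) := hc.fderiv_apply ℝ e
  simpa [smul_eq_mul] using hu.1.integrable_smul_right_of_hasCompactSupport h1 h2

theorem IsWeakGradient.integrable_right {u : 𝔼 → ℝ} {G : 𝔼 → 𝔼} (hu : IsWeakGradient u G)
    {φ : 𝔼 → ℝ} (hφ : ContDiff ℝ ∞ φ) (hc : HasCompactSupport φ) (e : 𝔼) :
    Integrable (fun x => inner ℝ (G x) e * φ x) := by
  have := (hu.2.1.integrable_smul_left_of_hasCompactSupport hφ.continuous hc).inner_const (𝕜 := ℝ) e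
  refine this.congr (Eventually.of_forall fun x => ?_)
  simp [inner_smul_left, mul_comm]

theorem IsWeakGradient.add {u v : 𝔼 → ℝ} {G H : 𝔼 → 𝔼} (hu : IsWeakGradient u G)
    (hv : IsWeakGradient v H) : IsWeakGradient (u + v) (G + H) := by
  refine ⟨hu.1.add hv.1, hu.2.1.add hv.2.1, fun φ hφ hc e => ?_⟩
  simp only [Pi.add_apply, inner_add_left, add_mul]
  rw [integral_add (hu.integrable_left hφ hc e) (hv.integrable_left hφ hc e),
    integral_add (hu.integrable_right hφ hc e) (hv.integrable_right hφ hc e),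
    hu.2.2 φ hφ hc e, hv.2.2 φ hφ hc e]
  ring

theorem IsWeakGradient.smul {u : 𝔼 → ℝ} {G : 𝔼 → 𝔼} (hu : IsWeakGradient u G) (a : ℝ) :
    IsWeakGradient (a • u) (a • G) := by
  refine ⟨hu.1.smul a, hu.2.1.smul a, fun φ hφ hc e => ?_⟩
  simp only [Pi.smul_apply, smul_eq_mul, inner_smul_left, mul_assoc, integral_const_mul]
  rw [hu.2.2 φ hφ hc e]
  simp

variable [NeZero N]

theorem gagliardo_congr (s : ℝ) {u v : 𝔼 → ℝ} (h : u =ᵐ[volume] v) :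
    gagliardo s u = gagliardo s v := by
  unfold gagliardo
  split_ifs
  · exact eLpNorm_congr_ae h
  · have : ∀ G, IsWeakGradient u G ↔ IsWeakGradient v G :=
      fun G => ⟨fun k => k.congr h, fun k => k.congr h.symm⟩
    simp only [this]
  · congr 2
    refine lintegral_congr_ae ?_
    filter_upwards [h] with x hx
    refine lintegral_congr_ae ?_
    filter_upwards [h] with y hy
    rw [hx, hy]

theorem gagliardo_smul_le (s a : ℝ) (u : 𝔼 → ℝ) :
    gagliardo s (a • u) ≤ ‖a‖ₑ * gagliardo s u := by
  unfold gagliardo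
  split_ifs
  · exact eLpNorm_const_smul_le
  · by_cases ha : a = 0
    · have h0 : IsWeakGradient (a • u) (0 : 𝔼 → 𝔼) := by
        subst ha
        refine ⟨by rw [zero_smul]; exact locallyIntegrable_zero,
          locallyIntegrable_zero, fun φ _ _ e => by simp⟩
      refine (iInf₂_le _ h0).trans ?_
      simp
    · rw [ENNReal.mul_iInf_of_ne (by simpa using ha) (by simp)]
      refine le_iInf fun G => ?_
      rw [ENNReal.mul_iInf_of_ne (by simpa using ha) (by simp)]
      refine le_iInf fun hG => (iInf₂_le _ (hG.smul a)).trans eLpNorm_const_smul_le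
  · have : ∀ x y : 𝔼, ENNReal.ofReal (|(a • u) x - (a • u) y| ^ 2 / ‖x - y‖ ^ ((N : ℝ) + 2 * s)) =
        ENNReal.ofReal (|a| ^ 2) *
          ENNReal.ofReal (|u x - u y| ^ 2 / ‖x - y‖ ^ ((N : ℝ) + 2 * s)) := by
      intro x y
      rw [← ENNReal.ofReal_mul (by positivity), Pi.smul_apply, Pi.smul_apply, smul_eq_mul,
        smul_eq_mul, ← mul_sub, abs_mul, mul_pow, mul_div_assoc]
    simp only [this]
    simp_rw [lintegral_const_mul' _ _ ENNReal.ofReal_ne_top]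
    rw [mul_left_comm, ENNReal.mul_rpow_of_nonneg _ _ (by norm_num : (0:ℝ) ≤ 1 / 2)]
    gcongr
    rw [ENNReal.ofReal_pow (abs_nonneg a), ← ENNReal.rpow_natCast, ← ENNReal.rpow_mul]
    simp [Real.enorm_eq_ofReal_abs]

theorem lintegral_sq_add_le {α : Type*} [MeasurableSpace α] {μ : Measure α} {f g h : α → ℝ≥0∞}
    (hf : AEMeasurable f μ) (hg : AEMeasurable g μ) (hh : ∀ a, h a ≤ f a + g a) :
    (∫⁻ a, h a ^ (2 : ℝ) ∂μ) ^ (1 / 2 : ℝ) ≤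
      (∫⁻ a, f a ^ (2 : ℝ) ∂μ) ^ (1 / 2 : ℝ) + (∫⁻ a, g a ^ (2 : ℝ) ∂μ) ^ (1 / 2 : ℝ) := by
  refine le_trans ?_ (ENNReal.lintegral_Lp_add_le hf hg one_le_two)
  gcongr with a
  exact hh a

theorem measurable_kernel {u : 𝔼 → ℝ} (hu : Measurable u) :
    Measurable (fun p : (ℝ × 𝔼) × 𝔼 => ENNReal.ofReal
      (|u p.1.2 - u p.2| ^ 2 / ‖p.1.2 - p.2‖ ^ ((N : ℝ) + 2 * p.1.1))) := by
  fun_prop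

theorem measurable_normConst : Measurable (normConst N) := by
  unfold normConst
  refine Measurable.const_mul (Measurable.inv ?_) _
  refine StronglyMeasurable.measurable ?_
  refine StronglyMeasurable.integral_prod_right
    (f := fun (s : ℝ) (ζ : 𝔼) => (1 - Real.cos (ζ 0)) / ‖ζ‖ ^ ((N : ℝ) + 2 * s)) ?_
  refine Measurable.stronglyMeasurable ?_
  simp only [Function.uncurry_def]
  fun_prop

theorem measurable_gagliardo {u : 𝔼 → ℝ} (hu : Measurable u) :
    Measurable (fun s : ℝ => gagliardo s u) := by
  unfold gagliardo
  refine Measurable.ite (measurableSet_eq) measurable_const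
    (Measurable.ite (measurableSet_eq) measurable_const ?_)
  refine Measurable.pow_const (Measurable.mul measurable_normConst.ennreal_ofReal ?_) _
  have h1 := (measurable_kernel hu).lintegral_prod_right' (ν := (volume : Measure 𝔼))
  exact h1.lintegral_prod_right' (ν := (volume : Measure 𝔼))

theorem gagliardo_eq_prod (s : ℝ) {u : 𝔼 → ℝ} (hu : Measurable u) :
    ENNReal.ofReal (normConst N s) * ∫⁻ x : 𝔼, ∫⁻ y,
      ENNReal.ofReal (|u x - u y| ^ 2 / ‖x - y‖ ^ ((N : ℝ) + 2 * s)) =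
    ∫⁻ z : 𝔼 × 𝔼, ((ENNReal.ofReal (normConst N s)) ^ (1 / 2 : ℝ) * ENNReal.ofReal (|u z.1 - u z.2| *
      (‖z.1 - z.2‖ ^ ((N : ℝ) + 2 * s))⁻¹ ^ (1 / 2 : ℝ))) ^ (2 : ℝ)
      ∂(volume : Measure 𝔼).prod (volume : Measure 𝔼) := by
  rw [lintegral_prod _ (by fun_prop), ← lintegral_const_mul' _ _ ENNReal.ofReal_ne_top]
  refine lintegral_congr fun x => ?_
  rw [← lintegral_const_mul' _ _ ENNReal.ofReal_ne_top]
  refine lintegral_congr fun y => ?_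
  rw [ENNReal.mul_rpow_of_nonneg _ _ zero_le_two, ← ENNReal.rpow_mul]
  simp only [one_div, isUnit_iff_ne_zero, ne_eq, OfNat.ofNat_ne_zero, not_false_eq_true,
    IsUnit.inv_mul_cancel, ENNReal.rpow_one]
  congr 1
  rw [ENNReal.ofReal_rpow_of_nonneg (by positivity) zero_le_two,
    Real.mul_rpow (by positivity) (by positivity), ← Real.rpow_mul (by positivity)]
  simp [div_eq_mul_inv]

theorem gagliardo_add_le (s : ℝ) {u v : 𝔼 → ℝ} (hu : Measurable u) (hv : Measurable v) :
    gagliardo s (u + v) ≤ gagliardo s u + gagliardo s v := by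
  unfold gagliardo
  split_ifs
  · exact eLpNorm_add_le hu.aestronglyMeasurable hv.aestronglyMeasurable one_le_two
  · simp only [ENNReal.iInf_add, ENNReal.add_iInf]
    refine le_iInf₂ fun G hG => le_iInf₂ fun H hH => ?_
    exact (iInf₂_le _ (hH.add hG)).trans
      ((eLpNorm_add_le hH.2.1.aestronglyMeasurable hG.2.1.aestronglyMeasurable one_le_two))
  · rw [gagliardo_eq_prod s hu, gagliardo_eq_prod s hv, gagliardo_eq_prod s (hu.add hv)]
    refine lintegral_sq_add_le (by fun_prop) (by fun_prop) fun z => ?_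
    rw [← mul_add, ← ENNReal.ofReal_add (by positivity) (by positivity), ← add_mul]
    gcongr
    simp only [Pi.add_apply]
    rw [add_sub_add_comm]
    exact abs_add_le _ _

theorem energyNorm_congr (μ : Measure unitInterval) {u v : 𝔼 → ℝ} (h : u =ᵐ[volume] v) :
    energyNorm μ u = energyNorm μ v := by
  unfold energyNorm
  simp only [gagliardo_congr _ h]

theorem energyNorm_smul_le (μ : Measure unitInterval) (a : ℝ) (u : 𝔼 → ℝ) :
    energyNorm μ (a • u) ≤ ‖a‖ₑ * energyNorm μ u := by
  unfold energyNorm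
  calc _ ≤ (∫⁻ s : unitInterval, ‖a‖ₑ ^ (2 : ℝ) * gagliardo (s : ℝ) u ^ (2 : ℝ) ∂μ) ^
        (1 / 2 : ℝ) := by
        gcongr
        rw [← ENNReal.mul_rpow_of_nonneg _ _ zero_le_two]
        gcongr
        exact gagliardo_smul_le _ _ _
    _ = _ := by
        rw [lintegral_const_mul' _ _ (by simp), ENNReal.mul_rpow_of_nonneg _ _ (by norm_num),
          ← ENNReal.rpow_mul]
        simp

theorem energyNorm_add_le (μ : Measure unitInterval) {u v : 𝔼 → ℝ} (hu : Measurable u)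
    (hv : Measurable v) : energyNorm μ (u + v) ≤ energyNorm μ u + energyNorm μ v :=
  lintegral_sq_add_le ((measurable_gagliardo hu).comp measurable_subtype_coe).aemeasurable
    ((measurable_gagliardo hv).comp measurable_subtype_coe).aemeasurable
    fun s => gagliardo_add_le _ hu hv

theorem normConst_pos {s : ℝ} (h0 : 0 < s) (h1 : s < 1) : 0 < normConst N s := by
  have hN : 0 < (N : ℝ) := by exact_mod_cast NeZero.pos N
  have hcos : ∀ t : ℝ, 0 ≤ 1 - Real.cos t := fun t => by linarith [Real.cos_le_one t]
  have hint : Integrable (fun ζ : 𝔼 => (1 - Real.cos (ζ 0)) / ‖ζ‖ ^ ((N : ℝ) + 2 * s)) := by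
    let g : ℝ → ℝ := fun r => min (r ^ 2) 2 / r ^ ((N : ℝ) + 2 * s)
    have hg : Integrable (fun ζ : 𝔼 => g ‖ζ‖) := by
      rw [integrable_fun_norm_addHaar volume (f := g)]
      rw [← Ioc_union_Ioi_eq_Ioi zero_le_one]
      have hpow : ∀ r : ℝ, 0 < r → r ^ (Module.finrank ℝ 𝔼 - 1) = r ^ ((N : ℝ) - 1) := by
        intro r hr
        rw [finrank_euclideanSpace_fin, ← Real.rpow_natCast, Nat.cast_sub NeZero.one_le]
        simp
      refine IntegrableOn.union ?_ ?_
      · have h2 : IntegrableOn (fun r : ℝ => r ^ (1 - 2 * s)) (Ioc 0 1) :=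
          (intervalIntegrable_iff_integrableOn_Ioc_of_le zero_le_one).1
            (intervalIntegral.intervalIntegrable_rpow' (by linarith))
        refine Integrable.mono' h2 (by fun_prop) ?_
        refine (ae_restrict_mem measurableSet_Ioc).mono fun r hr => ?_
        have hr0 : 0 < r := hr.1
        have hgr : 0 ≤ g r := by positivity
        rw [smul_eq_mul, Real.norm_of_nonneg (by positivity), hpow r hr0]
        calc r ^ ((N : ℝ) - 1) * g r ≤ r ^ ((N : ℝ) - 1) * (r ^ (2 : ℝ) / r ^ ((N : ℝ) + 2 * s)) := by
              simp only [g]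
              gcongr
              rw [Real.rpow_two]
              exact min_le_left _ _
          _ = r ^ (1 - 2 * s) := by
              rw [← Real.rpow_sub hr0, ← Real.rpow_add hr0]
              congr 1
              ring
      · have h2 : IntegrableOn (fun r : ℝ => 2 * r ^ (-1 - 2 * s)) (Ioi 1) :=
          (integrableOn_Ioi_rpow_of_lt (by linarith) one_pos).const_mul 2
        refine Integrable.mono' h2 (by fun_prop) ?_
        refine (ae_restrict_mem measurableSet_Ioi).mono fun r hr => ?_
        have hr0 : 0 < r := one_pos.trans hr
        have hgr : 0 ≤ g r := by positivity
        rw [smul_eq_mul, Real.norm_of_nonneg (by positivity), hpow r hr0]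
        calc r ^ ((N : ℝ) - 1) * g r ≤ r ^ ((N : ℝ) - 1) * (2 / r ^ ((N : ℝ) + 2 * s)) := by
              simp only [g]
              gcongr
              exact min_le_right _ _
          _ = 2 * r ^ (-1 - 2 * s) := by
              rw [mul_div_left_comm, ← Real.rpow_sub hr0]
              congr 2
              ring
    refine Integrable.mono' hg (by
      refine Measurable.aestronglyMeasurable ?_
      fun_prop) (Eventually.of_forall fun ζ => ?_)
    rw [Real.norm_of_nonneg (div_nonneg (hcos _) (by positivity))]
    simp only [g]
    gcongr
    refine le_min ?_ (by linarith [Real.neg_one_le_cos (ζ 0)])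
    have h3 : |ζ 0| ≤ ‖ζ‖ := PiLp.norm_apply_le ζ 0
    have h4 : (ζ 0) ^ 2 ≤ ‖ζ‖ ^ 2 := by
      rw [← sq_abs]
      gcongr
    linarith [Real.one_sub_sq_div_two_le_cos (x := ζ 0), sq_nonneg (ζ 0)]
  unfold normConst
  refine mul_pos (by norm_num) (inv_pos.2 ?_)
  rw [integral_pos_iff_support_of_nonneg (fun ζ => div_nonneg (hcos _) (by positivity)) hint]
  have hopen : IsOpen {ζ : 𝔼 | Real.cos (ζ 0) < 1} :=
    isOpen_lt (by fun_prop) continuous_const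
  have hne : ({ζ : 𝔼 | Real.cos (ζ 0) < 1}).Nonempty :=
    ⟨EuclideanSpace.single 0 Real.pi, by simp⟩
  refine (hopen.measure_pos volume hne).trans_le (measure_mono fun ζ hζ => ?_)
  have hζ' : Real.cos (ζ 0) < 1 := hζ
  have : ζ ≠ 0 := by
    rintro rfl
    simp at hζ'
  have h5 : 0 < ‖ζ‖ := norm_pos_iff.2 this
  exact (div_pos (by linarith) (by positivity)).ne'

theorem compl_measure_pos {Ω : Set 𝔼} (hΩ : Bornology.IsBounded Ω) : volume Ωᶜ ≠ 0 := by
  intro h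
  have h1 := measure_univ_le_add_compl Ω (μ := (volume : Measure 𝔼))
  rw [h, add_zero] at h1
  have : Nonempty (Fin N) := ⟨0⟩
  have h2 : volume (univ : Set 𝔼) = ⊤ := by
    obtain ⟨x, hx⟩ : ∃ x : 𝔼, x ≠ 0 := ⟨EuclideanSpace.single 0 1, by simp⟩
    have : Nontrivial 𝔼 := ⟨x, 0, hx⟩
    have := NormedSpace.noncompactSpace ℝ 𝔼
    exact measure_univ_of_isAddLeftInvariant _
  exact absurd (h1.trans_lt hΩ.measure_lt_top) (by simp [h2])

theorem ae_eq_zero_of_weakGradient {Ω : Set 𝔼} (hΩ : Bornology.IsBounded Ω) {u : 𝔼 → ℝ}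
    (hu : LocallyIntegrable u volume) (h0 : ∀ᵐ x, x ∉ Ω → u x = 0)
    (h : ∀ φ : 𝔼 → ℝ, ContDiff ℝ ∞ φ → HasCompactSupport φ → ∀ e : 𝔼,
      ∫ x, u x * fderiv ℝ φ x e = 0) : u =ᵐ[volume] 0 := by
  refine ae_eq_zero_of_integral_contDiff_smul_eq_zero hu fun φ hφ hc => ?_
  let ψ : 𝔼 → ℝ := fun y => φ (-y)
  have hψ : ContDiff ℝ ∞ ψ := hφ.comp contDiff_neg
  have hψc : HasCompactSupport ψ := hc.comp_homeomorph (Homeomorph.neg 𝔼)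
  let L := ContinuousLinearMap.mul ℝ ℝ
  have hd : ∀ z, HasFDerivAt (convolution u ψ L volume) (0 : 𝔼 →L[ℝ] ℝ) z := by
    intro z
    have h1 := hψc.hasFDerivAt_convolution_right L hu (hψ.of_le (by simp)) z
    refine h1.congr_fderiv (ContinuousLinearMap.ext fun e => ?_)
    rw [convolution_precompR_apply L hu (hψc.fderiv ℝ) (hψ.continuous_fderiv (by simp))]
    have h2 := h (fun t => ψ (z - t)) (hψ.comp (contDiff_const.sub contDiff_id))
      (hψc.comp_homeomorph (Homeomorph.subLeft z)) (-e)
    rw [zero_apply, ← h2]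
    simp only [convolution_def]
    refine integral_congr_ae (Eventually.of_forall fun t => ?_)
    have h3 : HasFDerivAt (fun t => ψ (z - t))
        ((fderiv ℝ ψ (z - t)).comp (-ContinuousLinearMap.id ℝ 𝔼)) t :=
      ((hψ.differentiable (by simp)) (z - t)).hasFDerivAt.comp t ((hasFDerivAt_id t).const_sub z)
    simp [L, h3.fderiv]
  have hconst := is_const_of_fderiv_eq_zero (𝕜 := ℝ) (fun z => (hd z).differentiableAt)
    (fun z => (hd z).fderiv)
  obtain ⟨R, hR⟩ := hΩ.subset_closedBall 0
  obtain ⟨R', hR'⟩ := hc.isBounded.subset_closedBall 0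
  let z : 𝔼 := EuclideanSpace.single 0 (|R| + |R'| + 1)
  have hz : ‖z‖ = |R| + |R'| + 1 := by
    simp only [z, PiLp.norm_single]
    exact Real.norm_of_nonneg (by positivity)
  have hfar : convolution u ψ L volume z = 0 := by
    refine integral_eq_zero_of_ae ?_
    filter_upwards [h0] with t ht
    by_cases htΩ : t ∈ Ω
    · have h4 : ‖t‖ ≤ R := by simpa using hR htΩ
      have h5 : φ (-(z - t)) = 0 := by
        by_contra hne
        have h6 : ‖-(z - t)‖ ≤ R' := by simpa using hR' (subset_tsupport φ hne)
        rw [norm_neg] at h6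
        have h7 := norm_sub_norm_le z t
        linarith [le_abs_self R, le_abs_self R']
      simp [L, ψ, h5]
    · simp [ht htΩ]
  have hzero := hconst 0 z
  rw [hfar] at hzero
  rw [← hzero]
  refine integral_congr_ae (Eventually.of_forall fun t => ?_)
  simp [L, ψ, mul_comm]

theorem ae_eq_zero_of_gagliardo_eq_zero {Ω : Set 𝔼} (hΩ : Bornology.IsBounded Ω) {s : ℝ}
    (hs0 : 0 ≤ s) (hs1 : s ≤ 1) {u : 𝔼 → ℝ} (hu : Measurable u) (h0 : ∀ᵐ x, x ∉ Ω → u x = 0)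
    (h : gagliardo s u = 0) : u =ᵐ[volume] 0 := by
  unfold gagliardo at h
  split_ifs at h with h1 h2
  · exact (eLpNorm_eq_zero_iff hu.aestronglyMeasurable two_ne_zero).1 h
  · have hlt : ∀ ε : ℝ≥0∞, ε ≠ 0 → ∃ G, IsWeakGradient u G ∧ eLpNorm G 2 volume < ε := by
      intro ε hε
      have := h.trans_lt (pos_iff_ne_zero.2 hε)
      simpa only [iInf_lt_iff, exists_prop] using this
    obtain ⟨G₀, hG₀, -⟩ := hlt 1 one_ne_zero
    refine ae_eq_zero_of_weakGradient hΩ hG₀.1 h0 fun φ hφ hc e => ?_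
    have hφL : MemLp φ 2 volume := hφ.continuous.memLp_of_hasCompactSupport hc
    rw [← enorm_eq_zero]
    by_contra hne
    set K := ‖e‖ₑ * eLpNorm φ 2 volume with hK
    have hKtop : K ≠ ⊤ := ENNReal.mul_ne_top enorm_ne_top hφL.2.ne
    obtain ⟨G, hG, hGε⟩ := hlt (‖∫ x, u x * fderiv ℝ φ x e‖ₑ / (K + 1))
      (ENNReal.div_pos hne (by simp [hKtop])).ne'
    have hle : ‖∫ x, u x * fderiv ℝ φ x e‖ₑ ≤ eLpNorm G 2 volume * K := by
      rw [hG.2.2 φ hφ hc e, enorm_neg]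
      calc _ ≤ ∫⁻ x, ‖inner ℝ (G x) e * φ x‖ₑ := enorm_integral_le_lintegral_enorm _
        _ ≤ ∫⁻ x, (‖e‖ₑ * (‖G x‖ₑ * ‖φ x‖ₑ)) := by
            gcongr with x
            rw [enorm_mul, ← mul_assoc]
            gcongr
            rw [mul_comm, ← enorm_norm e, ← enorm_norm (G x), ← enorm_mul]
            refine enorm_le_iff_norm_le.2 ?_
            simpa using norm_inner_le_norm (𝕜 := ℝ) (G x) e
        _ = ‖e‖ₑ * ∫⁻ x, ((fun x => ‖G x‖ₑ) * fun x => ‖φ x‖ₑ) x := by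
            rw [lintegral_const_mul' _ _ enorm_ne_top]
            rfl
        _ ≤ ‖e‖ₑ * (eLpNorm G 2 volume * eLpNorm φ 2 volume) := by
            gcongr
            refine (ENNReal.lintegral_mul_le_Lp_mul_Lq volume Real.HolderConjugate.two_two
              hG.2.1.aestronglyMeasurable.enorm hφL.1.enorm).trans ?_
            simp [eLpNorm_eq_lintegral_rpow_enorm_toReal two_ne_zero ENNReal.ofNat_ne_top]
        _ = _ := by rw [hK]; ring
    have hlt2 : eLpNorm G 2 volume * (K + 1) < ‖∫ x, u x * fderiv ℝ φ x e‖ₑ :=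
      (ENNReal.lt_div_iff_mul_lt (by simp) (by simp [hKtop])).1 hGε
    exact absurd (hle.trans (by gcongr; exact le_self_add)) hlt2.not_ge
  · have hs0' : 0 < s := lt_of_le_of_ne hs0 (Ne.symm h1)
    have hs1' : s < 1 := lt_of_le_of_ne hs1 h2
    have hc := normConst_pos (N := N) hs0' hs1'
    rw [ENNReal.rpow_eq_zero_iff_of_pos (by norm_num), mul_eq_zero] at h
    have hI := h.resolve_left (by simpa using hc)
    have hm := measurable_kernel hu
    have hm1 : Measurable (fun p : 𝔼 × 𝔼 => ENNReal.ofReal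
      (|u p.1 - u p.2| ^ 2 / ‖p.1 - p.2‖ ^ ((N : ℝ) + 2 * s))) := by fun_prop
    rw [lintegral_eq_zero_iff hm1.lintegral_prod_right'] at hI
    filter_upwards [hI] with x hx
    simp only [Pi.zero_apply] at hx
    have hx := (lintegral_eq_zero_iff (hm1.comp measurable_prodMk_left)).1 hx
    have hfreq : ∃ᵐ y ∂(volume : Measure 𝔼), y ∈ Ωᶜ :=
      frequently_ae_mem_iff.2 (compl_measure_pos hΩ)
    obtain ⟨y, hy, hxy, huy⟩ := (hfreq.and_eventually (hx.and h0)).exists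
    rcases eq_or_ne x y with rfl | hne
    · exact huy hy
    · have h5 : 0 < ‖x - y‖ := norm_pos_iff.2 (sub_ne_zero.2 hne)
      have h6 : |u x - u y| ^ 2 / ‖x - y‖ ^ ((N : ℝ) + 2 * s) ≤ 0 := by simpa using hxy
      have h7 : |u x - u y| ^ 2 = 0 := by
        by_contra h8
        have : 0 < |u x - u y| ^ 2 := by positivity
        exact absurd h6 (not_le.2 (by positivity))
      have h9 := huy hy
      simpa [h9] using h7

theorem ae_eq_zero_of_energyNorm_eq_zero {Ω : Set 𝔼} (hΩ : Bornology.IsBounded Ω)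
    {μ : Measure unitInterval} (hμ : μ ≠ 0) {u : 𝔼 → ℝ} (hu : Measurable u)
    (h0 : ∀ᵐ x, x ∉ Ω → u x = 0) (h : energyNorm μ u = 0) : u =ᵐ[volume] 0 := by
  unfold energyNorm at h
  rw [ENNReal.rpow_eq_zero_iff_of_pos (by norm_num)] at h
  have h := (lintegral_eq_zero_iff
    (((measurable_gagliardo hu).comp measurable_subtype_coe).pow_const _)).1 h
  have : NeBot (ae μ) := ae_neBot.2 hμ
  obtain ⟨s, hs⟩ := h.exists
  refine ae_eq_zero_of_gagliardo_eq_zero hΩ s.2.1 s.2.2 hu h0 ?_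
  simpa using hs

/-- The set of (classes of) measurable functions `u : ℝ^N → ℝ` that vanish outside `Ω` and satisfy
`∫_{[0,1]} [u]_s² dμ⁺(s) < ⊤`, as a vector space. -/
def X0Submodule (Ω : Set (EuclideanSpace ℝ (Fin N))) (μp : Measure unitInterval) :
    Submodule ℝ (EuclideanSpace ℝ (Fin N) →ₘ[volume] ℝ) where
  carrier := {u | (∀ᵐ x, x ∉ Ω → u x = 0) ∧ energyNorm μp u < ⊤}
  add_mem' := by
    rintro u v ⟨hu, hu'⟩ ⟨hv, hv'⟩
    constructor
    · filter_upwards [hu, hv, AEEqFun.coeFn_add u v] with x h1 h2 h3 hx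
      rw [h3, Pi.add_apply, h1 hx, h2 hx, add_zero]
    · rw [energyNorm_congr μp (AEEqFun.coeFn_add u v)]
      exact (energyNorm_add_le μp u.measurable v.measurable).trans_lt (ENNReal.add_lt_top.2 ⟨hu', hv'⟩)
  zero_mem' := by
    constructor
    · filter_upwards [AEEqFun.coeFn_zero (α := 𝔼) (β := ℝ) (μ := volume)] with x h1 hx
      rw [h1, Pi.zero_apply]
    · rw [energyNorm_congr μp AEEqFun.coeFn_zero]
      have := energyNorm_smul_le μp (0 : ℝ) (0 : 𝔼 → ℝ)
      rw [zero_smul, enorm_zero, zero_mul] at this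
      exact this.trans_lt ENNReal.zero_lt_top
  smul_mem' := by
    rintro a u ⟨hu, hu'⟩
    constructor
    · filter_upwards [hu, AEEqFun.coeFn_smul a u] with x h1 h3 hx
      rw [h3, Pi.smul_apply, h1 hx, smul_zero]
    · rw [energyNorm_congr μp (AEEqFun.coeFn_smul a u)]
      exact (energyNorm_smul_le μp a u).trans_lt (ENNReal.mul_lt_top enorm_lt_top hu')

variable {Ω : Set (EuclideanSpace ℝ (Fin N))} {μp : Measure unitInterval} {sbar : unitInterval}

/-- The space `X₀(Ω)` for a bounded `Ω` and a measure `μ⁺` with `μ⁺([s̄,1]) > 0`; the two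
assumptions ensure that its norm, defined below, is definite. -/
def X0 (_hΩ : Bornology.IsBounded Ω) (_hμ : 0 < μp (Icc sbar 1)) : Type :=
  ↥(X0Submodule Ω μp)

namespace X0

variable {hΩ : Bornology.IsBounded Ω} {hμ : 0 < μp (Icc sbar 1)}

instance : AddCommGroup (X0 hΩ hμ) := inferInstanceAs (AddCommGroup (X0Submodule Ω μp))

instance : Module ℝ (X0 hΩ hμ) := inferInstanceAs (Module ℝ (X0Submodule Ω μp))

/-- An element of `X₀(Ω)` as a function on `ℝ^N`. -/
def fn (u : X0 hΩ hμ) : EuclideanSpace ℝ (Fin N) → ℝ :=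
  ⇑u.1

/-- The norm `‖u‖_{X₀(Ω)} = (∫_{[0,1]} [u]_s² dμ⁺(s))^{1/2}`. -/
instance : Norm (X0 hΩ hμ) := ⟨fun u => (energyNorm μp u.fn).toReal⟩

theorem norm_def (u : X0 hΩ hμ) : ‖u‖ = (energyNorm μp u.fn).toReal := rfl

theorem energyNorm_lt_top (u : X0 hΩ hμ) : energyNorm μp u.fn < ⊤ := u.2.2

theorem norm_smul_le' (a : ℝ) (u : X0 hΩ hμ) : ‖a • u‖ ≤ |a| * ‖u‖ := by
  have h1 : energyNorm μp (a • u).fn ≤ ‖a‖ₑ * energyNorm μp u.fn := by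
    exact (energyNorm_congr μp (AEEqFun.coeFn_smul a u.1)).trans_le (energyNorm_smul_le μp a _)
  have h2 := ENNReal.toReal_mono (ENNReal.mul_ne_top enorm_ne_top u.energyNorm_lt_top.ne) h1
  simpa [norm_def] using h2

theorem core : NormedSpace.Core ℝ (X0 hΩ hμ) where
  norm_nonneg u := ENNReal.toReal_nonneg
  norm_smul a u := by
    refine le_antisymm (norm_smul_le' a u) ?_
    rcases eq_or_ne a 0 with rfl | ha
    · rw [norm_zero, zero_mul]
      exact ENNReal.toReal_nonneg
    · have h := norm_smul_le' a⁻¹ (a • u)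
      rw [smul_smul, inv_mul_cancel₀ ha, one_smul, abs_inv] at h
      rw [Real.norm_eq_abs]
      calc |a| * ‖u‖ ≤ |a| * (|a|⁻¹ * ‖a • u‖) := by gcongr
        _ = ‖a • u‖ := by field_simp
  norm_triangle u v := by
    have h1 : energyNorm μp (u + v).fn ≤ energyNorm μp u.fn + energyNorm μp v.fn :=
      (energyNorm_congr μp (AEEqFun.coeFn_add u.1 v.1)).trans_le
        (energyNorm_add_le μp u.1.measurable v.1.measurable)
    rw [norm_def, norm_def, norm_def,
      ← ENNReal.toReal_add u.energyNorm_lt_top.ne v.energyNorm_lt_top.ne]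
    exact ENNReal.toReal_mono (ENNReal.add_lt_top.2 ⟨u.energyNorm_lt_top, v.energyNorm_lt_top⟩).ne h1
  norm_eq_zero_iff u := by
    constructor
    · intro h
      have h1 : energyNorm μp u.fn = 0 :=
        ((ENNReal.toReal_eq_zero_iff _).1 h).resolve_right u.energyNorm_lt_top.ne
      have hne : μp ≠ 0 := by
        rintro rfl
        simp at hμ
      have h2 := ae_eq_zero_of_energyNorm_eq_zero hΩ hne u.1.measurable u.2.1 h1
      exact Subtype.ext (AEEqFun.ext (h2.trans AEEqFun.coeFn_zero.symm))
    · rintro rfl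
      have h := norm_smul_le' 0 (0 : X0 hΩ hμ)
      rw [zero_smul, abs_zero, zero_mul] at h
      exact le_antisymm h ENNReal.toReal_nonneg

instance : NormedAddCommGroup (X0 hΩ hμ) := NormedAddCommGroup.ofCore core

instance : NormedSpace ℝ (X0 hΩ hμ) := NormedSpace.ofCore core

end X0

/-- The inner product `⟨u, v⟩` of `X₀(Ω)`. -/
def posForm {hΩ : Bornology.IsBounded Ω} {hμ : 0 < μp (Icc sbar 1)} (u v : X0 hΩ hμ) : ℝ :=
  ∫ s : unitInterval, gagliardoForm (s : ℝ) u.fn v.fn ∂μp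

/-- The bilinear form `(u, v)` associated with `μ⁻`. -/
def negForm {hΩ : Bornology.IsBounded Ω} {hμ : 0 < μp (Icc sbar 1)} (μm : Measure unitInterval)
    (u v : X0 hΩ hμ) : ℝ :=
  ∫ s in Icc 0 sbar, gagliardoForm (s : ℝ) u.fn v.fn ∂μm

/-- The spectrum `σ(A_μ)`: the real `λ` for which the Dirichlet problem `A_μ u = λ u` in `Ω`,
`u = 0` outside `Ω`, has a nonzero weak solution in `X₀(Ω)`. -/
def dirichletSpectrum (hΩ : Bornology.IsBounded Ω) (hμ : 0 < μp (Icc sbar 1)) (μm : Measure unitInterval) :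
    Set ℝ :=
  {lam | ∃ u : X0 hΩ hμ, u ≠ 0 ∧
    ∀ v : X0 hΩ hμ, posForm u v - negForm μm u v = lam * ∫ x in Ω, u.fn x * v.fn x}

/-- The functional `J(u) = ½ ‖u‖² - (λ̄/2) ∫_Ω u² - ∫_Ω F(x,u)` with `‖u‖² = ⟨u,u⟩ - (u,u)` and
`F(x,t) = ∫_0^t f(x,τ) dτ`. -/
def energyFunctional (hΩ : Bornology.IsBounded Ω) (hμ : 0 < μp (Icc sbar 1)) (μm : Measure unitInterval)
    (lam : ℝ) (f : EuclideanSpace ℝ (Fin N) → ℝ → ℝ) (u : X0 hΩ hμ) : ℝ :=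
  1 / 2 * (posForm u u - negForm μm u u) - lam / 2 * (∫ x in Ω, u.fn x ^ 2)
    - ∫ x in Ω, ∫ τ in (0 : ℝ)..(u.fn x), f x τ

/-- `f : Ω × ℝ → ℝ` is a Carathéodory function. -/
def IsCaratheodory {N : ℕ} (Ω : Set (EuclideanSpace ℝ (Fin N)))
    (f : EuclideanSpace ℝ (Fin N) → ℝ → ℝ) : Prop :=
  (∀ t : ℝ, AEMeasurable (fun x => f x t) (volume.restrict Ω)) ∧
    ∀ᵐ x ∂(volume.restrict Ω), Continuous (f x)

/-- The Palais–Smale condition at the level `c`. -/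
def PalaisSmaleAt {E : Type*} [NormedAddCommGroup E] [NormedSpace ℝ E] (I : E → ℝ) (c : ℝ) : Prop :=
  ∀ u : ℕ → E, Tendsto (fun n => I (u n)) atTop (𝓝 c) →
    Tendsto (fun n => fderiv ℝ I (u n)) atTop (𝓝 (0 : E →L[ℝ] ℝ)) →
      ∃ φ : ℕ → ℕ, StrictMono φ ∧ ∃ v : E, Tendsto (fun n => u (φ n)) atTop (𝓝 v)

end

end Superposition

open Superposition

/-! Let `ι` be the embedding of `X₀(Ω)` into `L²(Ω)`, let `B(u,v) = ⟨u,v⟩ - (u,v) - λ̄ ∫_Ω uv`, and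
let `Φ(y) = ∫_Ω F(x,y)` on `L²(Ω)`, so that `J(u) = ½ B(u,u) - Φ(ι u)`. The abstract argument,
`contDiff_and_palaisSmale`, rests on four facts: the Gårding inequality `½‖u‖² ≤ B(u,u) + |λ̄| ‖ι
u‖²`, the compactness of `ι`, the injectivity of `u ↦ B(u,·)`, which is what `λ̄ ∉ σ(A_μ)` says, and
the continuity and sublinear growth of `∇Φ`, the superposition operator of `f`. With completeness,
the first three yield `κ‖u‖ ≤ ‖B(u,·)‖` for some `κ > 0`. For a Palais–Smale sequence `B(u_n,·) =
J'(u_n) + ⟪∇Φ(ι u_n), ι ·⟫`, and sublinearity bounds `u_n`. Along a subsequence `ι u_n` converges,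
hence so does `B(u_n,·)`, and the Gårding inequality applied to differences makes `u_n` Cauchy.

The facts about the space come from the Fourier transform. If `u ∈ L²` vanishes outside the bounded
set `Ω`, then `[u]_s² = ∫ |2πξ|^{2s} |û(ξ)|² dξ` for every `s ∈ [0,1]` (`gagliardo_sq`). All the
seminorms are thus weighted `L²` norms of one function, and integrating over `s` turns the energy
into the `L²` norm of `û` for a single measure on frequency space (`energyNorm_eq_eLpNorm`,
`integral_gagliardoForm`).

Boundedness of `Ω` gives `|û(ξ)|² ≤ |closure Ω| ‖u‖²`, so a small ball of frequencies carries at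
most half of the `L²` norm. This is Poincaré's inequality with a constant uniform in `s`, and it
leads to `[u]_s² ≤ C [u]_{s'}²` for `s ≤ s'` with `C` depending on `N` and `Ω` only
(`exists_spectralEnergy_le`). Comparing orders below `s̄` with orders above it gives `(u,u) ≤ C γ
‖u‖_{X₀}²`, so `γ₀ = 1/(2C)` makes the Gårding inequality true. For compactness, weak `L²`
convergence on a bounded set is pointwise convergence of the Fourier transforms, and the high
frequencies are uniformly small because the energy of order `s̄ > 0` is bounded
(`exists_subseq_cauchy`). Completeness follows from Fatou's lemma in frequency space. -/

namespace Superposition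

/-! ### The abstract Palais–Smale argument for nonresonant forms. -/

section PalaisSmale

variable {X Y : Type*} [NormedAddCommGroup X] [NormedSpace ℝ X] [NormedAddCommGroup Y]
  [InnerProductSpace ℝ Y]

/-- Under a Gårding inequality, a bounded sequence whose images under the form and under the
lower order map are Cauchy is itself Cauchy. -/
theorem cauchySeq_of_garding {B : X →L[ℝ] X →L[ℝ] ℝ} {ι : X →L[ℝ] Y} {c K M : ℝ} (hc : 0 < c)
    (hK : 0 ≤ K) (hB : ∀ u, c * ‖u‖ ^ 2 ≤ B u u + K * ‖ι u‖ ^ 2) {u : ℕ → X}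
    (hu : ∀ n, ‖u n‖ ≤ M) (h1 : CauchySeq fun n => B (u n)) (h2 : CauchySeq fun n => ι (u n)) :
    CauchySeq u := by
  have hM : 0 ≤ M := (norm_nonneg _).trans (hu 0)
  rw [Metric.cauchySeq_iff] at h1 h2 ⊢
  intro ε hε
  obtain ⟨δ, hδ, hδε⟩ : ∃ δ : ℝ, 0 < δ ∧ δ * (2 * M) + K * δ ^ 2 < c * ε ^ 2 := by
    have hcont : Tendsto (fun δ : ℝ => δ * (2 * M) + K * δ ^ 2) (𝓝[>] 0) (𝓝 0) := by
      have : Continuous fun δ : ℝ => δ * (2 * M) + K * δ ^ 2 := by fun_prop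
      have h := this.tendsto 0
      simp only [zero_mul, ne_eq, OfNat.ofNat_ne_zero, not_false_eq_true, zero_pow, mul_zero,
        add_zero] at h
      exact h.mono_left nhdsWithin_le_nhds
    have hpos : 0 < c * ε ^ 2 := by positivity
    obtain ⟨δ, h, h'⟩ := ((hcont.eventually (gt_mem_nhds hpos)).and self_mem_nhdsWithin).exists
    exact ⟨δ, h', h⟩
  obtain ⟨n1, hn1⟩ := h1 δ hδ
  obtain ⟨n2, hn2⟩ := h2 δ hδ
  refine ⟨max n1 n2, fun m hm n hn => ?_⟩
  have k1 := hn1 m (le_of_max_le_left hm) n (le_of_max_le_left hn)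
  have k2 := hn2 m (le_of_max_le_right hm) n (le_of_max_le_right hn)
  rw [dist_eq_norm, ← map_sub] at k1 k2
  rw [dist_eq_norm]
  -- Only the functional has to be small: its argument stays in the ball of radius `2M`.
  have k3 : B (u m - u n) (u m - u n) ≤ δ * (2 * M) := by
    refine (le_abs_self _).trans (((B (u m - u n)).le_opNorm _).trans ?_)
    gcongr
    linarith [norm_sub_le (u m) (u n), hu m, hu n]
  have k4 : K * ‖ι (u m - u n)‖ ^ 2 ≤ K * δ ^ 2 := by gcongr
  have k5 : c * ‖u m - u n‖ ^ 2 < c * ε ^ 2 := by linarith [hB (u m - u n)]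
  exact lt_of_pow_lt_pow_left₀ 2 hε.le (lt_of_mul_lt_mul_left k5 hc.le)

/-- A form that satisfies a Gårding inequality relative to a compact map and has trivial kernel
is bounded below. -/
theorem exists_antilipschitz_of_garding [CompleteSpace X] {B : X →L[ℝ] X →L[ℝ] ℝ}
    {ι : X →L[ℝ] Y} {c K : ℝ} (hc : 0 < c) (hK : 0 ≤ K)
    (hB : ∀ u, c * ‖u‖ ^ 2 ≤ B u u + K * ‖ι u‖ ^ 2)
    (hι : ∀ (u : ℕ → X) (M : ℝ), (∀ n, ‖u n‖ ≤ M) →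
      ∃ φ : ℕ → ℕ, StrictMono φ ∧ CauchySeq fun n => ι (u (φ n)))
    (hinj : ∀ u, B u = 0 → u = 0) : ∃ κ : ℝ, 0 < κ ∧ ∀ u, κ * ‖u‖ ≤ ‖B u‖ := by
  -- Otherwise there are unit vectors with `B u_n → 0`. Compactness and the Gårding inequality give
  -- a convergent subsequence, whose limit is a unit vector in the kernel.
  by_contra! hcon
  have hex : ∀ n : ℕ, ∃ u : X, ‖u‖ = 1 ∧ ‖B u‖ < 1 / ((n : ℝ) + 1) := by
    intro n
    obtain ⟨u, hu⟩ := hcon (1 / ((n : ℝ) + 1)) (by positivity)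
    have hu0 : 0 < ‖u‖ := by
      refine norm_pos_iff.2 ?_
      rintro rfl
      simp at hu
    refine ⟨‖u‖⁻¹ • u, ?_, ?_⟩
    · rw [norm_smul, norm_inv, norm_norm, inv_mul_cancel₀ hu0.ne']
    · rw [map_smul, norm_smul, norm_inv, norm_norm, inv_mul_lt_iff₀ hu0, mul_comm]
      exact hu
  choose u hu1 hu2 using hex
  obtain ⟨φ, hφ, hcs⟩ := hι u 1 fun n => (hu1 n).le
  have hB0 : Tendsto (fun n => B (u (φ n))) atTop (𝓝 0) := by
    have : Tendsto (fun n => B (u n)) atTop (𝓝 0) :=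
      squeeze_zero_norm (fun n => (hu2 n).le) tendsto_one_div_add_atTop_nhds_zero_nat
    exact this.comp hφ.tendsto_atTop
  have hcau := cauchySeq_of_garding hc hK hB (u := fun n => u (φ n)) (fun n => (hu1 _).le)
    hB0.cauchySeq hcs
  obtain ⟨v, hv⟩ := cauchySeq_tendsto_of_complete hcau
  have hv1 : ‖v‖ = 1 := by
    refine tendsto_nhds_unique hv.norm ?_
    simp [hu1]
  have hBv : B v = 0 := tendsto_nhds_unique ((B.continuous.tendsto v).comp hv) hB0
  rw [hinj v hBv, norm_zero] at hv1
  exact zero_ne_one hv1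

/-- An asymptotically quadratic functional `½ B(u,u) - Φ(ι u)` is of class `C¹` and satisfies the
Palais–Smale condition at every level if the form `B` is nonresonant, satisfies a Gårding
inequality relative to the compact map `ι`, and the gradient of `Φ` is continuous and sublinear. -/
theorem contDiff_and_palaisSmale [CompleteSpace X] [CompleteSpace Y] {B : X →L[ℝ] X →L[ℝ] ℝ}
    {ι : X →L[ℝ] Y} {c K : ℝ} (hsymm : ∀ u v, B u v = B v u) (hc : 0 < c) (hK : 0 ≤ K)
    (hB : ∀ u, c * ‖u‖ ^ 2 ≤ B u u + K * ‖ι u‖ ^ 2)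
    (hι : ∀ (u : ℕ → X) (M : ℝ), (∀ n, ‖u n‖ ≤ M) →
      ∃ φ : ℕ → ℕ, StrictMono φ ∧ CauchySeq fun n => ι (u (φ n)))
    (hinj : ∀ u, B u = 0 → u = 0) {Φ : Y → ℝ} {G : Y → Y} (hG : Continuous G)
    (hΦ : ∀ y, HasFDerivAt Φ (innerSL ℝ (G y)) y)
    (hsub : ∀ ε : ℝ, 0 < ε → ∃ C : ℝ, ∀ y, ‖G y‖ ≤ C + ε * ‖y‖)
    {J : X → ℝ} (hJ : ∀ u, J u = 1 / 2 * B u u - Φ (ι u)) :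
    ContDiff ℝ 1 J ∧ ∀ c : ℝ, PalaisSmaleAt J c := by
  have hJ' : ∀ u, HasFDerivAt J (B u - (innerSL ℝ (G (ι u))).comp ι) u := by
    intro u
    have h1 : HasFDerivAt (fun u => B u u) ((2 : ℝ) • B u) u := by
      refine (B.hasFDerivAt.clm_apply (hasFDerivAt_id u)).congr_fderiv ?_
      ext v
      simp [hsymm v u, two_mul]
    have h2 := (h1.const_mul (1 / 2)).sub ((hΦ (ι u)).comp u ι.hasFDerivAt)
    have h3 : J = (fun u => 1 / 2 * B u u) - (Φ ∘ ι) := by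
      ext u
      simp [hJ]
    rw [h3]
    refine h2.congr_fderiv ?_
    rw [smul_smul]
    norm_num
  have hcd : ContDiff ℝ 1 J := by
    rw [contDiff_one_iff_hasFDerivAt]
    refine ⟨_, ?_, hJ'⟩
    have : Continuous fun u => (innerSL ℝ (G (ι u))).comp ι :=
      ((innerSL ℝ).continuous.comp (hG.comp ι.continuous)).clm_comp continuous_const
    exact B.continuous.sub this
  refine ⟨hcd, fun lev u _ hu => ?_⟩
  obtain ⟨κ, hκ, hκB⟩ := exists_antilipschitz_of_garding hc hK hB hι hinj
  have hdJ : ∀ n, B (u n) = fderiv ℝ J (u n) + (innerSL ℝ (G (ι (u n)))).comp ι := fun n => by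
    rw [(hJ' (u n)).fderiv, sub_add_cancel]
  -- With this `ε` the nonlinear term absorbs at most half of `κ‖u‖`; the `+ 1` in the witness
  -- covers `ι = 0`.
  obtain ⟨ε, hε, hεκ⟩ : ∃ ε : ℝ, 0 < ε ∧ ε * ‖ι‖ ^ 2 ≤ κ / 2 :=
    ⟨κ / (2 * (‖ι‖ ^ 2 + 1)), by positivity, by
      rw [div_mul_eq_mul_div, div_le_div_iff₀ (by positivity) (by positivity)]
      nlinarith⟩
  obtain ⟨C, hC⟩ := hsub ε hε
  obtain ⟨D, hD⟩ := hu.norm.isBoundedUnder_le.bddAbove_range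
  have hbdd : ∀ n, ‖u n‖ ≤ (D + C * ‖ι‖) / (κ / 2) := by
    intro n
    have e1 : ‖fderiv ℝ J (u n)‖ ≤ D := hD ⟨n, rfl⟩
    have e2 : ‖(innerSL ℝ (G (ι (u n)))).comp ι‖ ≤ ‖G (ι (u n))‖ * ‖ι‖ := by
      refine (ContinuousLinearMap.opNorm_comp_le _ _).trans ?_
      rw [innerSL_apply_norm]
    have e3 : ‖G (ι (u n))‖ ≤ C + ε * (‖ι‖ * ‖u n‖) :=
      (hC _).trans (by gcongr; exact ι.le_opNorm _)
    have e4 : κ * ‖u n‖ ≤ D + (C + ε * (‖ι‖ * ‖u n‖)) * ‖ι‖ := by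
      refine (hκB _).trans ?_
      rw [hdJ]
      refine (norm_add_le _ _).trans (add_le_add e1 (e2.trans ?_))
      gcongr
    have e5 : ε * ‖ι‖ ^ 2 * ‖u n‖ ≤ κ / 2 * ‖u n‖ := by gcongr
    rw [le_div_iff₀ (by positivity)]
    nlinarith
  obtain ⟨φ, hφ, hcs⟩ := hι u _ hbdd
  obtain ⟨y, hy⟩ := cauchySeq_tendsto_of_complete hcs
  -- Convergence of `ι u_n` in `Y` and `J'(u_n) → 0` force `B u_n` to converge in the dual, so the
  -- Gårding argument applies once more.
  have hconv : Tendsto (fun n => B (u (φ n))) atTop (𝓝 (0 + (innerSL ℝ (G y)).comp ι)) := by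
    simp_rw [hdJ]
    refine (hu.comp hφ.tendsto_atTop).add ?_
    have : Continuous fun y => (innerSL ℝ (G y)).comp ι :=
      ((innerSL ℝ).continuous.comp hG).clm_comp continuous_const
    exact (this.tendsto y).comp hy
  have hcau := cauchySeq_of_garding hc hK hB (u := fun n => u (φ n)) (fun n => hbdd _)
    hconv.cauchySeq hcs
  exact ⟨φ, hφ, cauchySeq_tendsto_of_complete hcau⟩

end PalaisSmale

/-! ### The superposition operator on `L²` and its primitive. -/

section Nemytskii

variable {α : Type*} [MeasurableSpace α] {ν : Measure α}

/-- A Carathéodory function coincides, for almost every `x`, with a jointly measurable one. -/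
theorem exists_measurable_caratheodory {f : α → ℝ → ℝ} (h1 : ∀ t, AEMeasurable (fun x => f x t) ν)
    (h2 : ∀ᵐ x ∂ν, Continuous (f x)) :
    ∃ g : α → ℝ → ℝ, Measurable (Function.uncurry g) ∧ (∀ x, Continuous (g x)) ∧
      ∀ᵐ x ∂ν, f x = g x := by
  classical
  -- Countably many rational times cost a single null set; continuity recovers all other times
  -- outside it.
  have hae : ∀ᵐ x ∂ν, Continuous (f x) ∧ ∀ q : ℚ, f x q = (h1 q).mk _ x :=
    h2.and (ae_all_iff.2 fun q => (h1 q).ae_eq_mk)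
  obtain ⟨S, hS, hSm, hS0⟩ := exists_measurable_superset_of_null (ae_iff.1 hae)
  have hA : ∀ x ∈ Sᶜ, Continuous (f x) ∧ ∀ q : ℚ, f x q = (h1 q).mk _ x := fun x hx => by
    by_contra hcon
    exact hx (hS hcon)
  let g : α → ℝ → ℝ := fun x t => if x ∈ Sᶜ then f x t else 0
  have hgc : ∀ x, Continuous (g x) := fun x => by
    by_cases hx : x ∈ Sᶜ
    · simpa only [g, hx, if_true] using (hA x hx).1
    · simpa only [g, hx, if_false] using continuous_const
  have hgm : ∀ t, Measurable fun x => g x t := by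
    intro t
    -- At a real time, `g` is the pointwise limit of its values at rational times, where it is given
    -- by measurable representatives.
    obtain ⟨r, hrmem, hr⟩ := mem_closure_iff_seq_limit.1 (Rat.denseRange_cast (𝕜 := ℝ) t)
    choose q hq using hrmem
    refine measurable_of_tendsto_metrizable (f := fun n x => if x ∈ Sᶜ then (h1 (q n)).mk _ x else 0)
      (fun n => Measurable.ite hSm.compl (h1 (q n)).measurable_mk measurable_const) ?_
    refine tendsto_pi_nhds.2 fun x => ?_
    by_cases hx : x ∈ Sᶜ
    · simp only [hx, if_true, g]
      have h3 := ((hA x hx).1.tendsto t).comp hr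
      refine h3.congr fun n => ?_
      rw [Function.comp_apply, ← hq n, (hA x hx).2]
    · simp only [hx, if_false, g]
      exact tendsto_const_nhds
  refine ⟨g, ?_, hgc, ?_⟩
  · exact (measurable_uncurry_of_continuous_of_measurable (u := fun t x => g x t) hgc hgm).comp
      measurable_swap
  · have : ∀ᵐ x ∂ν, x ∈ Sᶜ := by
      rw [ae_iff]
      simpa using hS0
    filter_upwards [this] with x hx
    funext t
    simp only [g, hx, if_true]

/-- A dominated sequence tending to zero almost everywhere tends to zero in `L²`. -/
theorem tendsto_eLpNorm_two_of_dominated {E : Type*} [NormedAddCommGroup E] {d : ℕ → α → E}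
    {D : α → ℝ} (hd : ∀ n, AEStronglyMeasurable (d n) ν) (hD : MemLp D 2 ν)
    (hle : ∀ n, ∀ᵐ x ∂ν, ‖d n x‖ ≤ D x) (hlim : ∀ᵐ x ∂ν, Tendsto (fun n => d n x) atTop (𝓝 0)) :
    Tendsto (fun n => eLpNorm (d n) 2 ν) atTop (𝓝 0) := by
  have h1 : Tendsto (fun n => ∫⁻ x, ‖d n x‖ₑ ^ (2 : ℝ) ∂ν) atTop (𝓝 (∫⁻ _, 0 ∂ν)) := by
    refine tendsto_lintegral_of_dominated_convergence' (fun x => ‖D x‖ₑ ^ (2 : ℝ))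
      (fun n => (hd n).enorm.pow_const _) (fun n => ?_) ?_ ?_
    · filter_upwards [hle n] with x hx
      gcongr
      exact enorm_le_iff_norm_le.2 (hx.trans (le_abs_self _))
    · have := (lintegral_rpow_enorm_lt_top_of_eLpNorm_lt_top two_ne_zero ENNReal.ofNat_ne_top hD.2).ne
      simpa using this
    · filter_upwards [hlim] with x hx
      have h2 := (ENNReal.continuous_rpow_const (y := 2)).tendsto _ |>.comp hx.enorm
      simpa [Function.comp_def] using h2
  rw [lintegral_zero] at h1
  have h3 := (ENNReal.continuous_rpow_const (y := 1 / 2)).tendsto _ |>.comp h1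
  simp only [eLpNorm_eq_lintegral_rpow_enorm_toReal two_ne_zero ENNReal.ofNat_ne_top]
  simpa [Function.comp_def] using h3

/-- Local boundedness and sublinearity at infinity give arbitrarily small linear growth. -/
theorem exists_growth_bound {f : α → ℝ → ℝ} (hfc : ∀ᵐ x ∂ν, Continuous (f x))
    (h1 : ∀ τ : ℝ, 0 < τ → MemLp (fun x => ⨆ t : Icc (-τ) τ, |f x t|) ⊤ ν)
    (h2 : ∀ ε : ℝ, 0 < ε → ∃ R : ℝ, 0 < R ∧ ∀ᵐ x ∂ν, ∀ t : ℝ, R ≤ |t| → |f x t / t| < ε)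
    {ε : ℝ} (hε : 0 < ε) : ∃ C : ℝ, ∀ᵐ x ∂ν, ∀ t, |f x t| ≤ C + ε * |t| := by
  obtain ⟨R, hR, hR2⟩ := h2 ε hε
  have hM := (h1 R hR).2
  rw [eLpNorm_exponent_top] at hM
  -- For `|t| ≤ R` the essential supremum serves as the constant; for `|t| ≥ R` the slope `ε`
  -- suffices.
  refine ⟨(eLpNormEssSup (fun x => ⨆ t : Icc (-R) R, |f x t|) ν).toReal, ?_⟩
  filter_upwards [hfc, hR2, enorm_ae_le_eLpNormEssSup (fun x => ⨆ t : Icc (-R) R, |f x t|) ν]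
    with x hx1 hx2 hx3 t
  rcases le_total R |t| with ht | ht
  · have ht0 : 0 < |t| := hR.trans_le ht
    have h3 := hx2 t ht
    rw [abs_div, div_lt_iff₀ ht0] at h3
    exact h3.le.trans (le_add_of_nonneg_left ENNReal.toReal_nonneg)
  · have hbdd : BddAbove (range fun t : Icc (-R) R => |f x t|) :=
      (isCompact_range (hx1.comp continuous_subtype_val).abs).bddAbove
    have h3 : |f x t| ≤ ⨆ t : Icc (-R) R, |f x t| := le_ciSup hbdd ⟨t, abs_le.1 ht⟩
    have h4 := ENNReal.toReal_mono hM.ne hx3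
    rw [toReal_enorm] at h4
    have h5 : 0 ≤ ε * |t| := by positivity
    linarith [Real.le_norm_self (⨆ t : Icc (-R) R, |f x t|)]

variable [IsFiniteMeasure ν] {g : α → ℝ → ℝ}

theorem memLp_superposition (hg : Measurable (Function.uncurry g)) {C ε : ℝ}
    (hC : ∀ᵐ x ∂ν, ∀ t, |g x t| ≤ C + ε * |t|) {u : α → ℝ} (hu : MemLp u 2 ν) :
    MemLp (fun x => g x (u x)) 2 ν := by
  have hD : MemLp (fun x => C + ε * |u x|) 2 ν := (memLp_const C).add (hu.abs.const_mul ε)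
  refine hD.mono' ?_ ?_
  · have : AEMeasurable (fun x => (x, u x)) ν := aemeasurable_id.prodMk hu.1.aemeasurable
    exact (hg.comp_aemeasurable this).aestronglyMeasurable
  · filter_upwards [hC] with x hx using hx _

/-- The growth condition bounds the difference in terms of `u n`, not by a fixed function.
Truncating at a fixed square integrable `D` makes dominated convergence available, and the part cut
off is at most `|u n - v|`, which tends to zero in `L²`. -/
theorem tendsto_eLpNorm_superposition (hg : Measurable (Function.uncurry g))
    (hgc : ∀ x, Continuous (g x)) {C : ℝ} (hC : ∀ᵐ x ∂ν, ∀ t, |g x t| ≤ C + |t|)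
    {u : ℕ → α → ℝ} {v : α → ℝ} (hu : ∀ n, MemLp (u n) 2 ν) (hv : MemLp v 2 ν)
    (huv : Tendsto (fun n => eLpNorm (u n - v) 2 ν) atTop (𝓝 0))
    (hae : ∀ᵐ x ∂ν, Tendsto (fun n => u n x) atTop (𝓝 (v x))) :
    Tendsto (fun n => eLpNorm (fun x => g x (u n x) - g x (v x)) 2 ν) atTop (𝓝 0) := by
  have hC' : ∀ᵐ x ∂ν, ∀ t, |g x t| ≤ C + 1 * |t| := by simpa using hC
  have hm : ∀ w : α → ℝ, MemLp w 2 ν → AEStronglyMeasurable (fun x => g x (w x)) ν :=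
    fun w hw => (memLp_superposition hg hC' hw).1
  -- The growth bounds at `u n` and `v` together with `|u n| ≤ |u n - v| + |v|` give `|g(u n) -
  -- g(v)| ≤ D + |u n - v|`.
  obtain ⟨D, hDdef⟩ : ∃ D : α → ℝ, D = fun x => 2 * |C| + 2 * |v x| := ⟨_, rfl⟩
  have hD : MemLp D 2 ν := by
    have hK : MemLp (fun _ : α => 2 * |C|) 2 ν := memLp_const _
    have hv2 : MemLp (fun x => 2 * |v x|) 2 ν := hv.abs.const_mul 2
    rw [hDdef]
    exact hK.add hv2
  have hD0 : ∀ x, 0 ≤ D x := fun x => by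
    rw [hDdef]
    positivity
  obtain ⟨d, hd⟩ : ∃ d : ℕ → α → ℝ, d = fun n x => min (|g x (u n x) - g x (v x)|) (D x) :=
    ⟨_, rfl⟩
  have hdm : ∀ n, AEStronglyMeasurable (d n) ν := fun n => by
    have h1 : AEStronglyMeasurable (fun x => |g x (u n x) - g x (v x)|) ν :=
      ((hm _ (hu n)).sub (hm _ hv)).norm
    rw [hd]
    exact h1.inf hD.1
  have hd0 : Tendsto (fun n => eLpNorm (d n) 2 ν) atTop (𝓝 0) := by
    refine tendsto_eLpNorm_two_of_dominated hdm hD (fun n => ae_of_all _ fun x => ?_) ?_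
    · rw [hd, Real.norm_of_nonneg (le_min (abs_nonneg _) (hD0 x))]
      exact min_le_right _ _
    · filter_upwards [hae] with x hx
      have h1 : Tendsto (fun n => |g x (u n x) - g x (v x)|) atTop (𝓝 0) := by
        have := (((hgc x).tendsto _).comp hx).sub_const (g x (v x))
        rw [sub_self] at this
        simpa using this.abs
      have h2 := h1.min (tendsto_const_nhds (x := D x))
      rw [min_eq_left (hD0 x)] at h2
      simpa only [hd] using h2
  refine tendsto_of_tendsto_of_tendsto_of_le_of_le tendsto_const_nhds
    (by simpa using hd0.add huv) (fun _ => zero_le) fun n => ?_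
  have hle : eLpNorm (fun x => g x (u n x) - g x (v x)) 2 ν ≤
      eLpNorm (d n + fun x => ‖(u n - v) x‖) 2 ν := by
    refine eLpNorm_mono_ae_real ?_
    filter_upwards [hC] with x hx
    simp only [Real.norm_eq_abs, Pi.add_apply, Pi.sub_apply, hd]
    have e1 := hx (u n x)
    have e2 := hx (v x)
    have e3 : |g x (u n x) - g x (v x)| ≤ |g x (u n x)| + |g x (v x)| := abs_sub _ _
    have e4 : |u n x| ≤ |u n x - v x| + |v x| := by
      simpa using abs_add_le (u n x - v x) (v x)
    rcases le_total (|g x (u n x) - g x (v x)|) (D x) with h | h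
    · rw [min_eq_left h]
      linarith [abs_nonneg (u n x - v x)]
    · rw [min_eq_right h]
      simp only [hDdef]
      linarith [le_abs_self C]
  refine hle.trans ((eLpNorm_add_le (hdm n) ((hu n).sub hv).1.norm one_le_two).trans ?_)
  rw [eLpNorm_norm]

/-- The superposition operator `u ↦ g(·,u)` on `L²`. -/
noncomputable def superposition (hg : Measurable (Function.uncurry g))
    (hC : ∃ C : ℝ, ∀ᵐ x ∂ν, ∀ t, |g x t| ≤ C + 1 * |t|) (u : Lp ℝ 2 ν) : Lp ℝ 2 ν :=
  (memLp_superposition hg hC.choose_spec (Lp.memLp u)).toLp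

theorem coeFn_superposition (hg : Measurable (Function.uncurry g))
    (hC : ∃ C : ℝ, ∀ᵐ x ∂ν, ∀ t, |g x t| ≤ C + 1 * |t|) (u : Lp ℝ 2 ν) :
    superposition hg hC u =ᵐ[ν] fun x => g x (u x) :=
  MemLp.coeFn_toLp _

/-- The pointwise slope `ε` survives in norm, because constants are square integrable for a finite
measure. This is the sublinearity required of the gradient. -/
theorem norm_superposition_le (hg : Measurable (Function.uncurry g))
    (hC : ∃ C : ℝ, ∀ᵐ x ∂ν, ∀ t, |g x t| ≤ C + 1 * |t|) {C ε : ℝ} (hε : 0 ≤ ε)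
    (h : ∀ᵐ x ∂ν, ∀ t, |g x t| ≤ C + ε * |t|) :
    ∃ C' : ℝ, ∀ u : Lp ℝ 2 ν, ‖superposition hg hC u‖ ≤ C' + ε * ‖u‖ := by
  refine ⟨‖(memLp_const C : MemLp (fun _ : α => C) 2 ν).toLp‖, fun u => ?_⟩
  have hu := Lp.memLp u
  have h1 : ‖superposition hg hC u‖ ≤
      ‖(memLp_const C : MemLp (fun _ : α => C) 2 ν).toLp + ε • (hu.abs).toLp‖ := by
    refine Lp.norm_le_norm_of_ae_le ?_
    filter_upwards [coeFn_superposition hg hC u, h, Lp.coeFn_add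
      (memLp_const C : MemLp (fun _ : α => C) 2 ν).toLp (ε • (hu.abs).toLp),
      (memLp_const C : MemLp (fun _ : α => C) 2 ν).coeFn_toLp, Lp.coeFn_smul ε (hu.abs).toLp,
      (hu.abs).coeFn_toLp] with x h1 h2 h3 h4 h5 h6
    rw [h1, h3, Pi.add_apply, h4, h5, Pi.smul_apply, h6, smul_eq_mul]
    exact (h2 _).trans (le_abs_self _)
  refine h1.trans ((norm_add_le _ _).trans ?_)
  gcongr
  rw [norm_smul, Real.norm_of_nonneg hε]
  gcongr
  refine Lp.norm_le_norm_of_ae_le ?_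
  filter_upwards [(hu.abs).coeFn_toLp] with x hx
  rw [hx]
  simp

/-- Convergence in `L²` gives almost everywhere convergence only along subsequences, and it is
enough that each subsequence has a further one along which the images converge. -/
theorem continuous_superposition (hg : Measurable (Function.uncurry g))
    (hgc : ∀ x, Continuous (g x))
    (hC : ∃ C : ℝ, ∀ᵐ x ∂ν, ∀ t, |g x t| ≤ C + 1 * |t|) :
    Continuous (superposition hg hC) := by
  refine continuous_iff_seqContinuous.2 fun u v huv => ?_
  refine tendsto_of_subseq_tendsto fun ns hns => ?_
  have h1 := huv.comp hns
  obtain ⟨ms, hms, hae⟩ := (tendstoInMeasure_of_tendsto_Lp h1).exists_seq_tendsto_ae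
  refine ⟨ms, ?_⟩
  have h2 := h1.comp hms.tendsto_atTop
  rw [Lp.tendsto_Lp_iff_tendsto_eLpNorm'] at h2
  obtain ⟨C, hC1⟩ := hC
  have h3 := tendsto_eLpNorm_superposition hg hgc (C := C) (by simpa using hC1)
    (u := fun n => u (ns (ms n))) (fun n => Lp.memLp _) (Lp.memLp v) h2 hae
  rw [Lp.tendsto_Lp_iff_tendsto_eLpNorm']
  refine h3.congr fun n => eLpNorm_congr_ae ?_
  filter_upwards [coeFn_superposition hg ⟨C, hC1⟩ v,
    coeFn_superposition hg ⟨C, hC1⟩ (u (ns (ms n)))] with x e1 e2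
  simp [e1, e2]

theorem measurable_primitive (hg : Measurable (Function.uncurry g)) (hgc : ∀ x, Continuous (g x)) :
    Measurable fun p : α × ℝ => ∫ τ in (0 : ℝ)..p.2, g p.1 τ := by
  have h1 : ∀ x, Continuous fun t : ℝ => ∫ τ in (0 : ℝ)..t, g x τ := fun x =>
    intervalIntegral.continuous_primitive (fun a b => (hgc x).intervalIntegrable a b) 0
  have h2 : ∀ t : ℝ, Measurable fun x => ∫ τ in (0 : ℝ)..t, g x τ := fun t => by
    have h3 : ∀ S : Set ℝ, Measurable fun x => ∫ τ in S, g x τ := fun S =>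
      (hg.stronglyMeasurable.integral_prod_right (ν := volume.restrict S)).measurable
    exact (h3 _).sub (h3 _)
  exact (measurable_uncurry_of_continuous_of_measurable
    (u := fun t x => ∫ τ in (0 : ℝ)..t, g x τ) h1 h2).comp measurable_swap

theorem hasDerivAt_primitive (hgc : ∀ x, Continuous (g x)) (x : α) (t : ℝ) :
    HasDerivAt (fun t => ∫ τ in (0 : ℝ)..t, g x τ) (g x t) t :=
  intervalIntegral.integral_hasDerivAt_right ((hgc x).intervalIntegrable _ _)
    (hgc x).stronglyMeasurable.stronglyMeasurableAtFilter (hgc x).continuousAt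

/-- Differentiation under the integral sign: the integrand has derivative `g(u + th) h` in `t`,
which the linear growth of `g` dominates locally uniformly. -/
theorem hasDerivAt_integral_primitive_line (hg : Measurable (Function.uncurry g))
    (hgc : ∀ x, Continuous (g x)) (hC : ∃ C : ℝ, ∀ᵐ x ∂ν, ∀ t, |g x t| ≤ C + 1 * |t|)
    (u h : Lp ℝ 2 ν) (t₀ : ℝ) :
    HasDerivAt (fun t : ℝ => ∫ x, (∫ τ in (0 : ℝ)..((u + t • h : Lp ℝ 2 ν) x), g x τ) ∂ν)
      (inner ℝ (superposition hg hC (u + t₀ • h)) h) t₀ := by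
  obtain ⟨C, hC1⟩ := hC
  have hrep : ∀ t : ℝ, (u + t • h : Lp ℝ 2 ν) =ᵐ[ν] fun x => u x + t * h x := fun t => by
    filter_upwards [Lp.coeFn_add u (t • h), Lp.coeFn_smul t h] with x e1 e2
    rw [e1, Pi.add_apply, e2, Pi.smul_apply, smul_eq_mul]
  have hfun : (fun t : ℝ => ∫ x, (∫ τ in (0 : ℝ)..((u + t • h : Lp ℝ 2 ν) x), g x τ) ∂ν) =
      fun t : ℝ => ∫ x, (∫ τ in (0 : ℝ)..(u x + t * h x), g x τ) ∂ν := by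
    funext t
    refine integral_congr_ae ?_
    filter_upwards [hrep t] with x hx
    rw [hx]
  have hinner : inner ℝ (superposition hg ⟨C, hC1⟩ (u + t₀ • h)) h =
      ∫ x, g x (u x + t₀ * h x) * h x ∂ν := by
    rw [L2.inner_def]
    refine integral_congr_ae ?_
    filter_upwards [hrep t₀, coeFn_superposition hg ⟨C, hC1⟩ (u + t₀ • h)] with x e1 e2
    rw [e2, e1]
    simp [mul_comm]
  rw [hfun, hinner]
  have hu := Lp.memLp u
  have hh := Lp.memLp h
  have hm : ∀ t : ℝ, AEMeasurable (fun x => (x, u x + t * h x)) ν := fun t =>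
    aemeasurable_id.prodMk (hu.1.aemeasurable.add (hh.1.aemeasurable.const_mul t))
  have hFm := measurable_primitive hg hgc
  have hint : ∀ w : α → ℝ, MemLp w 2 ν → Integrable (fun x => (|C| + |w x|) * |w x|) ν :=
    fun w hw => ((memLp_const |C|).add hw.abs).integrable_mul hw.abs
  refine (hasDerivAt_integral_of_dominated_loc_of_deriv_le
    (F := fun t x => ∫ τ in (0 : ℝ)..(u x + t * h x), g x τ)
    (F' := fun t x => g x (u x + t * h x) * h x)
    -- For `|t - t₀| < 1` one has `|t| ≤ |t₀| + 1`, and the rest is the growth bound times `|h|`; a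
    -- product of two `L²` functions is integrable.
    (bound := fun x => (|C| + |u x| + (|t₀| + 1) * |h x|) * |h x|)
    (Metric.ball_mem_nhds t₀ one_pos)
    (Eventually.of_forall fun t => (hFm.comp_aemeasurable (hm t)).aestronglyMeasurable) ?_ ?_ ?_ ?_
    ?_).2
  · have hw : MemLp (fun x => u x + t₀ * h x) 2 ν := hu.add (hh.const_mul t₀)
    refine (hint _ hw).mono' (hFm.comp_aemeasurable (hm t₀)).aestronglyMeasurable ?_
    filter_upwards [hC1] with x hx
    refine (intervalIntegral.norm_integral_le_of_norm_le_const
      (C := |C| + |u x + t₀ * h x|) fun τ hτ => ?_).trans ?_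
    · refine (hx τ).trans ?_
      have : |τ| ≤ |u x + t₀ * h x| := by
        rcases le_total 0 (u x + t₀ * h x) with h0 | h0
        · rw [uIoc_of_le h0] at hτ
          rw [abs_of_pos hτ.1, abs_of_nonneg h0]
          exact hτ.2
        · rw [uIoc_of_ge h0] at hτ
          rw [abs_of_nonpos hτ.2, abs_of_nonpos h0]
          linarith [hτ.1]
      linarith [le_abs_self C]
    · rw [sub_zero]
  · exact ((hg.comp_aemeasurable (hm t₀)).mul hh.1.aemeasurable).aestronglyMeasurable
  · filter_upwards [hC1] with x hx t ht
    have ht' : |t| ≤ |t₀| + 1 := by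
      have h1 : |t - t₀| < 1 := by simpa [Real.dist_eq] using ht
      have h2 := abs_sub_abs_le_abs_sub t t₀
      linarith
    rw [norm_mul, Real.norm_eq_abs, Real.norm_eq_abs]
    refine mul_le_mul_of_nonneg_right ((hx _).trans ?_) (abs_nonneg _)
    have h3 : |u x + t * h x| ≤ |u x| + (|t₀| + 1) * |h x| := by
      refine (abs_add_le _ _).trans ?_
      rw [abs_mul]
      gcongr
    linarith [le_abs_self C]
  · exact (((memLp_const |C|).add hu.abs).add (hh.abs.const_mul _)).integrable_mul hh.abs
  · refine ae_of_all _ fun x t _ => ?_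
    have h1 : HasDerivAt (fun t : ℝ => u x + t * h x) (h x) t := by
      simpa using ((hasDerivAt_id t).mul_const (h x)).const_add (u x)
    exact (hasDerivAt_primitive hgc x (u x + t * h x)).comp t h1

/-- The directional derivatives depend continuously on the base point, and the mean value inequality
on the segment from `u` to `u + h` upgrades them to a Fréchet derivative. -/
theorem hasFDerivAt_integral_primitive (hg : Measurable (Function.uncurry g))
    (hgc : ∀ x, Continuous (g x)) (hC : ∃ C : ℝ, ∀ᵐ x ∂ν, ∀ t, |g x t| ≤ C + 1 * |t|)
    (u : Lp ℝ 2 ν) :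
    HasFDerivAt (fun u : Lp ℝ 2 ν => ∫ x, (∫ τ in (0 : ℝ)..(u x), g x τ) ∂ν)
      (innerSL ℝ (superposition hg hC u)) u := by
  rw [hasFDerivAt_iff_isLittleO_nhds_zero, Asymptotics.isLittleO_iff]
  intro ε hε
  obtain ⟨δ, hδ, hδε⟩ := Metric.continuousAt_iff.1
    ((continuous_superposition hg hgc hC).continuousAt (x := u)) ε hε
  filter_upwards [Metric.ball_mem_nhds (0 : Lp ℝ 2 ν) hδ] with h hh
  rw [mem_ball_zero_iff] at hh
  -- Subtracting the linear part in advance makes the derivative along the segment at most `ε‖h‖`.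
  have hd : ∀ t : ℝ, HasDerivAt (fun t : ℝ => (∫ x, (∫ τ in (0 : ℝ)..((u + t • h : Lp ℝ 2 ν) x),
      g x τ) ∂ν) - t * inner ℝ (superposition hg hC u) h)
      (inner ℝ (superposition hg hC (u + t • h)) h - inner ℝ (superposition hg hC u) h) t :=
    fun t => by
      have h1 : HasDerivAt (fun t : ℝ => t * inner ℝ (superposition hg hC u) h)
          (inner ℝ (superposition hg hC u) h) t := by
        simpa using (hasDerivAt_id t).mul_const (inner ℝ (superposition hg hC u) h)
      exact (hasDerivAt_integral_primitive_line hg hgc hC u h t).sub h1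
  have key := norm_image_sub_le_of_norm_deriv_le_segment_01'
    (fun t _ => (hd t).hasDerivWithinAt) (C := ε * ‖h‖) fun t ht => by
      rw [← inner_sub_left]
      refine (norm_inner_le_norm _ _).trans ?_
      gcongr
      rw [← dist_eq_norm]
      refine (hδε ?_).le
      rw [dist_eq_norm, add_sub_cancel_left, norm_smul]
      refine lt_of_le_of_lt ?_ hh
      refine mul_le_of_le_one_left (norm_nonneg _) ?_
      rw [Real.norm_of_nonneg ht.1]
      exact ht.2.le
  simp only [one_smul, zero_smul, add_zero, one_mul, zero_mul, sub_zero] at key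
  rw [innerSL_apply_apply]
  convert key using 2
  ring

end Nemytskii

/-! ### Fourier transform and Plancherel's identity on `L¹ ∩ L²`. -/

section FourierLemmas

open FourierTransform SchwartzMap

variable {V : Type*} [NormedAddCommGroup V] [InnerProductSpace ℝ V] [FiniteDimensional ℝ V]
  [MeasurableSpace V] [BorelSpace V]

theorem continuous_fourier_of_integrable {f : V → ℂ} (hf : Integrable f) : Continuous (𝓕 f) :=
  VectorFourier.fourierIntegral_continuous Real.continuous_fourierChar
    (by exact continuous_inner) hf

/-- The Fourier transform is self-adjoint on integrable functions. -/
theorem integral_fourier_mul_of_integrable {f g : V → ℂ} (hf : Integrable f) (hg : Integrable g) :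
    ∫ ξ, 𝓕 f ξ * g ξ = ∫ x, f x * 𝓕 g x := by
  have h := VectorFourier.integral_fourierIntegral_smul_eq_flip (μ := volume) (ν := volume)
    (L := innerₗ V) Real.continuous_fourierChar continuous_inner hf hg
  rw [flip_innerₗ] at h
  exact h

/-- Two locally integrable functions with the same integrals against smooth compactly supported
Schwartz functions coincide. -/
theorem ae_eq_of_forall_schwartz {f g : V → ℂ} (hf : LocallyIntegrable f)
    (hg : LocallyIntegrable g) (h : ∀ φ : 𝓢(V, ℂ), ∫ x, φ x * f x = ∫ x, φ x * g x) :
    f =ᵐ[volume] g := by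
  refine ae_eq_of_integral_contDiff_smul_eq hf hg fun φ hφ hc => ?_
  have hc' : HasCompactSupport fun x => (φ x : ℂ) := hc.comp_left (g := Complex.ofReal) rfl
  have h1 := h (hc'.toSchwartzMap (Complex.ofRealCLM.contDiff.comp hφ))
  simp only [Complex.real_smul]
  exact h1

/-- On `L¹ ∩ L²` the two notions of Fourier transform agree. -/
theorem coeFn_fourier_toLp {f : V → ℂ} (hf : Integrable f) (hf2 : MemLp f 2) :
    (𝓕 hf2.toLp : Lp ℂ 2 (volume : Measure V)) =ᵐ[volume] 𝓕 f := by
  refine ae_eq_of_forall_schwartz ((Lp.memLp _).locallyIntegrable one_le_two)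
    (continuous_fourier_of_integrable hf).locallyIntegrable fun φ => ?_
  -- The `L²` transform has no pointwise formula. It is tested against Schwartz functions as a
  -- tempered distribution, while the integral transform is tested through self-adjointness.
  have h1 := congrArg (fun T => T φ) (Lp.fourier_toTemperedDistribution_eq hf2.toLp)
  simp only [TemperedDistribution.fourier_apply, Lp.toTemperedDistribution_apply, smul_eq_mul] at h1
  rw [← h1]
  have h2 : ∫ x, 𝓕 φ x * (hf2.toLp : Lp ℂ 2 (volume : Measure V)) x = ∫ x, 𝓕 (φ : V → ℂ) x * f x := by
    refine integral_congr_ae ?_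
    filter_upwards [hf2.coeFn_toLp] with x hx
    rw [hx, SchwartzMap.fourier_coe]
  rw [h2, integral_fourier_mul_of_integrable φ.integrable hf]

/-- An integrable function whose Fourier transform is in `L²` is in `L²`, and it is the inverse
transform of its Fourier transform. -/
theorem coeFn_fourierInv_toLp {f : V → ℂ} (hf : Integrable f) (hf2 : MemLp (𝓕 f) 2) :
    (𝓕⁻ hf2.toLp : Lp ℂ 2 (volume : Measure V)) =ᵐ[volume] f := by
  refine ae_eq_of_forall_schwartz ((Lp.memLp _).locallyIntegrable one_le_two)
    hf.locallyIntegrable fun φ => ?_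
  have h1 := congrArg (fun T => T φ) (Lp.fourierInv_toTemperedDistribution_eq hf2.toLp)
  simp only [TemperedDistribution.fourierInv_apply, Lp.toTemperedDistribution_apply,
    smul_eq_mul] at h1
  rw [← h1]
  have h2 : ∫ x, 𝓕⁻ φ x * (hf2.toLp : Lp ℂ 2 (volume : Measure V)) x =
      ∫ x, 𝓕 f x * 𝓕⁻ φ x := by
    refine integral_congr_ae ?_
    filter_upwards [hf2.coeFn_toLp] with x hx
    rw [hx, mul_comm]
  rw [h2, integral_fourier_mul_of_integrable hf (𝓕⁻ φ).integrable, ← SchwartzMap.fourier_coe,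
    FourierTransform.fourier_fourierInv_eq]
  simp only [mul_comm]

/-- Needed at order one, where a weak gradient provides only integrability of `u` at the outset. -/
theorem memLp_two_of_memLp_fourier {f : V → ℂ} (hf : Integrable f) (hf2 : MemLp (𝓕 f) 2) :
    MemLp f 2 :=
  (memLp_congr_ae (coeFn_fourierInv_toLp hf hf2)).1 (Lp.memLp _)

theorem eLpNorm_fourier_eq {f : V → ℂ} (hf : Integrable f) (hf2 : MemLp f 2) :
    eLpNorm (𝓕 f) 2 = eLpNorm f 2 := by
  rw [← eLpNorm_congr_ae (coeFn_fourier_toLp hf hf2), ← eLpNorm_congr_ae hf2.coeFn_toLp,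
    ← Lp.enorm_def, ← Lp.enorm_def, ← ofReal_norm, ← ofReal_norm, Lp.norm_fourier_eq]

theorem lintegral_sq_eq_eLpNorm {α E : Type*} [MeasurableSpace α] [NormedAddCommGroup E]
    (μ : Measure α) (f : α → E) :
    ∫⁻ x, ‖f x‖ₑ ^ (2 : ℝ) ∂μ = eLpNorm f 2 μ ^ (2 : ℝ) := by
  rw [eLpNorm_eq_lintegral_rpow_enorm_toReal two_ne_zero ENNReal.ofNat_ne_top, ← ENNReal.rpow_mul]
  simp

/-- Plancherel's identity on `L¹ ∩ L²`. -/
theorem lintegral_fourier_sq {f : V → ℂ} (hf : Integrable f) (hf2 : MemLp f 2) :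
    ∫⁻ ξ, ‖𝓕 f ξ‖ₑ ^ (2 : ℝ) = ∫⁻ x, ‖f x‖ₑ ^ (2 : ℝ) := by
  rw [lintegral_sq_eq_eLpNorm, lintegral_sq_eq_eLpNorm, eLpNorm_fourier_eq hf hf2]

theorem fourier_translate (f : V → ℂ) (h ξ : V) :
    𝓕 (fun x => f (x + h)) ξ =
      Complex.exp ((2 * Real.pi * inner ℝ h ξ : ℝ) * Complex.I) * 𝓕 f ξ := by
  rw [Real.fourier_eq', Real.fourier_eq', ← integral_const_mul,
    ← integral_add_right_eq_self (fun v => Complex.exp _ * _) h]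
  refine integral_congr_ae (ae_of_all _ fun x => ?_)
  simp only [smul_eq_mul]
  rw [← mul_assoc, ← Complex.exp_add, inner_add_left]
  congr 2
  push_cast
  ring

theorem fourier_sub_of_integrable {f g : V → ℂ} (hf : Integrable f) (hg : Integrable g) (ξ : V) :
    𝓕 (fun x => f x - g x) ξ = 𝓕 f ξ - 𝓕 g ξ := by
  simp only [Real.fourier_eq, smul_sub]
  exact integral_sub ((Real.fourierIntegral_convergent_iff ξ).2 hf)
    ((Real.fourierIntegral_convergent_iff ξ).2 hg)

theorem fourier_add_of_integrable {f g : V → ℂ} (hf : Integrable f) (hg : Integrable g) (ξ : V) :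
    𝓕 (fun x => f x + g x) ξ = 𝓕 f ξ + 𝓕 g ξ := by
  simp only [Real.fourier_eq, smul_add]
  exact integral_add ((Real.fourierIntegral_convergent_iff ξ).2 hf)
    ((Real.fourierIntegral_convergent_iff ξ).2 hg)

theorem fourier_const_mul (f : V → ℂ) (a : ℂ) (ξ : V) :
    𝓕 (fun x => a * f x) ξ = a * 𝓕 f ξ := by
  simp only [Real.fourier_eq, ← integral_const_mul]
  refine integral_congr_ae (ae_of_all _ fun x => ?_)
  simp only [Circle.smul_def, smul_eq_mul]
  ring

end FourierLemmas

/-! ### The spectral formula for the Gagliardo seminorm, `0 < s < 1`. -/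

section SpectralFormula

open FourierTransform

variable {N : ℕ}

local notation "𝔼" => EuclideanSpace ℝ (Fin N)

/-- The Fourier transform of a real function on `ℝ^N`. -/
noncomputable def fourierReal (u : 𝔼 → ℝ) : 𝔼 → ℂ := 𝓕 fun x => (u x : ℂ)

/-- The symbol `|2πξ|^{2s}` of `(-Δ)^s`. -/
noncomputable def symbol (s : ℝ) (ξ : 𝔼) : ℝ≥0∞ := ENNReal.ofReal ((2 * Real.pi * ‖ξ‖) ^ (2 * s))

/-- The spectral energy `∫ |2πξ|^{2s} |û(ξ)|² dξ`. -/
noncomputable def spectralEnergy (s : ℝ) (u : 𝔼 → ℝ) : ℝ≥0∞ :=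
  ∫⁻ ξ, symbol s ξ * ‖fourierReal u ξ‖ₑ ^ (2 : ℝ)

theorem measurable_symbol : Measurable fun p : ℝ × 𝔼 => symbol p.1 p.2 := by
  unfold symbol
  fun_prop

theorem lintegral_scale (f : 𝔼 → ℝ≥0∞) (hf : Measurable f) {r : ℝ} (hr : 0 < r) :
    ∫⁻ x, f (r • x) = ENNReal.ofReal (r ^ (-(N : ℝ))) * ∫⁻ x, f x := by
  have h := Measure.map_addHaar_smul (volume : Measure 𝔼) hr.ne'
  have hm : Measurable fun x : 𝔼 => r • x := measurable_const_smul r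
  rw [← lintegral_map hf hm, h, lintegral_smul_measure, smul_eq_mul, finrank_euclideanSpace_fin,
    abs_of_nonneg (by positivity), Real.rpow_neg hr.le, Real.rpow_natCast]

theorem two_mul_ofReal (a : ℝ) : 2 * ENNReal.ofReal a = ENNReal.ofReal (2 * a) := by
  rw [ENNReal.ofReal_mul zero_le_two, ENNReal.ofReal_ofNat]

/-- The kernel integral `∫ (1 - cos⟨h,η⟩) / |h|^{N+2s} dh`. -/
noncomputable def cosKernel (s : ℝ) (η : 𝔼) : ℝ≥0∞ :=
  ∫⁻ h : 𝔼, ENNReal.ofReal ((1 - Real.cos (inner ℝ h η)) / ‖h‖ ^ ((N : ℝ) + 2 * s))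

variable [NeZero N]

/-- An isometry moves `e₁` to the direction of `η`. Scaling by `r = ‖η‖` then gives `r^{N+2s}` from
the kernel and `r^{-N}` from the Jacobian, leaving `r^{2s}`. -/
theorem cosKernel_eq (s : ℝ) (η : 𝔼) (hη : η ≠ 0) :
    cosKernel s η = ENNReal.ofReal (‖η‖ ^ (2 * s)) *
      cosKernel s (EuclideanSpace.single 0 1 : 𝔼) := by
  set e : 𝔼 := EuclideanSpace.single 0 1
  set r := ‖η‖
  have hr : 0 < r := norm_pos_iff.2 hη
  have he : ‖e‖ = ‖r⁻¹ • η‖ := by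
    rw [norm_smul, norm_inv, norm_norm, inv_mul_cancel₀ hr.ne']
    simp [e]
  -- Reflection in the hyperplane orthogonal to the difference of two vectors of equal length
  -- exchanges them; if they coincide, it is the identity.
  let A : 𝔼 ≃ₗᵢ[ℝ] 𝔼 := (ℝ ∙ (e - r⁻¹ • η))ᗮ.reflection
  have hA : A e = r⁻¹ • η := Submodule.reflection_sub he
  have hη' : η = r • A e := by rw [hA, smul_smul, mul_inv_cancel₀ hr.ne', one_smul]
  unfold cosKernel
  rw [← A.measurePreserving.lintegral_comp_emb A.toHomeomorph.measurableEmbedding]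
  have h1 : ∀ h : 𝔼, ENNReal.ofReal ((1 - Real.cos (inner ℝ (A h) η)) /
      ‖A h‖ ^ ((N : ℝ) + 2 * s)) = ENNReal.ofReal (r ^ ((N : ℝ) + 2 * s)) *
      ENNReal.ofReal ((1 - Real.cos (inner ℝ (r • h) e)) / ‖r • h‖ ^ ((N : ℝ) + 2 * s)) := by
    intro h
    rw [← ENNReal.ofReal_mul (by positivity), A.norm_map, norm_smul, Real.norm_of_nonneg hr.le,
      Real.mul_rpow hr.le (norm_nonneg _)]
    nth_rw 1 [hη']
    rw [inner_smul_right, A.inner_map_map, inner_smul_left]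
    congr 1
    have : r ^ ((N : ℝ) + 2 * s) ≠ 0 := by positivity
    simp only [conj_trivial]
    field_simp
  simp_rw [h1]
  rw [lintegral_const_mul' _ _ ENNReal.ofReal_ne_top, lintegral_scale
    (fun h : 𝔼 => ENNReal.ofReal ((1 - Real.cos (inner ℝ h e)) / ‖h‖ ^ ((N : ℝ) + 2 * s)))
    (by fun_prop) hr, ← mul_assoc, ← ENNReal.ofReal_mul (by positivity), ← Real.rpow_add hr]
  congr 3
  ring

/-- The factor `2` comes from `|e^{it} - 1|² = 2(1 - cos t)` and cancels the `1/2` in the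
normalization. -/
theorem normConst_mul_cosKernel {s : ℝ} (h0 : 0 < s) (h1 : s < 1) :
    ENNReal.ofReal (normConst N s) * (2 * cosKernel s (EuclideanSpace.single 0 1 : 𝔼)) = 1 := by
  have hpos := normConst_pos (N := N) h0 h1
  have hI : 0 < ∫ ζ : 𝔼, (1 - Real.cos (ζ 0)) / ‖ζ‖ ^ ((N : ℝ) + 2 * s) := by
    unfold normConst at hpos
    exact inv_pos.1 (pos_of_mul_pos_right hpos (by norm_num))
  -- A nonintegrable function has Bochner integral zero by convention, so positivity of the integral
  -- implies integrability.
  have hint : Integrable fun ζ : 𝔼 => (1 - Real.cos (ζ 0)) / ‖ζ‖ ^ ((N : ℝ) + 2 * s) := by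
    by_contra hcon
    rw [integral_undef hcon] at hI
    exact hI.false
  have hK : cosKernel s (EuclideanSpace.single 0 1 : 𝔼) =
      ENNReal.ofReal (∫ ζ : 𝔼, (1 - Real.cos (ζ 0)) / ‖ζ‖ ^ ((N : ℝ) + 2 * s)) := by
    rw [ofReal_integral_eq_lintegral_ofReal hint (ae_of_all _ fun ζ => div_nonneg
      (by linarith [Real.cos_le_one (ζ 0)]) (by positivity))]
    unfold cosKernel
    simp [EuclideanSpace.inner_single_right]
  rw [hK, two_mul_ofReal, ← ENNReal.ofReal_mul hpos.le,
    ENNReal.ofReal_eq_one]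
  unfold normConst
  field_simp

theorem enorm_exp_sub_one_sq (t : ℝ) :
    ‖Complex.exp ((t : ℝ) * Complex.I) - 1‖ₑ ^ (2 : ℝ) = ENNReal.ofReal (2 * (1 - Real.cos t)) := by
  rw [← ofReal_norm, ENNReal.ofReal_rpow_of_nonneg (norm_nonneg _) zero_le_two]
  congr 1
  rw [Real.rpow_two, ← Complex.normSq_eq_norm_sq, Complex.normSq_apply]
  simp only [Complex.sub_re, Complex.sub_im, Complex.exp_ofReal_mul_I_re,
    Complex.exp_ofReal_mul_I_im, Complex.one_re, Complex.one_im]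
  nlinarith [Real.sin_sq_add_cos_sq t]

theorem lintegral_kernel_eq_symbol {s : ℝ} (h0 : 0 < s) (h1 : s < 1) (ξ : 𝔼) :
    ENNReal.ofReal (normConst N s) * ∫⁻ h : 𝔼, ENNReal.ofReal ((‖h‖ ^ ((N : ℝ) + 2 * s))⁻¹) *
      ‖Complex.exp ((2 * Real.pi * inner ℝ h ξ : ℝ) * Complex.I) - 1‖ₑ ^ (2 : ℝ) = symbol s ξ := by
  simp_rw [enorm_exp_sub_one_sq]
  have hrw : ∀ h : 𝔼, ENNReal.ofReal ((‖h‖ ^ ((N : ℝ) + 2 * s))⁻¹) *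
      ENNReal.ofReal (2 * (1 - Real.cos (2 * Real.pi * inner ℝ h ξ))) =
      2 * ENNReal.ofReal ((1 - Real.cos (inner ℝ h ((2 * Real.pi) • ξ))) /
        ‖h‖ ^ ((N : ℝ) + 2 * s)) := by
    intro h
    rw [two_mul_ofReal, ← ENNReal.ofReal_mul (by positivity), inner_smul_right]
    congr 1
    rw [div_eq_mul_inv]
    ring
  simp_rw [hrw]
  rw [lintegral_const_mul' _ _ (by simp)]
  change _ * (2 * cosKernel s ((2 * Real.pi) • ξ)) = _
  -- The rotation needs a direction, so the origin is separate; there both sides vanish because `s >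
  -- 0`.
  rcases eq_or_ne ξ 0 with rfl | hξ
  · have h2 : (0 : ℝ) ^ (2 * s) = 0 := Real.zero_rpow (by positivity)
    simp [cosKernel, symbol, h2]
  · have hpi : (2 * Real.pi) • ξ ≠ 0 := smul_ne_zero (by positivity) hξ
    rw [cosKernel_eq s _ hpi, mul_left_comm 2, mul_left_comm, normConst_mul_cosKernel h0 h1,
      mul_one, symbol, norm_smul, Real.norm_of_nonneg (by positivity)]

/-- After the substitution `y = x + h`, Plancherel in `x` turns the difference `u(x+h) - u(x)` into
the multiplier `e^{2πi⟨h,ξ⟩} - 1`. By Tonelli the integral over `h` comes first, and it produces the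
symbol. -/
theorem gagliardo_sq_of_mem_Ioo {s : ℝ} (h0 : 0 < s) (h1 : s < 1) {u : 𝔼 → ℝ} (hm : Measurable u)
    (hu : Integrable u) (hu2 : MemLp u 2) : gagliardo s u ^ (2 : ℝ) = spectralEnergy s u := by
  have hshift : ∀ x : 𝔼, ∫⁻ y, ENNReal.ofReal (|u x - u y| ^ 2 / ‖x - y‖ ^ ((N : ℝ) + 2 * s)) =
      ∫⁻ h : 𝔼, ENNReal.ofReal ((‖h‖ ^ ((N : ℝ) + 2 * s))⁻¹) *
        ‖(u (x + h) : ℂ) - u x‖ₑ ^ (2 : ℝ) := by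
    intro x
    rw [← lintegral_add_left_eq_self _ x]
    refine lintegral_congr fun h => ?_
    rw [← ofReal_norm, ENNReal.ofReal_rpow_of_nonneg (norm_nonneg _) zero_le_two,
      ← ENNReal.ofReal_mul (by positivity), ← Complex.ofReal_sub, Complex.norm_real,
      Real.norm_eq_abs, Real.rpow_two, abs_sub_comm, sub_add_cancel_left, norm_neg, div_eq_mul_inv]
    congr 1
    ring
  have hplan : ∀ h : 𝔼, ∫⁻ x : 𝔼, ‖(u (x + h) : ℂ) - u x‖ₑ ^ (2 : ℝ) =
      ∫⁻ ξ : 𝔼, ‖Complex.exp ((2 * Real.pi * inner ℝ h ξ : ℝ) * Complex.I) - 1‖ₑ ^ (2 : ℝ) *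
        ‖fourierReal u ξ‖ₑ ^ (2 : ℝ) := by
    intro h
    have e1 : Integrable fun x : 𝔼 => (u x : ℂ) := hu.ofReal
    have e2 : Integrable fun x : 𝔼 => (u (x + h) : ℂ) := e1.comp_add_right h
    have e3 : MemLp (fun x : 𝔼 => (u x : ℂ)) 2 := hu2.ofReal
    have e4 : MemLp (fun x : 𝔼 => (u (x + h) : ℂ)) 2 :=
      e3.comp_measurePreserving (measurePreserving_add_right volume h)
    refine (lintegral_fourier_sq (f := fun x => (u (x + h) : ℂ) - u x) (e2.sub e1)
      (e4.sub e3)).symm.trans ?_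
    refine lintegral_congr fun ξ => ?_
    rw [← ENNReal.mul_rpow_of_nonneg _ _ zero_le_two, ← enorm_mul]
    congr 2
    have := fourier_sub_of_integrable e2 e1 ξ
    refine this.trans ?_
    rw [fourier_translate (fun x => (u x : ℂ)) h ξ, sub_mul, one_mul]
    rfl
  have hmF : Measurable (fourierReal u) := (continuous_fourier_of_integrable hu.ofReal).measurable
  unfold gagliardo
  rw [if_neg h0.ne', if_neg h1.ne, ← ENNReal.rpow_mul]
  simp_rw [hshift]
  rw [lintegral_lintegral_swap (by
    refine Measurable.aemeasurable ?_
    simp only [Function.uncurry_def]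
    fun_prop)]
  simp_rw [lintegral_const_mul' _ _ ENNReal.ofReal_ne_top, hplan,
    ← lintegral_const_mul' _ _ (ENNReal.ofReal_ne_top)]
  rw [lintegral_lintegral_swap (by
    refine Measurable.aemeasurable ?_
    simp only [Function.uncurry_def]
    fun_prop)]
  simp only [one_div, ne_eq, OfNat.ofNat_ne_zero, not_false_eq_true, inv_mul_cancel₀,
    ENNReal.rpow_one]
  refine lintegral_congr fun ξ => ?_
  have hfin : ‖fourierReal u ξ‖ₑ ^ (2 : ℝ) ≠ ⊤ := by simp
  rw [← lintegral_kernel_eq_symbol h0 h1 ξ, ← lintegral_const_mul' _ _ ENNReal.ofReal_ne_top,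
    ← lintegral_mul_const' _ _ hfin]
  refine lintegral_congr fun h => ?_
  simp only [mul_assoc]

end SpectralFormula

/-! ### Weak gradients on the Fourier side. -/

section WeakGradientFourier

open FourierTransform SchwartzMap LineDeriv

variable {N : ℕ}

local notation "𝔼" => EuclideanSpace ℝ (Fin N)

theorem integrable_of_vanishing {E : Type*} [NormedAddCommGroup E] {Ω : Set 𝔼}
    (hΩ : Bornology.IsBounded Ω) {u : 𝔼 → E} (hu : LocallyIntegrable u)
    (h0 : ∀ᵐ x, x ∉ Ω → u x = 0) : Integrable u := by
  have h1 := (hu.integrableOn_isCompact hΩ.isCompact_closure).integrable_indicator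
    isClosed_closure.measurableSet
  refine h1.congr ?_
  filter_upwards [h0] with x hx
  by_cases hxc : x ∈ closure Ω
  · rw [indicator_of_mem hxc]
  · rw [indicator_of_notMem hxc, hx fun h => hxc (subset_closure h)]

/-- A test function supported off `closure Ω` does not meet `u`, so its integral against `G` is
zero. The closure is used because its complement is open; the boundary of `Ω` may have positive
measure. -/
theorem IsWeakGradient.vanishing {Ω : Set 𝔼} {u : 𝔼 → ℝ} {G : 𝔼 → 𝔼} (hu : IsWeakGradient u G)
    (h0 : ∀ᵐ x, x ∉ Ω → u x = 0) : ∀ᵐ x, x ∉ closure Ω → G x = 0 := by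
  refine isClosed_closure.isOpen_compl.ae_eq_zero_of_integral_contDiff_smul_eq_zero
    (hu.2.1.locallyIntegrableOn _) fun φ hφ hc hs => ?_
  refine ext_inner_right ℝ fun e => ?_
  have hint : Integrable fun x => φ x • G x :=
    hu.2.1.integrable_smul_left_of_hasCompactSupport hφ.continuous hc
  rw [inner_zero_left, real_inner_comm, ← integral_inner hint e]
  have h1 := hu.2.2 φ hφ hc e
  have h2 : ∫ x, u x * fderiv ℝ φ x e = 0 := by
    refine integral_eq_zero_of_ae ?_
    filter_upwards [h0] with x hx
    by_cases hxΩ : x ∈ Ω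
    · have h3 : x ∉ tsupport φ := fun h => hs h (subset_closure hxΩ)
      have h4 : fderiv ℝ φ x = 0 := by
        by_contra hne
        exact h3 (support_fderiv_subset ℝ hne)
      simp [h4]
    · simp [hx hxΩ]
  rw [h2, zero_eq_neg] at h1
  rw [← h1]
  refine integral_congr_ae (ae_of_all _ fun x => ?_)
  simp only [inner_smul_right]
  rw [real_inner_comm, mul_comm]

/-- For functions vanishing outside a bounded set the test functions need not have compact
support. -/
theorem IsWeakGradient.integral_eq_of_vanishing {Ω : Set 𝔼} (hΩ : Bornology.IsBounded Ω)
    {u : 𝔼 → ℝ} {G : 𝔼 → 𝔼} (hu : IsWeakGradient u G) (h0 : ∀ᵐ x, x ∉ Ω → u x = 0)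
    {ψ : 𝔼 → ℝ} (hψ : ContDiff ℝ ∞ ψ) (e : 𝔼) :
    ∫ x, u x * fderiv ℝ ψ x e = - ∫ x, inner ℝ (G x) e * ψ x := by
  obtain ⟨R, hR0, hR⟩ := hΩ.closure.subset_closedBall_lt 0 0
  -- The cutoff is one on a ball that is a neighbourhood of `closure Ω`, so the derivatives of `χψ`
  -- and `ψ` agree there as well as the values.
  let χ : ContDiffBump (0 : 𝔼) := ⟨R + 1, R + 2, by linarith, by linarith⟩
  have hone : ∀ x ∈ closure Ω, (fun y => χ y * ψ y) =ᶠ[𝓝 x] ψ := fun x hx => by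
    have hx1 : x ∈ Metric.ball (0 : 𝔼) (R + 1) :=
      Metric.closedBall_subset_ball (by linarith) (hR hx)
    filter_upwards [Metric.isOpen_ball.mem_nhds hx1] with y hy
    rw [χ.one_of_mem_closedBall (Metric.ball_subset_closedBall hy), one_mul]
  have key := hu.2.2 (fun y => χ y * ψ y) (χ.contDiff.mul hψ) χ.hasCompactSupport.mul_right e
  have e1 : ∫ x, u x * fderiv ℝ ψ x e = ∫ x, u x * fderiv ℝ (fun y => χ y * ψ y) x e := by
    refine integral_congr_ae ?_
    filter_upwards [h0] with x hx
    by_cases hxΩ : x ∈ Ω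
    · rw [(hone x (subset_closure hxΩ)).fderiv_eq]
    · rw [hx hxΩ, zero_mul, zero_mul]
  have e2 : ∫ x, inner ℝ (G x) e * ψ x = ∫ x, inner ℝ (G x) e * (χ x * ψ x) := by
    refine integral_congr_ae ?_
    filter_upwards [hu.vanishing h0] with x hx
    by_cases hxΩ : x ∈ closure Ω
    · rw [(hone x hxΩ).eq_of_nhds]
    · simp [hx hxΩ]
  rw [e1, e2, key]

/-- Weak gradients and `L²(ℝ^N; ℝ)` are tested with real functions, hence the splitting into two
real integrals. -/
theorem fourierReal_eq_cos_sin {u : 𝔼 → ℝ} (hu : Integrable u) (ξ : 𝔼) :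
    fourierReal u ξ = ((∫ x, u x * Real.cos (2 * Real.pi * inner ℝ x ξ) : ℝ) : ℂ) -
      ((∫ x, u x * Real.sin (2 * Real.pi * inner ℝ x ξ) : ℝ) : ℂ) * Complex.I := by
  have hc : Integrable fun x => u x * Real.cos (2 * Real.pi * inner ℝ x ξ) :=
    hu.mul_bdd (c := 1) (Continuous.aestronglyMeasurable (by fun_prop))
      (ae_of_all _ fun x => Real.abs_cos_le_one _)
  have hs : Integrable fun x => u x * Real.sin (2 * Real.pi * inner ℝ x ξ) :=
    hu.mul_bdd (c := 1) (Continuous.aestronglyMeasurable (by fun_prop))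
      (ae_of_all _ fun x => Real.abs_sin_le_one _)
  rw [← integral_complex_ofReal, ← integral_complex_ofReal, ← integral_mul_const,
    ← integral_sub hc.ofReal (hs.ofReal.mul_const _), fourierReal, Real.fourier_eq']
  refine integral_congr_ae (ae_of_all _ fun x => ?_)
  simp only [smul_eq_mul]
  rw [Complex.exp_mul_I, ← Complex.ofReal_cos, ← Complex.ofReal_sin]
  simp only [neg_mul, Real.cos_neg, Real.sin_neg]
  push_cast
  ring

/-- The Fourier transform of a weak derivative. -/
theorem fourier_weakGradient {Ω : Set 𝔼} (hΩ : Bornology.IsBounded Ω)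
    {u : 𝔼 → ℝ} {G : 𝔼 → 𝔼} (hu : IsWeakGradient u G) (h0 : ∀ᵐ x, x ∉ Ω → u x = 0) (e ξ : 𝔼) :
    fourierReal (fun x => inner ℝ (G x) e) ξ =
      ((2 * Real.pi * inner ℝ e ξ : ℝ) : ℂ) * Complex.I * fourierReal u ξ := by
  have hui : Integrable u := integrable_of_vanishing hΩ hu.1 h0
  have hGi : Integrable G := integrable_of_vanishing hΩ.closure hu.2.1 (hu.vanishing h0)
  rw [fourierReal_eq_cos_sin (hGi.inner_const e), fourierReal_eq_cos_sin hui]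
  have hlin : ∀ x : 𝔼, HasFDerivAt (fun x : 𝔼 => 2 * Real.pi * inner ℝ x ξ)
      ((2 * Real.pi) • (innerSL ℝ ξ)) x := fun x => by
    have := ((innerSL ℝ ξ).hasFDerivAt (x := x)).const_mul (2 * Real.pi)
    simpa [real_inner_comm] using this
  have hcd : ContDiff ℝ ∞ fun x : 𝔼 => 2 * Real.pi * inner ℝ x ξ :=
    contDiff_const.mul (contDiff_id.inner ℝ contDiff_const)
  -- The real and imaginary parts of the plane wave are not compactly supported, but they are
  -- admissible test functions since `u` vanishes outside a bounded set.
  have hcos := hu.integral_eq_of_vanishing hΩ h0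
    (ψ := fun x => Real.cos (2 * Real.pi * inner ℝ x ξ)) hcd.cos e
  have hsin := hu.integral_eq_of_vanishing hΩ h0
    (ψ := fun x => Real.sin (2 * Real.pi * inner ℝ x ξ)) hcd.sin e
  have dcos : ∀ x : 𝔼, fderiv ℝ (fun x : 𝔼 => Real.cos (2 * Real.pi * inner ℝ x ξ)) x e =
      -(2 * Real.pi * inner ℝ e ξ) * Real.sin (2 * Real.pi * inner ℝ x ξ) := fun x => by
    rw [(hlin x).cos.fderiv]
    simp [real_inner_comm]
    ring
  have dsin : ∀ x : 𝔼, fderiv ℝ (fun x : 𝔼 => Real.sin (2 * Real.pi * inner ℝ x ξ)) x e =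
      (2 * Real.pi * inner ℝ e ξ) * Real.cos (2 * Real.pi * inner ℝ x ξ) := fun x => by
    rw [(hlin x).sin.fderiv]
    simp [real_inner_comm]
    ring
  simp only [dcos, mul_left_comm (u _), integral_const_mul] at hcos
  simp only [dsin, mul_left_comm (u _), integral_const_mul] at hsin
  rw [eq_comm, neg_eq_iff_eq_neg] at hcos hsin
  rw [hcos, hsin]
  push_cast
  linear_combination (2 * (Real.pi : ℂ) * (inner ℝ e ξ : ℝ) *
    ((∫ x, u x * Real.sin (2 * Real.pi * inner ℝ x ξ) : ℝ) : ℂ)) * Complex.I_sq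

theorem enorm_sq_eq_sum (x : 𝔼) : ‖x‖ₑ ^ (2 : ℝ) = ∑ i, ‖x i‖ₑ ^ (2 : ℝ) := by
  have h : ∀ (E : Type) [SeminormedAddCommGroup E] (y : E), ‖y‖ₑ ^ (2 : ℝ) =
      ENNReal.ofReal (‖y‖ ^ 2) := fun E _ y => by
    rw [← ofReal_norm, ENNReal.ofReal_rpow_of_nonneg (norm_nonneg _) zero_le_two, Real.rpow_two]
  simp_rw [h]
  rw [EuclideanSpace.norm_sq_eq, ENNReal.ofReal_sum_of_nonneg fun _ _ => by positivity]

theorem symbol_one (ξ : 𝔼) :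
    symbol 1 ξ = ∑ i, ‖((2 * Real.pi * inner ℝ (EuclideanSpace.single i 1) ξ : ℝ) : ℂ) *
      Complex.I‖ₑ ^ (2 : ℝ) := by
  have h1 : symbol 1 ξ = ‖(2 * Real.pi) • ξ‖ₑ ^ (2 : ℝ) := by
    rw [← ofReal_norm, ENNReal.ofReal_rpow_of_nonneg (norm_nonneg _) zero_le_two, norm_smul,
      Real.norm_of_nonneg (by positivity), symbol, mul_one]
  rw [h1, enorm_sq_eq_sum]
  refine Finset.sum_congr rfl fun i _ => ?_
  congr 1
  rw [← ofReal_norm, ← ofReal_norm]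
  congr 1
  simp [EuclideanSpace.inner_single_left]

/-- Plancherel for each component of the gradient; the squared multipliers of the partial
derivatives add up to `|2πξ|²`. -/
theorem eLpNorm_weakGradient_sq {Ω : Set 𝔼} (hΩ : Bornology.IsBounded Ω)
    {u : 𝔼 → ℝ} {G : 𝔼 → 𝔼} (hu : IsWeakGradient u G) (h0 : ∀ᵐ x, x ∉ Ω → u x = 0)
    (hG : MemLp G 2) : eLpNorm G 2 ^ (2 : ℝ) = spectralEnergy 1 u := by
  have hui : Integrable u := integrable_of_vanishing hΩ hu.1 h0
  have hGi : Integrable G := integrable_of_vanishing hΩ.closure hu.2.1 (hu.vanishing h0)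
  have hmF : Measurable (fourierReal u) := (continuous_fourier_of_integrable hui.ofReal).measurable
  rw [← lintegral_sq_eq_eLpNorm]
  simp_rw [enorm_sq_eq_sum, spectralEnergy, symbol_one, Finset.sum_mul]
  have hGe : ∀ e : 𝔼, MemLp (fun x => inner ℝ (G x) e) 2 := fun e => hG.inner_const e
  rw [lintegral_finsetSum' _ fun i _ => ?_, lintegral_finsetSum' _ fun i _ => ?_]
  · refine Finset.sum_congr rfl fun i _ => ?_
    have h1 := lintegral_fourier_sq (f := fun x => ((inner ℝ (G x) (EuclideanSpace.single i 1 : 𝔼) : ℝ) : ℂ))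
      (hGi.inner_const _).ofReal (hGe _).ofReal
    have h2 : ∀ x, ‖G x i‖ₑ = ‖((inner ℝ (G x) (EuclideanSpace.single i 1 : 𝔼) : ℝ) : ℂ)‖ₑ := by
      intro x
      rw [← ofReal_norm, ← ofReal_norm, Complex.norm_real]
      simp [EuclideanSpace.inner_single_right]
    simp_rw [h2]
    rw [← h1]
    refine lintegral_congr fun ξ => ?_
    rw [← ENNReal.mul_rpow_of_nonneg _ _ zero_le_two, ← enorm_mul,
      ← fourier_weakGradient hΩ hu h0]
    rfl
  · refine Measurable.aemeasurable ?_
    fun_prop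
  · refine AEMeasurable.pow_const ?_ _
    have := (hGe (EuclideanSpace.single i 1)).1.enorm
    refine this.congr (ae_of_all _ fun x => ?_)
    simp [EuclideanSpace.inner_single_right]

end WeakGradientFourier

/-! ### The spectral formula at order one and for all `s ∈ [0,1]`. -/

section SpectralFormulaOne

open FourierTransform SchwartzMap LineDeriv

variable {N : ℕ}

local notation "𝔼" => EuclideanSpace ℝ (Fin N)

/-- A partial derivative, in the sense of distributions, that is given on the Fourier side. -/
theorem exists_weak_partial {u : 𝔼 → ℝ} (hu : Integrable u) (m : 𝔼)
    (hm : MemLp (fun ξ => ((2 * Real.pi * inner ℝ m ξ : ℝ) : ℂ) * Complex.I * fourierReal u ξ) 2) :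
    ∃ g : 𝔼 → ℝ, MemLp g 2 ∧ ∀ φ : 𝔼 → ℝ, ContDiff ℝ ∞ φ → HasCompactSupport φ →
      ∫ x, u x * fderiv ℝ φ x m = - ∫ x, g x * φ x := by
  set T : Lp ℂ 2 (volume : Measure 𝔼) := 𝓕⁻ hm.toLp
  have hT : MemLp T 2 := Lp.memLp _
  -- There is no need to show that `T` is real: the test functions and `u` are real, so the real
  -- part satisfies the same identity.
  refine ⟨fun x => (T x).re, hT.re, fun φ hφ hc => ?_⟩
  have hc' : HasCompactSupport fun x => (φ x : ℂ) := hc.comp_left (g := Complex.ofReal) rfl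
  set Φ : 𝓢(𝔼, ℂ) := hc'.toSchwartzMap (Complex.ofRealCLM.contDiff.comp hφ)
  have hΦ : ∀ x, Φ x = φ x := fun x => rfl
  have hdΦ : ∀ x, (∂_{m} Φ : 𝓢(𝔼, ℂ)) x = ((fderiv ℝ φ x m : ℝ) : ℂ) := fun x => by
    rw [SchwartzMap.lineDerivOp_apply_eq_fderiv]
    have h1 : HasFDerivAt (fun x => (φ x : ℂ)) (Complex.ofRealCLM.comp (fderiv ℝ φ x)) x :=
      Complex.ofRealCLM.hasFDerivAt.comp x ((hφ.differentiable (by simp)) x).hasFDerivAt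
    have h2 : fderiv ℝ (Φ : 𝔼 → ℂ) x = Complex.ofRealCLM.comp (fderiv ℝ φ x) := h1.fderiv
    rw [h2]
    rfl
  have h1 := congrArg (fun T => T Φ) (Lp.fourierInv_toTemperedDistribution_eq hm.toLp)
  simp only [TemperedDistribution.fourierInv_apply, Lp.toTemperedDistribution_apply,
    smul_eq_mul] at h1
  -- On the Schwartz side the inverse transform turns `∂_m` into multiplication by `-2πi⟨m,ξ⟩`, so
  -- the multiplier passes from `û` to the test function with a sign.
  have h2 : ∫ ξ, 𝓕⁻ Φ ξ * (hm.toLp : Lp ℂ 2 (volume : Measure 𝔼)) ξ =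
      - ∫ ξ, fourierReal u ξ * 𝓕⁻ (∂_{m} Φ) ξ := by
    rw [← integral_neg]
    refine integral_congr_ae ?_
    filter_upwards [hm.coeFn_toLp] with ξ hξ
    have hg : (inner ℝ · m : 𝔼 → ℝ).HasTemperateGrowth := by fun_prop
    rw [hξ, SchwartzMap.fourierInv_lineDerivOp_eq]
    simp only [_root_.smul_apply, SchwartzMap.smulLeftCLM_apply_apply hg, smul_eq_mul,
      Complex.real_smul]
    rw [real_inner_comm]
    push_cast
    ring
  have h3 : ∫ ξ, fourierReal u ξ * 𝓕⁻ (∂_{m} Φ) ξ = ((∫ x, u x * fderiv ℝ φ x m : ℝ) : ℂ) := by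
    rw [fourierReal, integral_fourier_mul_of_integrable (f := fun x => (u x : ℂ)) hu.ofReal
      (𝓕⁻ (∂_{m} Φ) : 𝓢(𝔼, ℂ)).integrable, ← SchwartzMap.fourier_coe, FourierTransform.fourier_fourierInv_eq, ← integral_complex_ofReal]
    refine integral_congr_ae (ae_of_all _ fun x => ?_)
    simp only [hdΦ, Complex.ofReal_mul]
  rw [h2, h3] at h1
  have hint : Integrable fun x => Φ x * T x := (Φ.memLp 2).integrable_mul hT
  have h4 := congrArg Complex.re h1
  rw [← RCLike.re_eq_complex_re, ← integral_re hint] at h4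
  simp only [RCLike.re_eq_complex_re, hΦ, Complex.re_ofReal_mul, Complex.neg_re,
    Complex.ofReal_re] at h4
  rw [← neg_eq_iff_eq_neg, h4]
  simp only [mul_comm]

theorem enorm_fourierReal_le (u : 𝔼 → ℝ) (ξ : 𝔼) : ‖fourierReal u ξ‖ₑ ≤ ∫⁻ x, ‖u x‖ₑ := by
  rw [fourierReal, Real.fourier_eq]
  refine (enorm_integral_le_lintegral_enorm _).trans_eq (lintegral_congr fun x => ?_)
  rw [← ofReal_norm, ← ofReal_norm, Circle.norm_smul, Complex.norm_real]

/-- The symbol of order one dominates the square of each coordinate multiplier, so every partial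
derivative exists in `L²`, and the partial derivatives form the gradient. -/
theorem exists_isWeakGradient {u : 𝔼 → ℝ} (hu : Integrable u) (h : spectralEnergy 1 u ≠ ⊤) :
    ∃ G : 𝔼 → 𝔼, IsWeakGradient u G ∧ MemLp G 2 := by
  have hF : Continuous (fourierReal u) := continuous_fourier_of_integrable hu.ofReal
  have hmem : ∀ i : Fin N, MemLp (fun ξ : 𝔼 => ((2 * Real.pi *
      inner ℝ (EuclideanSpace.single i 1 : 𝔼) ξ : ℝ) : ℂ) * Complex.I * fourierReal u ξ) 2 := by
    intro i
    refine ⟨Continuous.aestronglyMeasurable (by fun_prop), ?_⟩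
    have h1 : ∫⁻ ξ : 𝔼, ‖((2 * Real.pi * inner ℝ (EuclideanSpace.single i 1 : 𝔼) ξ : ℝ) : ℂ) *
        Complex.I * fourierReal u ξ‖ₑ ^ (2 : ℝ) ≤ spectralEnergy 1 u := by
      refine lintegral_mono fun ξ => ?_
      rw [enorm_mul, ENNReal.mul_rpow_of_nonneg _ _ zero_le_two, symbol_one]
      gcongr
      exact Finset.single_le_sum (f := fun i : Fin N => ‖((2 * Real.pi *
        inner ℝ (EuclideanSpace.single i 1 : 𝔼) ξ : ℝ) : ℂ) * Complex.I‖ₑ ^ (2 : ℝ))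
        (fun _ _ => zero_le) (Finset.mem_univ i)
    rw [lintegral_sq_eq_eLpNorm] at h1
    by_contra hcon
    rw [not_lt, top_le_iff] at hcon
    rw [hcon] at h1
    exact h (top_le_iff.1 (by simpa using h1))
  choose g hg hgφ using fun i => exists_weak_partial hu _ (hmem i)
  have hGL : MemLp (fun x => (WithLp.toLp 2 fun i => g i x : 𝔼)) 2 := by
    have h1 : (fun x => (WithLp.toLp 2 fun i => g i x : 𝔼)) =
        fun x => ∑ i, g i x • (EuclideanSpace.single i 1 : 𝔼) := by
      funext x
      ext j
      simp [Pi.single_apply]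
    rw [h1]
    exact memLp_finsetSum _ fun i _ =>
      (ContinuousLinearMap.toSpanSingleton ℝ (EuclideanSpace.single i 1 : 𝔼)).comp_memLp' (hg i)
  refine ⟨_, ⟨hu.locallyIntegrable, hGL.locallyIntegrable one_le_two, fun φ hφ hc e => ?_⟩, hGL⟩
  have he : e = ∑ i, e i • (EuclideanSpace.single i 1 : 𝔼) := by
    ext j
    simp [Pi.single_apply]
  have hφd : ∀ m : 𝔼, Integrable fun x => u x * fderiv ℝ φ x m := fun m => by
    have h1 : Continuous (fun x => fderiv ℝ φ x m) :=
      (hφ.continuous_fderiv (by simp)).clm_apply continuous_const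
    have h2 : HasCompactSupport (fun x => fderiv ℝ φ x m) := hc.fderiv_apply ℝ m
    simpa [smul_eq_mul] using
      hu.locallyIntegrable.integrable_smul_right_of_hasCompactSupport h1 h2
  have hgi : ∀ i, Integrable fun x => g i x * φ x := fun i =>
    (hg i).integrable_mul (hφ.continuous.memLp_of_hasCompactSupport hc : MemLp φ 2 volume)
  have e1 : ∀ x, u x * fderiv ℝ φ x e =
      ∑ i, e i * (u x * fderiv ℝ φ x (EuclideanSpace.single i 1)) := fun x => by
    conv_lhs => rw [he]
    rw [map_sum, Finset.mul_sum]
    refine Finset.sum_congr rfl fun i _ => ?_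
    rw [map_smul, smul_eq_mul]
    ring
  have e2 : ∀ x, inner ℝ (WithLp.toLp 2 fun i => g i x : 𝔼) e * φ x =
      ∑ i, e i * (g i x * φ x) := fun x => by
    rw [PiLp.inner_apply, Finset.sum_mul]
    refine Finset.sum_congr rfl fun i _ => ?_
    simp only [RCLike.inner_apply, conj_trivial]
    ring
  simp_rw [e1, e2]
  rw [integral_finsetSum _ fun i _ => (hφd _).const_mul _,
    integral_finsetSum _ fun i _ => (hgi i).const_mul _, ← Finset.sum_neg_distrib]
  refine Finset.sum_congr rfl fun i _ => ?_
  rw [integral_const_mul, integral_const_mul, hgφ i φ hφ hc, mul_neg]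

variable [NeZero N]

/-- Valid in `[0,∞]`: finite spectral energy produces a square integrable gradient, and a gradient
of finite norm has exactly that energy. -/
theorem gagliardo_one_sq {Ω : Set 𝔼} (hΩ : Bornology.IsBounded Ω) {u : 𝔼 → ℝ} (hu : Integrable u)
    (h0 : ∀ᵐ x, x ∉ Ω → u x = 0) : gagliardo 1 u ^ (2 : ℝ) = spectralEnergy 1 u := by
  unfold gagliardo
  rw [if_neg one_ne_zero, if_pos rfl]
  refine le_antisymm ?_ ?_
  · by_cases h : spectralEnergy 1 u = ⊤
    · rw [h]
      exact le_top
    · obtain ⟨G, hG, hG2⟩ := exists_isWeakGradient hu h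
      rw [← eLpNorm_weakGradient_sq hΩ hG h0 hG2]
      gcongr
      exact iInf₂_le _ hG
  · have h1 : spectralEnergy 1 u ^ (1 / 2 : ℝ) ≤
        ⨅ G, ⨅ _ : IsWeakGradient u G, eLpNorm G 2 volume := by
      refine le_iInf₂ fun G hG => ?_
      by_cases hG2 : eLpNorm G 2 volume < ⊤
      · rw [← eLpNorm_weakGradient_sq hΩ hG h0 ⟨hG.2.1.aestronglyMeasurable, hG2⟩,
          ← ENNReal.rpow_mul]
        simp
      · rw [not_lt, top_le_iff] at hG2
        rw [hG2]
        exact le_top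
    calc spectralEnergy 1 u = (spectralEnergy 1 u ^ (1 / 2 : ℝ)) ^ (2 : ℝ) := by
          rw [← ENNReal.rpow_mul]
          simp
      _ ≤ _ := by gcongr

/-- The seminorm `[u]_s` is the spectral energy. -/
theorem gagliardo_sq {Ω : Set 𝔼} (hΩ : Bornology.IsBounded Ω) {u : 𝔼 → ℝ} (hm : Measurable u)
    (hu2 : MemLp u 2) (h0 : ∀ᵐ x, x ∉ Ω → u x = 0) {s : ℝ} (hs0 : 0 ≤ s) (hs1 : s ≤ 1) :
    gagliardo s u ^ (2 : ℝ) = spectralEnergy s u := by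
  have hu : Integrable u := integrable_of_vanishing hΩ (hu2.locallyIntegrable one_le_two) h0
  rcases hs0.eq_or_lt with rfl | hs0
  · unfold gagliardo spectralEnergy symbol
    simp only [if_true, mul_zero, Real.rpow_zero, ENNReal.ofReal_one, one_mul]
    rw [fourierReal, lintegral_fourier_sq (f := fun x => (u x : ℂ)) hu.ofReal hu2.ofReal,
      lintegral_sq_eq_eLpNorm]
    congr 1
    exact eLpNorm_congr_norm_ae (ae_of_all _ fun x => by simp)
  rcases hs1.eq_or_lt with rfl | hs1
  · exact gagliardo_one_sq hΩ hu h0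
  · exact gagliardo_sq_of_mem_Ioo hs0 hs1 hm hu hu2

/-- A function of finite energy vanishing outside a bounded set is square integrable. -/
theorem memLp_of_gagliardo_lt_top {Ω : Set 𝔼} (hΩ : Bornology.IsBounded Ω) {u : 𝔼 → ℝ}
    (hm : Measurable u) (h0 : ∀ᵐ x, x ∉ Ω → u x = 0) {s : ℝ} (hs0 : 0 ≤ s) (hs1 : s ≤ 1)
    (h : gagliardo s u < ⊤) : MemLp u 2 := by
  rcases hs0.eq_or_lt with rfl | hs0
  · refine ⟨hm.aestronglyMeasurable, ?_⟩
    simpa [gagliardo] using h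
  rcases hs1.eq_or_lt with rfl | hs1
  · have h' := h
    unfold gagliardo at h'
    rw [if_neg one_ne_zero, if_pos rfl] at h'
    simp only [iInf_lt_iff] at h'
    obtain ⟨G, hG, -⟩ := h'
    have hu : Integrable u := integrable_of_vanishing hΩ hG.1 h0
    have hE : spectralEnergy 1 u < ⊤ := by
      rw [← gagliardo_one_sq hΩ hu h0]
      exact ENNReal.rpow_lt_top_of_nonneg zero_le_two h.ne
    have hF : Continuous (fourierReal u) := continuous_fourier_of_integrable hu.ofReal
    suffices MemLp (fourierReal u) 2 by
      have h2 := memLp_two_of_memLp_fourier hu.ofReal this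
      exact (memLp_congr_norm hm.aestronglyMeasurable h2.1 (ae_of_all _ fun x => by simp)).2 h2
    refine ⟨hF.aestronglyMeasurable, ?_⟩
    -- On the unit ball `û` is bounded by `‖u‖_{L¹}`; outside it the symbol is at least one and the
    -- energy controls `û`.
    have hle : ∀ ξ : 𝔼, ‖fourierReal u ξ‖ₑ ^ (2 : ℝ) ≤
        (Metric.closedBall (0 : 𝔼) 1).indicator (fun ξ => ‖fourierReal u ξ‖ₑ ^ (2 : ℝ)) ξ +
        symbol 1 ξ * ‖fourierReal u ξ‖ₑ ^ (2 : ℝ) := by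
      intro ξ
      by_cases hξ : ξ ∈ Metric.closedBall (0 : 𝔼) 1
      · rw [indicator_of_mem hξ]
        exact le_self_add
      · refine le_add_of_nonneg_of_le zero_le ?_
        have h1 : 1 ≤ symbol 1 ξ := by
          rw [mem_closedBall_zero_iff, not_le] at hξ
          rw [symbol, ENNReal.one_le_ofReal]
          refine Real.one_le_rpow ?_ (by norm_num)
          nlinarith [Real.pi_gt_three]
        exact le_mul_of_one_le_left zero_le h1
    have hint : ∫⁻ ξ, ‖fourierReal u ξ‖ₑ ^ (2 : ℝ) < ⊤ := by
      refine (lintegral_mono hle).trans_lt ?_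
      rw [lintegral_add_right _ (by
        have := hF.measurable
        exact (measurable_symbol.comp measurable_prodMk_left).mul (by fun_prop)),
        lintegral_indicator Metric.isClosed_closedBall.measurableSet]
      refine ENNReal.add_lt_top.2 ⟨?_, hE⟩
      have hfin : (∫⁻ x, ‖u x‖ₑ) ^ (2 : ℝ) ≠ ⊤ :=
        ENNReal.rpow_ne_top_of_nonneg zero_le_two hu.2.ne
      calc ∫⁻ ξ in Metric.closedBall (0 : 𝔼) 1, ‖fourierReal u ξ‖ₑ ^ (2 : ℝ)
          ≤ ∫⁻ _ in Metric.closedBall (0 : 𝔼) 1, (∫⁻ x, ‖u x‖ₑ) ^ (2 : ℝ) := by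
            gcongr with ξ
            exact enorm_fourierReal_le u ξ
        _ < ⊤ := by
            rw [setLIntegral_const]
            exact ENNReal.mul_lt_top hfin.lt_top (isCompact_closedBall (0 : 𝔼) 1).measure_lt_top
    rw [lintegral_sq_eq_eLpNorm] at hint
    exact (ENNReal.rpow_lt_top_iff_of_pos two_pos).1 hint
  · obtain ⟨R, hR0, hR⟩ := hΩ.subset_closedBall_lt 0 0
    -- The unit ball around `z` misses the ball of radius `R` that contains `Ω`, so `u` vanishes
    -- almost everywhere on it. Its interaction with `x ∈ Ω` alone bounds `|u(x)|²`.
    let z : 𝔼 := EuclideanSpace.single 0 (R + 1)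
    have hz : ‖z‖ = R + 1 := by
      simp only [z, PiLp.norm_single]
      exact Real.norm_of_nonneg (by positivity)
    set p : ℝ := (N : ℝ) + 2 * s
    have hp : 0 ≤ p := by positivity
    have hD : 0 < 2 * R + 2 := by positivity
    -- For such `x` and `y`, `‖x‖ ≤ R` and `‖y‖ ≤ R + 2`, so the distance is at most `2R + 2`.
    set κ : ℝ≥0∞ := ENNReal.ofReal (((2 * R + 2) ^ p)⁻¹) * volume (Metric.ball z 1)
    have hκ : κ ≠ 0 := mul_ne_zero (by
      rw [Ne, ENNReal.ofReal_eq_zero, not_le]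
      positivity) (Metric.measure_ball_pos volume z one_pos).ne'
    have hlow : ∀ᵐ x, ‖u x‖ₑ ^ (2 : ℝ) * κ ≤
        ∫⁻ y, ENNReal.ofReal (|u x - u y| ^ 2 / ‖x - y‖ ^ p) := by
      filter_upwards [h0] with x hx
      by_cases hxΩ : x ∈ Ω
      · calc ‖u x‖ₑ ^ (2 : ℝ) * κ = ∫⁻ _ in Metric.ball z 1,
              ‖u x‖ₑ ^ (2 : ℝ) * ENNReal.ofReal (((2 * R + 2) ^ p)⁻¹) := by
              rw [setLIntegral_const, mul_assoc]
          _ ≤ ∫⁻ y in Metric.ball z 1, ENNReal.ofReal (|u x - u y| ^ 2 / ‖x - y‖ ^ p) := by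
              refine lintegral_mono_ae ?_
              filter_upwards [ae_restrict_mem Metric.isOpen_ball.measurableSet,
                ae_restrict_of_ae h0] with y hy hy0
              have hxR : ‖x‖ ≤ R := by simpa using hR hxΩ
              rw [mem_ball_iff_norm] at hy
              have hyz : R < ‖y‖ := by
                have := norm_sub_norm_le z y
                rw [norm_sub_rev] at this
                linarith
              have hy1 : ‖y‖ ≤ R + 2 := by
                have := norm_sub_norm_le y z
                linarith
              have hyΩ : y ∉ Ω := fun hyΩ => by
                have : ‖y‖ ≤ R := by simpa using hR hyΩ
                linarith
              have hxy0 : 0 < ‖x - y‖ := by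
                have := norm_sub_norm_le y x
                rw [norm_sub_rev] at this
                linarith
              rw [hy0 hyΩ, sub_zero, ← ofReal_norm, ENNReal.ofReal_rpow_of_nonneg
                (norm_nonneg _) zero_le_two, ← ENNReal.ofReal_mul (by positivity), Real.rpow_two,
                Real.norm_eq_abs, div_eq_mul_inv]
              gcongr
              have := norm_sub_le x y
              linarith
          _ ≤ _ := setLIntegral_le_lintegral _ _
      · simp [hx hxΩ]
    unfold gagliardo at h
    rw [if_neg hs0.ne', if_neg hs1.ne, ENNReal.rpow_lt_top_iff_of_pos (by norm_num)] at h
    have hc := normConst_pos (N := N) hs0 hs1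
    have hfin : ∫⁻ x, ∫⁻ y, ENNReal.ofReal (|u x - u y| ^ 2 / ‖x - y‖ ^ p) < ⊤ :=
      ENNReal.lt_top_of_mul_ne_top_right h.ne (by simpa using hc)
    have hfin2 := (lintegral_mono_ae hlow).trans_lt hfin
    rw [lintegral_mul_const _ (by fun_prop), lintegral_sq_eq_eLpNorm] at hfin2
    refine ⟨hm.aestronglyMeasurable, ?_⟩
    exact (ENNReal.rpow_lt_top_iff_of_pos two_pos).1 (ENNReal.lt_top_of_mul_ne_top_left hfin2.ne hκ)

end SpectralFormulaOne

/-! ### From the seminorms to the bilinear forms. -/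

section Polarization

theorem toReal_eLpNorm_sq {α E : Type*} [MeasurableSpace α] {μ : Measure α} [NormedAddCommGroup E]
    {f : α → E} (hf : MemLp f 2 μ) : (eLpNorm f 2 μ ^ (2 : ℝ)).toReal = ∫ x, ‖f x‖ ^ 2 ∂μ := by
  rw [← lintegral_sq_eq_eLpNorm, ← integral_toReal]
  · simp
  · exact hf.1.enorm.pow_const _
  · exact ae_of_all _ fun x => by simp

/-- Transfers identities between quadratic forms to the bilinear forms, in the shape in which the
seminorms appear. -/
theorem integral_inner_polarization {α E : Type*} [MeasurableSpace α] {μ : Measure α}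
    [NormedAddCommGroup E] [InnerProductSpace ℝ E] {f g : α → E} (hf : MemLp f 2 μ)
    (hg : MemLp g 2 μ) :
    ∫ x, inner ℝ (f x) (g x) ∂μ = ((eLpNorm (f + g) 2 μ ^ (2 : ℝ)).toReal -
      (eLpNorm (f - g) 2 μ ^ (2 : ℝ)).toReal) / 4 := by
  rw [toReal_eLpNorm_sq (hf.add hg), toReal_eLpNorm_sq (hf.sub hg),
    ← integral_sub (hf.add hg).norm.integrable_sq (hf.sub hg).norm.integrable_sq,
    ← integral_div]
  refine integral_congr_ae (ae_of_all _ fun x => ?_)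
  simp only [Pi.add_apply, Pi.sub_apply]
  rw [norm_add_sq_real, norm_sub_sq_real]
  ring

variable {N : ℕ}

local notation "𝔼" => EuclideanSpace ℝ (Fin N)

theorem IsWeakGradient.ae_eq {u : 𝔼 → ℝ} {G H : 𝔼 → 𝔼} (hG : IsWeakGradient u G)
    (hH : IsWeakGradient u H) : G =ᵐ[volume] H := by
  refine ae_eq_of_integral_contDiff_smul_eq hG.2.1 hH.2.1 fun φ hφ hc => ?_
  have h : ∀ K : 𝔼 → 𝔼, IsWeakGradient u K → ∀ e : 𝔼,
      inner ℝ (∫ x, φ x • K x) e = - ∫ x, u x * fderiv ℝ φ x e := fun K hK e => by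
    have hint : Integrable fun x => φ x • K x :=
      hK.2.1.integrable_smul_left_of_hasCompactSupport hφ.continuous hc
    rw [hK.2.2 φ hφ hc e, neg_neg, real_inner_comm, ← integral_inner hint e]
    refine integral_congr_ae (ae_of_all _ fun x => ?_)
    simp only [inner_smul_right]
    rw [real_inner_comm, mul_comm]
  refine ext_inner_right ℝ fun e => ?_
  rw [h G hG e, h H hH e]

variable [NeZero N]

/-- The chosen gradient is arbitrary, but uniqueness almost everywhere passes on the square
integrability of a competitor in the infimum. -/
theorem isWeakGradient_weakGradient {u : 𝔼 → ℝ} (h : gagliardo 1 u < ⊤) :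
    IsWeakGradient u (weakGradient u) ∧ MemLp (weakGradient u) 2 := by
  unfold gagliardo at h
  rw [if_neg one_ne_zero, if_pos rfl] at h
  simp only [iInf_lt_iff] at h
  obtain ⟨G, hG, hG2⟩ := h
  have hex : ∃ G, IsWeakGradient u G := ⟨G, hG⟩
  have hw : IsWeakGradient u (weakGradient u) := by
    unfold weakGradient
    rw [dif_pos hex]
    exact hex.choose_spec
  exact ⟨hw, (memLp_congr_ae (hG.ae_eq hw)).1 ⟨hG.2.1.aestronglyMeasurable, hG2⟩⟩

/-- The normalized difference quotient, whose `L²` norm is the Gagliardo seminorm. -/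
noncomputable def diffQuotient (s : ℝ) (u : 𝔼 → ℝ) (z : 𝔼 × 𝔼) : ℝ :=
  normConst N s ^ (1 / 2 : ℝ) * ((u z.1 - u z.2) * (‖z.1 - z.2‖ ^ ((N : ℝ) + 2 * s))⁻¹ ^ (1 / 2 : ℝ))

theorem gagliardo_eq_eLpNorm_diffQuotient {s : ℝ} (h0 : 0 < s) (h1 : s < 1) {u : 𝔼 → ℝ}
    (hu : Measurable u) :
    gagliardo s u = eLpNorm (diffQuotient s u) 2 (volume.prod volume) := by
  have hc := (normConst_pos (N := N) h0 h1).le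
  unfold gagliardo
  rw [if_neg h0.ne', if_neg h1.ne, gagliardo_eq_prod s hu,
    eLpNorm_eq_lintegral_rpow_enorm_toReal two_ne_zero ENNReal.ofNat_ne_top]
  simp only [ENNReal.toReal_ofNat]
  congr 1
  refine lintegral_congr fun z => ?_
  congr 1
  rw [diffQuotient, enorm_mul, ← ofReal_norm, ← ofReal_norm, norm_mul,
    Real.norm_of_nonneg (Real.rpow_nonneg hc _),
    Real.norm_of_nonneg (r := (‖z.1 - z.2‖ ^ ((N : ℝ) + 2 * s))⁻¹ ^ (1 / 2 : ℝ)) (by positivity),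
    ENNReal.ofReal_rpow_of_nonneg hc (by norm_num), Real.norm_eq_abs]

theorem measurable_diffQuotient (s : ℝ) {u : 𝔼 → ℝ} (hu : Measurable u) :
    Measurable (diffQuotient s u) := by
  unfold diffQuotient
  fun_prop

/-- The form `𝓔_s(u,v)` is the polarization of `[u]_s²`. -/
theorem gagliardoForm_eq_polarization {Ω : Set 𝔼} (hΩ : Bornology.IsBounded Ω) {u v : 𝔼 → ℝ}
    (hmu : Measurable u) (hmv : Measurable v) (hu2 : MemLp u 2) (hv2 : MemLp v 2)
    (hu0 : ∀ᵐ x, x ∉ Ω → u x = 0) (hv0 : ∀ᵐ x, x ∉ Ω → v x = 0) {s : ℝ} (hs0 : 0 ≤ s)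
    (hs1 : s ≤ 1) (hus : gagliardo s u < ⊤) (hvs : gagliardo s v < ⊤) :
    gagliardoForm s u v = ((gagliardo s (u + v) ^ (2 : ℝ)).toReal -
      (gagliardo s (u - v) ^ (2 : ℝ)).toReal) / 4 := by
  rcases hs0.eq_or_lt with rfl | hs0
  · have := integral_inner_polarization hu2 hv2
    simp only [gagliardoForm, gagliardo, if_true]
    rw [← this]
    simp [mul_comm]
  rcases hs1.eq_or_lt with rfl | hs1
  · obtain ⟨hGu, hGu2⟩ := isWeakGradient_weakGradient hus
    obtain ⟨hGv, hGv2⟩ := isWeakGradient_weakGradient hvs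
    have hui := integrable_of_vanishing hΩ hGu.1 hu0
    have hvi := integrable_of_vanishing hΩ hGv.1 hv0
    have hadd0 : ∀ᵐ x, x ∉ Ω → (u + v) x = 0 := by
      filter_upwards [hu0, hv0] with x h1 h2 hx
      simp [h1 hx, h2 hx]
    have hsub0 : ∀ᵐ x, x ∉ Ω → (u - v) x = 0 := by
      filter_upwards [hu0, hv0] with x h1 h2 hx
      simp [h1 hx, h2 hx]
    have hGsub : IsWeakGradient (u - v) (weakGradient u - weakGradient v) := by
      have := hGu.add (hGv.smul (-1))
      simpa [sub_eq_add_neg] using this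
    rw [gagliardo_one_sq hΩ (hui.add hvi) hadd0, gagliardo_one_sq hΩ (hui.sub hvi) hsub0,
      ← eLpNorm_weakGradient_sq hΩ (hGu.add hGv) hadd0 (hGu2.add hGv2),
      ← eLpNorm_weakGradient_sq hΩ hGsub hsub0 (hGu2.sub hGv2),
      ← integral_inner_polarization hGu2 hGv2]
    simp [gagliardoForm]
  · have hc := (normConst_pos (N := N) hs0 hs1).le
    have hadd : diffQuotient s (u + v) = diffQuotient s u + diffQuotient s v := by
      funext z
      simp only [diffQuotient, Pi.add_apply]
      ring
    have hsub : diffQuotient s (u - v) = diffQuotient s u - diffQuotient s v := by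
      funext z
      simp only [diffQuotient, Pi.sub_apply]
      ring
    have hdu : MemLp (diffQuotient s u) 2 (volume.prod volume) :=
      ⟨(measurable_diffQuotient s hmu).aestronglyMeasurable, by
        rwa [← gagliardo_eq_eLpNorm_diffQuotient hs0 hs1 hmu]⟩
    have hdv : MemLp (diffQuotient s v) 2 (volume.prod volume) :=
      ⟨(measurable_diffQuotient s hmv).aestronglyMeasurable, by
        rwa [← gagliardo_eq_eLpNorm_diffQuotient hs0 hs1 hmv]⟩
    rw [gagliardo_eq_eLpNorm_diffQuotient hs0 hs1 (hmu.add hmv),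
      gagliardo_eq_eLpNorm_diffQuotient hs0 hs1 (hmu.sub hmv), hadd, hsub,
      ← integral_inner_polarization hdu hdv]
    have hint : Integrable (fun z => inner ℝ (diffQuotient s u z) (diffQuotient s v z))
        (volume.prod volume) :=
      (hdu.integrable_mul hdv).congr (ae_of_all _ fun z => by simp [mul_comm])
    rw [integral_prod _ hint]
    unfold gagliardoForm
    rw [if_neg hs0.ne', if_neg hs1.ne]
    simp_rw [← integral_const_mul]
    refine integral_congr_ae (ae_of_all _ fun x => integral_congr_ae (ae_of_all _ fun y => ?_))
    have h1 : normConst N s ^ (1 / 2 : ℝ) * normConst N s ^ (1 / 2 : ℝ) = normConst N s := by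
      rw [← sq, ← Real.rpow_natCast, ← Real.rpow_mul hc]
      norm_num
    have hk : 0 ≤ (‖x - y‖ ^ ((N : ℝ) + 2 * s))⁻¹ := by positivity
    have h2 : (‖x - y‖ ^ ((N : ℝ) + 2 * s))⁻¹ ^ (1 / 2 : ℝ) *
        (‖x - y‖ ^ ((N : ℝ) + 2 * s))⁻¹ ^ (1 / 2 : ℝ) = (‖x - y‖ ^ ((N : ℝ) + 2 * s))⁻¹ := by
      rw [← sq, ← Real.rpow_natCast, ← Real.rpow_mul hk]
      norm_num
    simp only [diffQuotient, RCLike.inner_apply, conj_trivial]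
    rw [div_eq_mul_inv]
    linear_combination (-((u x - u y) * (v x - v y) * (‖x - y‖ ^ ((N : ℝ) + 2 * s))⁻¹)) * h1 -
      (normConst N s ^ (1 / 2 : ℝ)) ^ 2 * (u x - u y) * (v x - v y) * h2

end Polarization

/-! ### Superposition over `s` as one measure on frequency space. -/

section SpectralMeasure

variable {N : ℕ}

local notation "𝔼" => EuclideanSpace ℝ (Fin N)

/-- Square integrable functions vanishing outside `Ω`. -/
structure IsAdmissible (Ω : Set (EuclideanSpace ℝ (Fin N))) (u : EuclideanSpace ℝ (Fin N) → ℝ) :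
    Prop where
  measurable : Measurable u
  memLp : MemLp u 2
  vanishing : ∀ᵐ x, x ∉ Ω → u x = 0

variable {Ω : Set (EuclideanSpace ℝ (Fin N))} {u v : EuclideanSpace ℝ (Fin N) → ℝ}

theorem IsAdmissible.add (hu : IsAdmissible Ω u) (hv : IsAdmissible Ω v) :
    IsAdmissible Ω (u + v) :=
  ⟨hu.1.add hv.1, hu.2.add hv.2, by
    filter_upwards [hu.3, hv.3] with x h1 h2 hx
    simp [h1 hx, h2 hx]⟩

theorem IsAdmissible.sub (hu : IsAdmissible Ω u) (hv : IsAdmissible Ω v) :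
    IsAdmissible Ω (u - v) :=
  ⟨hu.1.sub hv.1, hu.2.sub hv.2, by
    filter_upwards [hu.3, hv.3] with x h1 h2 hx
    simp [h1 hx, h2 hx]⟩

theorem IsAdmissible.integrable (hΩ : Bornology.IsBounded Ω) (hu : IsAdmissible Ω u) :
    Integrable u :=
  integrable_of_vanishing hΩ (hu.memLp.locallyIntegrable one_le_two) hu.vanishing

theorem IsAdmissible.continuous_fourierReal (hΩ : Bornology.IsBounded Ω) (hu : IsAdmissible Ω u) :
    Continuous (fourierReal u) :=
  continuous_fourier_of_integrable (hu.integrable hΩ).ofReal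

theorem fourierReal_congr (h : u =ᵐ[volume] v) : fourierReal u = fourierReal v := by
  funext ξ
  refine Real.fourier_congr_ae ?_ ξ
  filter_upwards [h] with x hx
  rw [hx]

theorem IsAdmissible.fourierReal_add (hΩ : Bornology.IsBounded Ω) (hu : IsAdmissible Ω u)
    (hv : IsAdmissible Ω v) : fourierReal (u + v) = fourierReal u + fourierReal v := by
  funext ξ
  have := fourier_add_of_integrable (f := fun x => (u x : ℂ)) (g := fun x => (v x : ℂ))
    (hu.integrable hΩ).ofReal (hv.integrable hΩ).ofReal ξ
  simpa [fourierReal] using this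

theorem IsAdmissible.fourierReal_sub (hΩ : Bornology.IsBounded Ω) (hu : IsAdmissible Ω u)
    (hv : IsAdmissible Ω v) : fourierReal (u - v) = fourierReal u - fourierReal v := by
  funext ξ
  have := fourier_sub_of_integrable (f := fun x => (u x : ℂ)) (g := fun x => (v x : ℂ))
    (hu.integrable hΩ).ofReal (hv.integrable hΩ).ofReal ξ
  simpa [fourierReal] using this

theorem fourierReal_smul (a : ℝ) (u : 𝔼 → ℝ) : fourierReal (a • u) = a • fourierReal u := by
  funext ξ
  have := fourier_const_mul (fun x => (u x : ℂ)) a ξ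
  simpa [fourierReal] using this

theorem lintegral_fourierReal_sq (hΩ : Bornology.IsBounded Ω) (hu : IsAdmissible Ω u) :
    ∫⁻ ξ, ‖fourierReal u ξ‖ₑ ^ (2 : ℝ) = eLpNorm u 2 ^ (2 : ℝ) := by
  rw [fourierReal, lintegral_fourier_sq (f := fun x => (u x : ℂ)) (hu.integrable hΩ).ofReal
    hu.memLp.ofReal, lintegral_sq_eq_eLpNorm]
  congr 1
  exact eLpNorm_congr_norm_ae (ae_of_all _ fun x => by simp)

/-- The measure `(∫ |2πξ|^{2s} dμ(s)) dξ`. -/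
noncomputable def spectralMeasure (N : ℕ) (μ : Measure unitInterval) :
    Measure (EuclideanSpace ℝ (Fin N)) :=
  volume.withDensity fun ξ => ∫⁻ s : unitInterval, symbol (s : ℝ) ξ ∂μ

theorem measurable_symbol_unitInterval :
    Measurable fun p : 𝔼 × unitInterval => symbol (p.2 : ℝ) p.1 := by
  unfold symbol
  fun_prop

theorem lintegral_spectralMeasure (μ : Measure unitInterval) [SFinite μ] {f : 𝔼 → ℝ≥0∞}
    (hf : Measurable f) : ∫⁻ ξ, f ξ ∂(spectralMeasure N μ) =
      ∫⁻ s : unitInterval, (∫⁻ ξ, symbol (s : ℝ) ξ * f ξ) ∂μ := by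
  have hm : Measurable fun ξ : 𝔼 => ∫⁻ s : unitInterval, symbol (s : ℝ) ξ ∂μ :=
    measurable_symbol_unitInterval.lintegral_prod_right'
  rw [spectralMeasure, lintegral_withDensity_eq_lintegral_mul _ hm hf, lintegral_lintegral_swap]
  · refine lintegral_congr fun ξ => ?_
    rw [Pi.mul_apply, lintegral_mul_const]
    unfold symbol
    fun_prop
  · refine Measurable.aemeasurable ?_
    unfold symbol
    simp only [Function.uncurry_def]
    fun_prop

theorem enorm_sq_rpow_half (a : ℝ≥0∞) : (a ^ (2 : ℝ)) ^ (1 / 2 : ℝ) = a := by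
  rw [← ENNReal.rpow_mul]
  simp

theorem rpow_half_sq (a : ℝ≥0∞) : (a ^ (1 / 2 : ℝ)) ^ (2 : ℝ) = a := by
  rw [← ENNReal.rpow_mul]
  simp

variable [NeZero N]

theorem energyNorm_sq_eq_lintegral (hΩ : Bornology.IsBounded Ω) (hu : IsAdmissible Ω u)
    (μ : Measure unitInterval) :
    energyNorm μ u ^ (2 : ℝ) = ∫⁻ s : unitInterval, spectralEnergy (s : ℝ) u ∂μ := by
  unfold energyNorm
  rw [rpow_half_sq]
  exact lintegral_congr fun s => gagliardo_sq hΩ hu.1 hu.2 hu.3 s.2.1 s.2.2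

/-- Tonelli moves the integral over `s` into the density, so the energy norm becomes an ordinary
Hilbert space norm of `û`. -/
theorem energyNorm_eq_eLpNorm (hΩ : Bornology.IsBounded Ω) (hu : IsAdmissible Ω u)
    (μ : Measure unitInterval) [SFinite μ] :
    energyNorm μ u = eLpNorm (fourierReal u) 2 (spectralMeasure N μ) := by
  have hF := (hu.continuous_fourierReal hΩ).measurable
  rw [← enorm_sq_rpow_half (energyNorm μ u), energyNorm_sq_eq_lintegral hΩ hu,
    ← enorm_sq_rpow_half (eLpNorm _ _ _), ← lintegral_sq_eq_eLpNorm,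
    lintegral_spectralMeasure μ (by fun_prop)]
  rfl

theorem memLp_fourierReal (hΩ : Bornology.IsBounded Ω) (hu : IsAdmissible Ω u)
    {μ : Measure unitInterval} [SFinite μ] (h : energyNorm μ u < ⊤) :
    MemLp (fourierReal u) 2 (spectralMeasure N μ) :=
  ⟨(hu.continuous_fourierReal hΩ).aestronglyMeasurable, by
    rwa [← energyNorm_eq_eLpNorm hΩ hu]⟩

/-- Since `μ ≠ 0`, at least one order has a finite seminorm, and a single one is enough. -/
theorem memLp_of_energyNorm_lt_top (hΩ : Bornology.IsBounded Ω) (hm : Measurable u)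
    (h0 : ∀ᵐ x, x ∉ Ω → u x = 0) {μ : Measure unitInterval} (hμ : μ ≠ 0)
    (h : energyNorm μ u < ⊤) : IsAdmissible Ω u := by
  refine ⟨hm, ?_, h0⟩
  unfold energyNorm at h
  rw [ENNReal.rpow_lt_top_iff_of_pos (by norm_num)] at h
  have h1 := ae_lt_top (((measurable_gagliardo hm).comp measurable_subtype_coe).pow_const _) h.ne
  have : NeBot (ae μ) := ae_neBot.2 hμ
  obtain ⟨s, hs⟩ := h1.exists
  exact memLp_of_gagliardo_lt_top hΩ hm h0 s.2.1 s.2.2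
    ((ENNReal.rpow_lt_top_iff_of_pos two_pos).1 hs)

/-- The superposed form is an inner product on the Fourier side. -/
theorem integral_gagliardoForm (hΩ : Bornology.IsBounded Ω) (hu : IsAdmissible Ω u)
    (hv : IsAdmissible Ω v) {μ : Measure unitInterval} [SFinite μ] (hμu : energyNorm μ u < ⊤)
    (hμv : energyNorm μ v < ⊤) : ∫ s : unitInterval, gagliardoForm (s : ℝ) u v ∂μ =
      ∫ ξ, inner ℝ (fourierReal u ξ) (fourierReal v ξ) ∂(spectralMeasure N μ) := by
  have hmeas : ∀ w : 𝔼 → ℝ, Measurable w →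
      Measurable fun s : unitInterval => gagliardo (s : ℝ) w ^ (2 : ℝ) := fun w hw =>
    ((measurable_gagliardo hw).comp measurable_subtype_coe).pow_const _
  have hfin : ∀ w : 𝔼 → ℝ, energyNorm μ w < ⊤ →
      ∫⁻ s : unitInterval, gagliardo (s : ℝ) w ^ (2 : ℝ) ∂μ ≠ ⊤ := fun w hw => by
    unfold energyNorm at hw
    exact ((ENNReal.rpow_lt_top_iff_of_pos (by norm_num)).1 hw).ne
  have hae : ∀ w : 𝔼 → ℝ, Measurable w → energyNorm μ w < ⊤ →
      ∀ᵐ s : unitInterval ∂μ, gagliardo (s : ℝ) w < ⊤ := fun w hw hμw => by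
    filter_upwards [ae_lt_top (hmeas w hw) (hfin w hμw)] with s hs
    exact (ENNReal.rpow_lt_top_iff_of_pos two_pos).1 hs
  have hadm := hu.add hv
  have hsdm := hu.sub hv
  have hFu := memLp_fourierReal hΩ hu hμu
  have hFv := memLp_fourierReal hΩ hv hμv
  have haddF : energyNorm μ (u + v) =
      eLpNorm (fourierReal u + fourierReal v) 2 (spectralMeasure N μ) := by
    rw [energyNorm_eq_eLpNorm hΩ hadm, hu.fourierReal_add hΩ hv]
  have hsubF : energyNorm μ (u - v) =
      eLpNorm (fourierReal u - fourierReal v) 2 (spectralMeasure N μ) := by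
    rw [energyNorm_eq_eLpNorm hΩ hsdm, hu.fourierReal_sub hΩ hv]
  have haddt : energyNorm μ (u + v) < ⊤ := haddF ▸ (hFu.add hFv).2
  have hsubt : energyNorm μ (u - v) < ⊤ := hsubF ▸ (hFu.sub hFv).2
  have hval : ∀ w : 𝔼 → ℝ, Measurable w → energyNorm μ w < ⊤ →
      ∫ s : unitInterval, (gagliardo (s : ℝ) w ^ (2 : ℝ)).toReal ∂μ =
        (energyNorm μ w ^ (2 : ℝ)).toReal := fun w hw hμw => by
    rw [integral_toReal (hmeas w hw).aemeasurable (ae_lt_top (hmeas w hw) (hfin w hμw)),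
      energyNorm, rpow_half_sq]
  have hint : ∀ w : 𝔼 → ℝ, Measurable w → energyNorm μ w < ⊤ →
      Integrable (fun s : unitInterval => (gagliardo (s : ℝ) w ^ (2 : ℝ)).toReal) μ :=
    fun w hw hμw => integrable_toReal_of_lintegral_ne_top (hmeas w hw).aemeasurable (hfin w hμw)
  -- Both sides are polarized: on the left for almost every `s`, on the right in the `L²` space of
  -- the spectral measure. Only squares of energies remain to be compared.
  rw [integral_inner_polarization hFu hFv, ← haddF, ← hsubF, ← hval _ hadm.1 haddt,
    ← hval _ hsdm.1 hsubt, ← integral_sub (hint _ hadm.1 haddt) (hint _ hsdm.1 hsubt),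
    ← integral_div]
  refine integral_congr_ae ?_
  filter_upwards [hae u hu.1 hμu, hae v hv.1 hμv] with s h1 h2
  exact gagliardoForm_eq_polarization hΩ hu.1 hv.1 hu.2 hv.2 hu.3 hv.3 s.2.1 s.2.2 h1 h2

end SpectralMeasure

/-! ### Poincaré's inequality and comparison of orders. -/

section Poincare

variable {N : ℕ}

local notation "𝔼" => EuclideanSpace ℝ (Fin N)

variable {Ω : Set (EuclideanSpace ℝ (Fin N))} {u v : EuclideanSpace ℝ (Fin N) → ℝ}

/-- Cauchy–Schwarz on `closure Ω`, which unlike `Ω` is known to be measurable here. -/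
theorem lintegral_enorm_le (hu : IsAdmissible Ω u) :
    ∫⁻ x, ‖u x‖ₑ ≤ eLpNorm u 2 * volume (closure Ω) ^ (1 / 2 : ℝ) := by
  have h1 : u =ᵐ[volume] (closure Ω).indicator u := by
    filter_upwards [hu.3] with x hx
    by_cases hxc : x ∈ closure Ω
    · rw [indicator_of_mem hxc]
    · rw [indicator_of_notMem hxc, hx fun h => hxc (subset_closure h)]
  rw [← eLpNorm_one_eq_lintegral_enorm, eLpNorm_congr_ae h1,
    eLpNorm_indicator_eq_eLpNorm_restrict isClosed_closure.measurableSet]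
  refine (eLpNorm_le_eLpNorm_mul_rpow_measure_univ (p := 1) (q := 2) one_le_two
    hu.1.aestronglyMeasurable).trans ?_
  rw [Measure.restrict_apply_univ]
  gcongr ?_ * ?_
  · exact eLpNorm_restrict_le _ _ _ _
  · norm_num

theorem enorm_fourierReal_sq_le (hu : IsAdmissible Ω u) (ξ : 𝔼) :
    ‖fourierReal u ξ‖ₑ ^ (2 : ℝ) ≤ eLpNorm u 2 ^ (2 : ℝ) * volume (closure Ω) := by
  calc ‖fourierReal u ξ‖ₑ ^ (2 : ℝ)
      ≤ (eLpNorm u 2 * volume (closure Ω) ^ (1 / 2 : ℝ)) ^ (2 : ℝ) := by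
        gcongr
        exact (enorm_fourierReal_le u ξ).trans (lintegral_enorm_le hu)
    _ = _ := by rw [ENNReal.mul_rpow_of_nonneg _ _ zero_le_two, rpow_half_sq]

/-- For `V = |closure Ω|`, frequencies in this ball carry at most half of the `L²` norm. The
condition `2πr ≤ 1` makes `(2πr)^{2s}` decreasing in `s`, so that `s = 1` is the worst case. -/
theorem exists_small_ball [NeZero N] {V : ℝ≥0∞} (hV : V ≠ ⊤) : ∃ r : ℝ, 0 < r ∧
    2 * Real.pi * r ≤ 1 ∧ volume (Metric.closedBall (0 : 𝔼) r) * V ≤ ENNReal.ofReal (1 / 2) := by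
  set W := volume (Metric.ball (0 : 𝔼) 1) * V
  have hW : W ≠ ⊤ := ENNReal.mul_ne_top Metric.isBounded_ball.measure_lt_top.ne hV
  set K := W.toReal
  have hK : 0 ≤ K := ENNReal.toReal_nonneg
  -- The first bound gives `2πr ≤ 1`, the second `rK ≤ 1/2`; as `r ≤ 1` and `N ≥ 1`, also `r^N K ≤
  -- 1/2`.
  set r := min (1 / (2 * Real.pi)) (1 / (2 * (K + 1)))
  have hr : 0 < r := lt_min (by positivity) (by positivity)
  have hr1 : 2 * Real.pi * r ≤ 1 := by
    have := min_le_left (1 / (2 * Real.pi)) (1 / (2 * (K + 1)))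
    rw [mul_comm]
    exact (le_div_iff₀ (by positivity)).1 this
  have hrK : r * (2 * (K + 1)) ≤ 1 := by
    have := min_le_right (1 / (2 * Real.pi)) (1 / (2 * (K + 1)))
    exact (le_div_iff₀ (by positivity)).1 this
  have hr2 : r ≤ 1 := by nlinarith [Real.pi_gt_three]
  refine ⟨r, hr, hr1, ?_⟩
  rw [Measure.addHaar_closedBall _ _ hr.le, finrank_euclideanSpace_fin, mul_assoc]
  change ENNReal.ofReal (r ^ N) * W ≤ _
  rw [← ENNReal.ofReal_toReal hW, ← ENNReal.ofReal_mul (by positivity)]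
  refine ENNReal.ofReal_le_ofReal ?_
  have h1 : r ^ N ≤ r := by
    have := pow_le_pow_of_le_one hr.le hr2 (NeZero.one_le (n := N))
    rwa [pow_one] at this
  have h2 : r ^ N * K ≤ r * K := by gcongr
  change r ^ N * K ≤ 1 / 2
  nlinarith

/-- Poincaré's inequality, uniformly in the order `s ∈ [0,1]`. -/
theorem exists_poincare [NeZero N] (hΩ : Bornology.IsBounded Ω) : ∃ C : ℝ, 0 < C ∧
    ∀ u, IsAdmissible Ω u → ∀ s : ℝ, 0 ≤ s → s ≤ 1 →
      eLpNorm u 2 ^ (2 : ℝ) ≤ ENNReal.ofReal C * spectralEnergy s u := by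
  obtain ⟨r, hr, hr1, hrV⟩ := exists_small_ball (N := N)
    (hΩ.closure.measure_lt_top (μ := volume)).ne
  -- A lower bound for the symbol outside the ball, simultaneously for all `s ∈ [0,1]`.
  set q := (2 * Real.pi * r) ^ (2 : ℝ)
  have hq : 0 < q := by positivity
  refine ⟨2 * q⁻¹, by positivity, fun u hu s hs0 hs1 => ?_⟩
  have hE := lintegral_fourierReal_sq hΩ hu
  have hEtop : eLpNorm u 2 ^ (2 : ℝ) ≠ ⊤ := ENNReal.rpow_ne_top_of_nonneg zero_le_two hu.2.2.ne
  set E0 := eLpNorm u 2 ^ (2 : ℝ)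
  set A := Metric.closedBall (0 : 𝔼) r
  have hA : MeasurableSet A := Metric.isClosed_closedBall.measurableSet
  have h1 : ∫⁻ ξ in A, ‖fourierReal u ξ‖ₑ ^ (2 : ℝ) ≤ ENNReal.ofReal (1 / 2) * E0 := by
    calc ∫⁻ ξ in A, ‖fourierReal u ξ‖ₑ ^ (2 : ℝ) ≤ ∫⁻ _ in A, E0 * volume (closure Ω) :=
          lintegral_mono fun ξ => enorm_fourierReal_sq_le hu ξ
      _ = E0 * (volume A * volume (closure Ω)) := by
          rw [setLIntegral_const]
          ring
      _ ≤ E0 * ENNReal.ofReal (1 / 2) := by gcongr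
      _ = _ := mul_comm _ _
  have h2 : ∫⁻ ξ in Aᶜ, ‖fourierReal u ξ‖ₑ ^ (2 : ℝ) ≤
      ENNReal.ofReal q⁻¹ * spectralEnergy s u := by
    calc ∫⁻ ξ in Aᶜ, ‖fourierReal u ξ‖ₑ ^ (2 : ℝ)
        ≤ ∫⁻ ξ in Aᶜ, ENNReal.ofReal q⁻¹ * (symbol s ξ * ‖fourierReal u ξ‖ₑ ^ (2 : ℝ)) := by
          refine setLIntegral_mono' hA.compl fun ξ hξ => ?_
          rw [← mul_assoc]
          refine le_mul_of_one_le_left zero_le ?_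
          rw [symbol, ← ENNReal.ofReal_mul (by positivity), ENNReal.one_le_ofReal,
            ← div_eq_inv_mul, one_le_div hq]
          have hξ' : r < ‖ξ‖ := by simpa [A] using hξ
          calc q ≤ (2 * Real.pi * r) ^ (2 * s) :=
                Real.rpow_le_rpow_of_exponent_ge (by positivity) hr1 (by linarith)
            _ ≤ _ := by gcongr
      _ ≤ ∫⁻ ξ, ENNReal.ofReal q⁻¹ * (symbol s ξ * ‖fourierReal u ξ‖ₑ ^ (2 : ℝ)) :=
          setLIntegral_le_lintegral _ _
      _ = _ := lintegral_const_mul' _ _ ENNReal.ofReal_ne_top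
  have h3 : E0 ≤ ENNReal.ofReal (1 / 2) * E0 + ENNReal.ofReal q⁻¹ * spectralEnergy s u := by
    have hsplit : E0 = (∫⁻ ξ in A, ‖fourierReal u ξ‖ₑ ^ (2 : ℝ)) +
        ∫⁻ ξ in Aᶜ, ‖fourierReal u ξ‖ₑ ^ (2 : ℝ) := by rw [lintegral_add_compl _ hA, hE]
    exact hsplit.trans_le (add_le_add h1 h2)
  have hhalf : E0 = ENNReal.ofReal (1 / 2) * E0 + ENNReal.ofReal (1 / 2) * E0 := by
    rw [← add_mul, ← ENNReal.ofReal_add (by norm_num) (by norm_num)]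
    norm_num
  -- The low-frequency half is absorbed on the left; cancelling it requires `E0` to be finite.
  have h4 : ENNReal.ofReal (1 / 2) * E0 ≤ ENNReal.ofReal q⁻¹ * spectralEnergy s u := by
    refine (ENNReal.add_le_add_iff_left
      (ENNReal.mul_ne_top ENNReal.ofReal_ne_top hEtop : ENNReal.ofReal (1 / 2) * E0 ≠ ⊤)).1 ?_
    rw [← hhalf]
    exact h3
  calc E0 = ENNReal.ofReal 2 * (ENNReal.ofReal (1 / 2) * E0) := by
        rw [← mul_assoc, ← ENNReal.ofReal_mul (by norm_num)]
        norm_num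
    _ ≤ ENNReal.ofReal 2 * (ENNReal.ofReal q⁻¹ * spectralEnergy s u) := by gcongr
    _ = _ := by rw [← mul_assoc, ← ENNReal.ofReal_mul (by norm_num)]

theorem symbol_le_one_add {s s' : ℝ} (hs : 0 ≤ s) (hss : s ≤ s') (ξ : 𝔼) :
    symbol s ξ ≤ 1 + symbol s' ξ := by
  unfold symbol
  have hx : 0 ≤ 2 * Real.pi * ‖ξ‖ := by positivity
  rcases le_total (2 * Real.pi * ‖ξ‖) 1 with h | h
  · refine le_add_right ?_
    rw [ENNReal.ofReal_le_one]
    exact Real.rpow_le_one hx h (by positivity)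
  · refine le_add_left (ENNReal.ofReal_le_ofReal ?_)
    exact Real.rpow_le_rpow_of_exponent_le h (by linarith)

/-- Comparison of the energies of different orders, with a constant that depends only on the
domain. -/
theorem exists_spectralEnergy_le [NeZero N] (hΩ : Bornology.IsBounded Ω) : ∃ C : ℝ, 0 < C ∧
    ∀ u, IsAdmissible Ω u → ∀ s s' : ℝ, 0 ≤ s → s ≤ s' → s' ≤ 1 →
      eLpNorm u 2 ^ (2 : ℝ) ≤ ENNReal.ofReal C * spectralEnergy s' u ∧
      spectralEnergy s u ≤ ENNReal.ofReal C * spectralEnergy s' u := by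
  obtain ⟨C, hC, h⟩ := exists_poincare hΩ
  -- The symbol of order `s` is at most one plus that of order `s'`: Poincaré costs `C` for the
  -- first term, and the second costs `1`.
  refine ⟨C + 1, by positivity, fun u hu s s' hs hss hs' => ?_⟩
  have h1 := h u hu s' (hs.trans hss) hs'
  refine ⟨h1.trans (by gcongr; linarith), ?_⟩
  have hF := (hu.continuous_fourierReal hΩ).measurable
  calc spectralEnergy s u
      ≤ ∫⁻ ξ, (‖fourierReal u ξ‖ₑ ^ (2 : ℝ) + symbol s' ξ * ‖fourierReal u ξ‖ₑ ^ (2 : ℝ)) := by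
        refine lintegral_mono fun ξ => ?_
        calc symbol s ξ * ‖fourierReal u ξ‖ₑ ^ (2 : ℝ)
            ≤ (1 + symbol s' ξ) * ‖fourierReal u ξ‖ₑ ^ (2 : ℝ) := by
              gcongr
              exact symbol_le_one_add hs hss ξ
          _ = _ := by rw [add_mul, one_mul]
    _ = eLpNorm u 2 ^ (2 : ℝ) + spectralEnergy s' u := by
        rw [lintegral_add_left (by fun_prop), lintegral_fourierReal_sq hΩ hu]
        rfl
    _ ≤ ENNReal.ofReal C * spectralEnergy s' u + spectralEnergy s' u := by gcongr
    _ = _ := by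
        rw [ENNReal.ofReal_add hC.le zero_le_one, ENNReal.ofReal_one, add_mul, one_mul]

end Poincare

/-! ### Compactness of the embedding into `L²`. -/

section Compactness

variable {N : ℕ}

local notation "𝔼" => EuclideanSpace ℝ (Fin N)

variable {Ω : Set (EuclideanSpace ℝ (Fin N))} {u v : EuclideanSpace ℝ (Fin N) → ℝ}

/-- A sequence bounded in `L²` and vanishing outside a bounded set has a subsequence whose Fourier
transforms converge pointwise. -/
theorem exists_subseq_fourierReal_tendsto (hΩ : Bornology.IsBounded Ω) {f : ℕ → 𝔼 → ℝ}
    (hf : ∀ n, IsAdmissible Ω (f n)) {K : ℝ≥0∞} (hK : K ≠ ⊤) (hfK : ∀ n, eLpNorm (f n) 2 ≤ K) :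
    ∃ φ : ℕ → ℕ, StrictMono φ ∧
      ∀ ξ, ∃ z, Tendsto (fun n => fourierReal (f (φ n)) ξ) atTop (𝓝 z) := by
  let y : ℕ → Lp ℝ 2 (volume : Measure 𝔼) := fun n => (hf n).2.toLp
  let T : ℕ → WeakDual ℝ (Lp ℝ 2 (volume : Measure 𝔼)) := fun n =>
    StrongDual.toWeakDual (innerSL ℝ (y n))
  have hT : ∀ n, T n ∈ WeakDual.toStrongDual ⁻¹'
      Metric.closedBall (0 : StrongDual ℝ (Lp ℝ 2 (volume : Measure 𝔼))) K.toReal := by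
    intro n
    rw [mem_preimage, mem_closedBall_zero_iff]
    change ‖innerSL ℝ (y n)‖ ≤ _
    rw [innerSL_apply_norm, Lp.norm_toLp]
    exact ENNReal.toReal_mono hK (hfK n)
  -- A finite exponent makes `L²` separable, as the sequential form of the Banach–Alaoglu theorem
  -- requires.
  have : Fact ((2 : ℝ≥0∞) ≠ ⊤) := ⟨ENNReal.ofNat_ne_top⟩
  obtain ⟨L, -, φ, hφ, hL⟩ := WeakDual.isSeqCompact_closedBall ℝ
    (Lp ℝ 2 (volume : Measure 𝔼)) 0 K.toReal hT
  refine ⟨φ, hφ, fun ξ => ?_⟩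
  have hlim : ∀ h : Lp ℝ 2 (volume : Measure 𝔼),
      Tendsto (fun n => inner ℝ (y (φ n)) h) atTop (𝓝 (L h)) := fun h =>
    ((WeakDual.eval_continuous h).tendsto L).comp hL
  -- Bounded test functions such as plane waves are not in `L²`, but cutting them off outside
  -- `closure Ω` does not change the integrals.
  have hkey : ∀ k : 𝔼 → ℝ, Continuous k → (∀ x, |k x| ≤ 1) →
      ∃ a : ℝ, Tendsto (fun n => ∫ x, f (φ n) x * k x) atTop (𝓝 a) := by
    intro k hk hk1
    have hmem : MemLp ((closure Ω).indicator k) 2 := by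
      refine (memLp_indicator_iff_restrict isClosed_closure.measurableSet).2 ?_
      have : IsFiniteMeasure (volume.restrict (closure Ω)) :=
        ⟨by rw [Measure.restrict_apply_univ]; exact hΩ.closure.measure_lt_top⟩
      exact MemLp.of_bound hk.aestronglyMeasurable 1 (ae_of_all _ hk1)
    refine ⟨_, (hlim hmem.toLp).congr fun n => ?_⟩
    rw [L2.inner_def]
    refine integral_congr_ae ?_
    have hy : y (φ n) =ᵐ[volume] f (φ n) := (hf (φ n)).2.coeFn_toLp
    filter_upwards [hmem.coeFn_toLp, hy, (hf (φ n)).3] with x h1 h2 h3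
    rw [h1, h2]
    by_cases hx : x ∈ closure Ω
    · rw [indicator_of_mem hx]
      simp [mul_comm]
    · rw [h3 fun h => hx (subset_closure h)]
      simp
  obtain ⟨a, ha⟩ := hkey (fun x => Real.cos (2 * Real.pi * inner ℝ x ξ)) (by fun_prop)
    fun x => Real.abs_cos_le_one _
  obtain ⟨b, hb⟩ := hkey (fun x => Real.sin (2 * Real.pi * inner ℝ x ξ)) (by fun_prop)
    fun x => Real.abs_sin_le_one _
  refine ⟨(a : ℂ) - (b : ℂ) * Complex.I, ?_⟩
  simp_rw [fun n => fourierReal_eq_cos_sin ((hf (φ n)).integrable hΩ) ξ]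
  exact ((Complex.continuous_ofReal.tendsto a).comp ha).sub
    (((Complex.continuous_ofReal.tendsto b).comp hb).mul_const _)

theorem enorm_sub_sq_le {E : Type*} [SeminormedAddCommGroup E] (a b : E) :
    ‖a - b‖ₑ ^ (2 : ℝ) ≤ 2 * (‖a‖ₑ ^ (2 : ℝ) + ‖b‖ₑ ^ (2 : ℝ)) := by
  calc ‖a - b‖ₑ ^ (2 : ℝ) ≤ (‖a‖ₑ + ‖b‖ₑ) ^ (2 : ℝ) := by
        gcongr
        exact enorm_sub_le
    _ ≤ 2 ^ ((2 : ℝ) - 1) * (‖a‖ₑ ^ (2 : ℝ) + ‖b‖ₑ ^ (2 : ℝ)) :=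
        ENNReal.rpow_add_le_mul_rpow_add_rpow _ _ one_le_two
    _ = _ := by norm_num

/-- Compactness: a sequence with bounded energy of positive order has a subsequence that is Cauchy
in `L²`. -/
theorem exists_subseq_cauchy (hΩ : Bornology.IsBounded Ω) {f : ℕ → 𝔼 → ℝ}
    (hf : ∀ n, IsAdmissible Ω (f n)) {K : ℝ≥0∞} (hK : K ≠ ⊤) (hfK : ∀ n, eLpNorm (f n) 2 ≤ K)
    {s : ℝ} (hs : 0 < s) (hfs : ∀ n, spectralEnergy s (f n) ≤ K) :
    ∃ φ : ℕ → ℕ, StrictMono φ ∧ ∀ ε : ℝ≥0∞, 0 < ε → ∃ n₀, ∀ m ≥ n₀, ∀ n ≥ n₀,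
      eLpNorm (f (φ m) - f (φ n)) 2 ^ (2 : ℝ) ≤ ε := by
  obtain ⟨φ, hφ, hlim⟩ := exists_subseq_fourierReal_tendsto hΩ hf hK hfK
  choose g hg using hlim
  refine ⟨φ, hφ, fun ε hε => ?_⟩
  set F : ℕ → 𝔼 → ℂ := fun n => fourierReal (f (φ n))
  have hFm : ∀ n, Measurable (F n) := fun n => ((hf _).continuous_fourierReal hΩ).measurable
  have hgm : Measurable g := measurable_of_tendsto_metrizable hFm (tendsto_pi_nhds.2 hg)
  set M := K ^ (2 : ℝ) * volume (closure Ω)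
  have hM : M ≠ ⊤ := ENNReal.mul_ne_top (ENNReal.rpow_ne_top_of_nonneg zero_le_two hK)
    (hΩ.closure.measure_lt_top (μ := volume)).ne
  have hFM : ∀ n ξ, ‖F n ξ‖ₑ ^ (2 : ℝ) ≤ M := fun n ξ =>
    (enorm_fourierReal_sq_le (hf _) ξ).trans
      (mul_le_mul' (ENNReal.rpow_le_rpow (hfK _) zero_le_two) le_rfl)
  have hgM : ∀ ξ, ‖g ξ‖ₑ ^ (2 : ℝ) ≤ M := fun ξ =>
    le_of_tendsto ((ENNReal.continuous_rpow_const.tendsto _).comp (hg ξ).enorm)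
      (Eventually.of_forall fun n => hFM n ξ)
  -- Outside the ball of radius `R` the symbol is at least `R^{2s}`, so each tail is at most
  -- `K/R^{2s}`; the square of a difference adds the factor `4`. Here `s > 0` is essential.
  have htail : Tendsto (fun R : ℝ => ENNReal.ofReal ((R ^ (2 * s))⁻¹) * (4 * K)) atTop (𝓝 0) := by
    have h1 : Tendsto (fun R : ℝ => (R ^ (2 * s))⁻¹) atTop (𝓝 0) :=
      (tendsto_rpow_atTop (by positivity)).inv_tendsto_atTop
    have h2 := ENNReal.Tendsto.mul_const (ENNReal.tendsto_ofReal h1) (b := 4 * K)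
      (Or.inr (ENNReal.mul_ne_top (by simp) hK))
    simpa using h2
  have hε2 : 0 < ε / 2 := ENNReal.half_pos hε.ne'
  obtain ⟨R, hR, hR0⟩ := ((htail.eventually (ge_mem_nhds hε2)).and (eventually_gt_atTop 0)).exists
  set A := Metric.closedBall (0 : 𝔼) R
  have hA : MeasurableSet A := Metric.isClosed_closedBall.measurableSet
  -- On the ball, pointwise convergence and the uniform bound `M` permit dominated convergence.
  have hball : Tendsto (fun n => ∫⁻ ξ in A, ‖F n ξ - g ξ‖ₑ ^ (2 : ℝ)) atTop (𝓝 0) := by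
    have h1 : Tendsto (fun n => ∫⁻ ξ in A, ‖F n ξ - g ξ‖ₑ ^ (2 : ℝ)) atTop
        (𝓝 (∫⁻ _ in A, 0)) := by
      refine tendsto_lintegral_of_dominated_convergence (fun _ => 2 * (M + M))
        (fun n => (((hFm n).sub hgm).enorm.pow_const _)) (fun n => ae_of_all _ fun ξ => ?_) ?_
        (ae_of_all _ fun ξ => ?_)
      · refine (enorm_sub_sq_le _ _).trans ?_
        exact mul_le_mul' le_rfl (add_le_add (hFM n ξ) (hgM ξ))
      · rw [setLIntegral_const]
        exact ENNReal.mul_ne_top (ENNReal.mul_ne_top (by simp) (ENNReal.add_ne_top.2 ⟨hM, hM⟩))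
          (isCompact_closedBall (0 : 𝔼) R).measure_lt_top.ne
      · have h2 : Tendsto (fun n => F n ξ - g ξ) atTop (𝓝 0) := by
          simpa using (hg ξ).sub_const (g ξ)
        simpa [Function.comp_def] using
          ((ENNReal.continuous_rpow_const (y := 2)).tendsto _).comp h2.enorm
    simpa using h1
  -- Two terms, each doubled by `|a - b|² ≤ 2(|a|² + |b|²)`, add up to `ε/2`.
  have hε8 : 0 < ε / 8 := ENNReal.div_pos hε.ne' (by simp)
  obtain ⟨n₀, hn₀⟩ := eventually_atTop.1 (hball.eventually (ge_mem_nhds hε8))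
  refine ⟨n₀, fun m hm n hn => ?_⟩
  have hsub : fourierReal (f (φ m) - f (φ n)) = F m - F n := (hf _).fourierReal_sub hΩ (hf _)
  rw [← lintegral_fourierReal_sq hΩ ((hf _).sub (hf _)), hsub, ← lintegral_add_compl _ hA,
    ← ENNReal.add_halves ε]
  refine add_le_add ?_ ?_
  · calc ∫⁻ ξ in A, ‖(F m - F n) ξ‖ₑ ^ (2 : ℝ)
        ≤ ∫⁻ ξ in A, 2 * (‖F m ξ - g ξ‖ₑ ^ (2 : ℝ) + ‖F n ξ - g ξ‖ₑ ^ (2 : ℝ)) := by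
          refine lintegral_mono fun ξ => ?_
          refine le_trans (le_of_eq ?_) (enorm_sub_sq_le _ _)
          simp
      _ = 2 * (∫⁻ ξ in A, ‖F m ξ - g ξ‖ₑ ^ (2 : ℝ)) +
          2 * ∫⁻ ξ in A, ‖F n ξ - g ξ‖ₑ ^ (2 : ℝ) := by
          have hm1 : Measurable fun ξ => ‖F m ξ - g ξ‖ₑ ^ (2 : ℝ) :=
            ((hFm m).sub hgm).enorm.pow_const _
          rw [lintegral_const_mul' _ _ (by simp), lintegral_add_left hm1, mul_add]
      _ ≤ 2 * (ε / 8) + 2 * (ε / 8) := by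
          gcongr
          · exact hn₀ m hm
          · exact hn₀ n hn
      _ = ε / 2 := by
          rw [← add_mul, div_eq_mul_inv, div_eq_mul_inv, mul_left_comm]
          congr 1
          rw [show (8 : ℝ≥0∞) = 4 * 2 by norm_num, ENNReal.mul_inv (by simp) (by simp), ← mul_assoc,
            show (2 : ℝ≥0∞) + 2 = 4 by norm_num, ENNReal.mul_inv_cancel (by simp) (by simp), one_mul]
  · have htl : ∀ k, ∫⁻ ξ in Aᶜ, ‖F k ξ‖ₑ ^ (2 : ℝ) ≤ ENNReal.ofReal ((R ^ (2 * s))⁻¹) * K := by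
      intro k
      calc ∫⁻ ξ in Aᶜ, ‖F k ξ‖ₑ ^ (2 : ℝ)
          ≤ ∫⁻ ξ in Aᶜ, ENNReal.ofReal ((R ^ (2 * s))⁻¹) *
              (symbol s ξ * ‖F k ξ‖ₑ ^ (2 : ℝ)) := by
            refine setLIntegral_mono' hA.compl fun ξ hξ => ?_
            rw [← mul_assoc]
            refine le_mul_of_one_le_left zero_le ?_
            have hRs : 0 < R ^ (2 * s) := by positivity
            rw [symbol, ← ENNReal.ofReal_mul (by positivity), ENNReal.one_le_ofReal,
              ← div_eq_inv_mul, one_le_div hRs]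
            have hξ' : R < ‖ξ‖ := by simpa [A] using hξ
            have : R ≤ 2 * Real.pi * ‖ξ‖ := by nlinarith [Real.pi_gt_three]
            gcongr
        _ ≤ ∫⁻ ξ, ENNReal.ofReal ((R ^ (2 * s))⁻¹) * (symbol s ξ * ‖F k ξ‖ₑ ^ (2 : ℝ)) :=
            setLIntegral_le_lintegral _ _
        _ = ENNReal.ofReal ((R ^ (2 * s))⁻¹) * spectralEnergy s (f (φ k)) :=
            lintegral_const_mul' _ _ ENNReal.ofReal_ne_top
        _ ≤ _ := by
            gcongr
            exact hfs _
    calc ∫⁻ ξ in Aᶜ, ‖(F m - F n) ξ‖ₑ ^ (2 : ℝ)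
        ≤ ∫⁻ ξ in Aᶜ, 2 * (‖F m ξ‖ₑ ^ (2 : ℝ) + ‖F n ξ‖ₑ ^ (2 : ℝ)) :=
          lintegral_mono fun ξ => enorm_sub_sq_le _ _
      _ = 2 * ((∫⁻ ξ in Aᶜ, ‖F m ξ‖ₑ ^ (2 : ℝ)) + ∫⁻ ξ in Aᶜ, ‖F n ξ‖ₑ ^ (2 : ℝ)) := by
          rw [lintegral_const_mul' _ _ (by simp), lintegral_add_left ((hFm m).enorm.pow_const _)]
      _ ≤ 2 * (ENNReal.ofReal ((R ^ (2 * s))⁻¹) * K + ENNReal.ofReal ((R ^ (2 * s))⁻¹) * K) := by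
          gcongr
          · exact htl m
          · exact htl n
      _ = ENNReal.ofReal ((R ^ (2 * s))⁻¹) * (4 * K) := by ring
      _ ≤ ε / 2 := hR

end Compactness

/-! ### Bilinear forms pulled back from a Hilbert space. -/

section InnerForm

variable {X H : Type*} [NormedAddCommGroup X] [NormedSpace ℝ X] [NormedAddCommGroup H]
  [InnerProductSpace ℝ H]

/-- The bounded bilinear form `(u, v) ↦ ⟪T u, T v⟫`. -/
noncomputable def innerForm (T : X →L[ℝ] H) : X →L[ℝ] X →L[ℝ] ℝ :=
  LinearMap.mkContinuous₂
    (LinearMap.mk₂ ℝ (fun u v => inner ℝ (T u) (T v))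
      (fun u u' v => by rw [map_add, inner_add_left])
      (fun a u v => by rw [map_smul, real_inner_smul_left, smul_eq_mul])
      (fun u v v' => by rw [map_add, inner_add_right])
      (fun a u v => by rw [map_smul, real_inner_smul_right, smul_eq_mul]))
    (‖T‖ * ‖T‖) fun u v => by
      refine (norm_inner_le_norm _ _).trans ?_
      calc ‖T u‖ * ‖T v‖ ≤ (‖T‖ * ‖u‖) * (‖T‖ * ‖v‖) := by
            gcongr <;> exact T.le_opNorm _
        _ = _ := by ring

theorem innerForm_apply (T : X →L[ℝ] H) (u v : X) : innerForm T u v = inner ℝ (T u) (T v) := rfl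

end InnerForm

/-! ### `X₀(Ω)` in frequency space and in `L²(Ω)`. -/

section Embeddings

theorem eLpNorm_restrict_of_vanishing {N : ℕ} {Ω : Set (EuclideanSpace ℝ (Fin N))}
    (hΩm : MeasurableSet Ω) {u : EuclideanSpace ℝ (Fin N) → ℝ}
    (hu : ∀ᵐ x, x ∉ Ω → u x = 0) : eLpNorm u 2 (volume.restrict Ω) = eLpNorm u 2 := by
  rw [← eLpNorm_indicator_eq_eLpNorm_restrict hΩm]
  refine eLpNorm_congr_ae ?_
  filter_upwards [hu] with x hx
  by_cases h : x ∈ Ω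
  · rw [indicator_of_mem h]
  · rw [indicator_of_notMem h, hx h]

variable {N : ℕ} [NeZero N]

local notation "𝔼" => EuclideanSpace ℝ (Fin N)

variable {Ω : Set (EuclideanSpace ℝ (Fin N))} {μp : Measure unitInterval} {sbar : unitInterval}
  {hΩ : Bornology.IsBounded Ω} {hμ : 0 < μp (Icc sbar 1)}

namespace X0

theorem isAdmissible (u : X0 hΩ hμ) : IsAdmissible Ω u.fn := by
  refine memLp_of_energyNorm_lt_top hΩ u.1.measurable u.2.1 ?_ u.energyNorm_lt_top
  rintro rfl
  simp at hμ

theorem fn_add (u v : X0 hΩ hμ) : (u + v).fn =ᵐ[volume] u.fn + v.fn := AEEqFun.coeFn_add u.1 v.1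

theorem fn_sub (u v : X0 hΩ hμ) : (u - v).fn =ᵐ[volume] u.fn - v.fn := AEEqFun.coeFn_sub u.1 v.1

theorem fn_smul (a : ℝ) (u : X0 hΩ hμ) : (a • u).fn =ᵐ[volume] a • u.fn :=
  AEEqFun.coeFn_smul a u.1

/-- The Fourier transform as a map into the `L²` space of the spectral measure of `μ`. -/
noncomputable def fourierMap (μ : Measure unitInterval) [SFinite μ]
    (h : ∀ u : X0 hΩ hμ, energyNorm μ u.fn < ⊤) :
    X0 hΩ hμ →ₗ[ℝ] Lp ℂ 2 (spectralMeasure N μ) where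
  toFun u := (memLp_fourierReal hΩ u.isAdmissible (h u)).toLp
  map_add' u v := by
    rw [← MemLp.toLp_add]
    refine MemLp.toLp_congr _ _ (ae_of_all _ fun ξ => ?_)
    rw [fourierReal_congr (fn_add u v), u.isAdmissible.fourierReal_add hΩ v.isAdmissible]
  map_smul' a u := by
    rw [RingHom.id_apply, ← MemLp.toLp_const_smul]
    refine MemLp.toLp_congr _ _ (ae_of_all _ fun ξ => ?_)
    rw [fourierReal_congr (fn_smul a u), fourierReal_smul]

theorem norm_fourierMap {μ : Measure unitInterval} [SFinite μ]
    (h : ∀ u : X0 hΩ hμ, energyNorm μ u.fn < ⊤) (u : X0 hΩ hμ) :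
    ‖fourierMap μ h u‖ = (energyNorm μ u.fn).toReal := by
  rw [energyNorm_eq_eLpNorm hΩ u.isAdmissible]
  exact Lp.norm_toLp _ (memLp_fourierReal hΩ u.isAdmissible (h u))

theorem inner_fourierMap {μ : Measure unitInterval} [SFinite μ]
    (h : ∀ u : X0 hΩ hμ, energyNorm μ u.fn < ⊤) (u v : X0 hΩ hμ) :
    inner ℝ (fourierMap μ h u) (fourierMap μ h v) =
      ∫ s : unitInterval, gagliardoForm (s : ℝ) u.fn v.fn ∂μ := by
  rw [integral_gagliardoForm hΩ u.isAdmissible v.isAdmissible (h u) (h v), L2.inner_def]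
  refine integral_congr_ae ?_
  filter_upwards [(memLp_fourierReal hΩ u.isAdmissible (h u)).coeFn_toLp,
    (memLp_fourierReal hΩ v.isAdmissible (h v)).coeFn_toLp] with ξ h1 h2
  change inner ℝ ((memLp_fourierReal hΩ u.isAdmissible (h u)).toLp _ ξ)
    ((memLp_fourierReal hΩ v.isAdmissible (h v)).toLp _ ξ) = _
  rw [h1, h2]

/-- Restriction to `Ω` as a map into `L²(Ω)`. -/
noncomputable def toL2 : X0 hΩ hμ →ₗ[ℝ] Lp ℝ 2 (volume.restrict Ω) where
  toFun u := (u.isAdmissible.memLp.restrict Ω).toLp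
  map_add' u v := by
    rw [← MemLp.toLp_add]
    exact MemLp.toLp_congr _ _ (ae_restrict_of_ae (fn_add u v))
  map_smul' a u := by
    rw [RingHom.id_apply, ← MemLp.toLp_const_smul]
    exact MemLp.toLp_congr _ _ (ae_restrict_of_ae (fn_smul a u))

theorem coeFn_toL2 (u : X0 hΩ hμ) : toL2 u =ᵐ[volume.restrict Ω] u.fn :=
  MemLp.coeFn_toLp (u.isAdmissible.memLp.restrict Ω)

theorem inner_toL2 (u v : X0 hΩ hμ) :
    inner ℝ (toL2 u) (toL2 v) = ∫ x in Ω, u.fn x * v.fn x := by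
  rw [L2.inner_def]
  refine integral_congr_ae ?_
  filter_upwards [coeFn_toL2 u, coeFn_toL2 v] with x h1 h2
  rw [h1, h2]
  simp [mul_comm]

end X0

theorem X0.norm_toL2 (hΩm : MeasurableSet Ω) (u : X0 hΩ hμ) :
    ‖toL2 u‖ = (eLpNorm u.fn 2).toReal := by
  rw [← eLpNorm_restrict_of_vanishing hΩm u.isAdmissible.vanishing]
  exact Lp.norm_toLp _ (u.isAdmissible.memLp.restrict Ω)

/-- A bound valid at every order in `[s̄,1]` is integrated against `μ⁺` there. It serves for the
`L²` norm and for energies of lower order alike. -/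
theorem mul_measure_le_energyNorm_sq (hΩ : Bornology.IsBounded Ω) {u : 𝔼 → ℝ}
    (hu : IsAdmissible Ω u) (μp : Measure unitInterval) (sbar : unitInterval) {a : ℝ≥0∞} {C : ℝ}
    (h : ∀ s : unitInterval, sbar ≤ s → a ≤ ENNReal.ofReal C * spectralEnergy (s : ℝ) u) :
    a * μp (Icc sbar 1) ≤ ENNReal.ofReal C * energyNorm μp u ^ (2 : ℝ) := by
  rw [energyNorm_sq_eq_lintegral hΩ hu, ← lintegral_const_mul' _ _ ENNReal.ofReal_ne_top,
    ← setLIntegral_const]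
  exact (setLIntegral_mono' measurableSet_Icc fun s hs => h s hs.1).trans
    (setLIntegral_le_lintegral _ _)

/-- The contribution of the small orders is dominated by that of the large ones. -/
theorem energyNorm_restrict_sq_le (hΩ : Bornology.IsBounded Ω) {u : 𝔼 → ℝ}
    (hu : IsAdmissible Ω u) {μp μm : Measure unitInterval} [IsFiniteMeasure μp]
    {sbar : unitInterval} (hμ : 0 < μp (Icc sbar 1)) {C γ : ℝ}
    (hC : ∀ s s' : ℝ, 0 ≤ s → s ≤ s' → s' ≤ 1 →
      spectralEnergy s u ≤ ENNReal.ofReal C * spectralEnergy s' u) (hC0 : 0 ≤ C)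
    (hμm : μm (Icc 0 sbar) ≤ ENNReal.ofReal γ * μp (Icc sbar 1)) :
    energyNorm (μm.restrict (Icc 0 sbar)) u ^ (2 : ℝ) ≤
      ENNReal.ofReal (C * γ) * energyNorm μp u ^ (2 : ℝ) := by
  -- Multiplying by the finite positive mass `μ⁺([s̄,1])` lets each order `s ≤ s̄` be compared with
  -- all orders in `[s̄,1]` at once.
  refine (ENNReal.mul_le_mul_iff_left hμ.ne' (measure_lt_top μp _).ne).1 ?_
  have h1 : ∀ s ∈ Icc 0 sbar, spectralEnergy (s : ℝ) u * μp (Icc sbar 1) ≤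
      ENNReal.ofReal C * energyNorm μp u ^ (2 : ℝ) := fun s hs =>
    mul_measure_le_energyNorm_sq hΩ hu μp sbar fun s' hs' =>
      hC s s' s.2.1 (hs.2.trans hs') s'.2.2
  calc energyNorm (μm.restrict (Icc 0 sbar)) u ^ (2 : ℝ) * μp (Icc sbar 1)
      = ∫⁻ s in Icc 0 sbar, spectralEnergy (s : ℝ) u * μp (Icc sbar 1) ∂μm := by
        rw [energyNorm_sq_eq_lintegral hΩ hu, lintegral_mul_const' _ _ (measure_lt_top μp _).ne]
    _ ≤ ∫⁻ _ in Icc 0 sbar, ENNReal.ofReal C * energyNorm μp u ^ (2 : ℝ) ∂μm :=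
        setLIntegral_mono' measurableSet_Icc h1
    _ = ENNReal.ofReal C * energyNorm μp u ^ (2 : ℝ) * μm (Icc 0 sbar) := setLIntegral_const _ _
    _ ≤ ENNReal.ofReal C * energyNorm μp u ^ (2 : ℝ) *
        (ENNReal.ofReal γ * μp (Icc sbar 1)) := by gcongr
    _ = _ := by
        rw [ENNReal.ofReal_mul hC0]
        ring

theorem measure_mul_norm_toL2_sq_le (hΩm : MeasurableSet Ω) (u : X0 hΩ hμ) {C : ℝ} (hC : 0 ≤ C)
    (h : ∀ s : unitInterval, eLpNorm u.fn 2 ^ (2 : ℝ) ≤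
      ENNReal.ofReal C * spectralEnergy (s : ℝ) u.fn) :
    ‖X0.toL2 u‖ ^ 2 * (μp (Icc sbar 1)).toReal ≤ C * ‖u‖ ^ 2 := by
  have h2 := ENNReal.toReal_mono (ENNReal.mul_ne_top ENNReal.ofReal_ne_top
    (ENNReal.rpow_ne_top_of_nonneg zero_le_two u.energyNorm_lt_top.ne))
    (mul_measure_le_energyNorm_sq hΩ u.isAdmissible μp sbar (fun s _ => h s))
  rw [X0.norm_toL2 hΩm, X0.norm_def]
  rwa [ENNReal.toReal_mul, ENNReal.toReal_mul, ← ENNReal.toReal_rpow, ← ENNReal.toReal_rpow,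
    ENNReal.toReal_ofReal hC, Real.rpow_two, Real.rpow_two] at h2

theorem exists_norm_toL2_le [IsFiniteMeasure μp] (hΩm : MeasurableSet Ω) :
    ∃ D : ℝ, 0 ≤ D ∧ ∀ u : X0 hΩ hμ, ‖X0.toL2 u‖ ≤ D * ‖u‖ := by
  obtain ⟨C, hC, h⟩ := exists_spectralEnergy_le (N := N) hΩ
  have hMr : 0 < (μp (Icc sbar 1)).toReal := ENNReal.toReal_pos hμ.ne' (measure_lt_top μp _).ne
  refine ⟨√(C / (μp (Icc sbar 1)).toReal), by positivity, fun u => ?_⟩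
  have h2 := measure_mul_norm_toL2_sq_le hΩm u hC.le fun s =>
    (h u.fn u.isAdmissible s s s.2.1 le_rfl s.2.2).1
  refine le_of_sq_le_sq ?_ (mul_nonneg (Real.sqrt_nonneg _) (norm_nonneg u))
  rwa [mul_pow, Real.sq_sqrt (div_pos hC hMr).le, div_mul_eq_mul_div, le_div_iff₀ hMr]

variable [IsFiniteMeasure μp]

/-- The embedding of `X₀(Ω)` into `L²(Ω)`. -/
noncomputable def embL2 (hΩ : Bornology.IsBounded Ω) (hμ : 0 < μp (Icc sbar 1))
    (hΩm : MeasurableSet Ω) : X0 hΩ hμ →L[ℝ] Lp ℝ 2 (volume.restrict Ω) :=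
  X0.toL2.mkContinuous (exists_norm_toL2_le hΩm).choose (exists_norm_toL2_le hΩm).choose_spec.2

theorem embL2_apply (hΩm : MeasurableSet Ω) (u : X0 hΩ hμ) : embL2 hΩ hμ hΩm u = X0.toL2 u := rfl

/-- The embedding of `X₀(Ω)` into `L²(Ω)` is compact. -/
theorem exists_subseq_cauchySeq_embL2 (hΩm : MeasurableSet Ω) (hs : 0 < sbar)
    (u : ℕ → X0 hΩ hμ) (R : ℝ) (hu : ∀ n, ‖u n‖ ≤ R) :
    ∃ φ : ℕ → ℕ, StrictMono φ ∧ CauchySeq fun n => embL2 hΩ hμ hΩm (u (φ n)) := by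
  obtain ⟨C, hC, h⟩ := exists_spectralEnergy_le (N := N) hΩ
  set M := μp (Icc sbar 1)
  have hM : M ≠ ⊤ := (measure_lt_top μp _).ne
  have hE : ∀ n, energyNorm μp (u n).fn ≤ ENNReal.ofReal R := fun n => by
    rw [← ENNReal.ofReal_toReal (u n).energyNorm_lt_top.ne]
    exact ENNReal.ofReal_le_ofReal (hu n)
  set K := ENNReal.ofReal C * ENNReal.ofReal R ^ (2 : ℝ) / M
  have hK : K ≠ ⊤ := ENNReal.div_ne_top (ENNReal.mul_ne_top ENNReal.ofReal_ne_top
    (ENNReal.rpow_ne_top_of_nonneg zero_le_two ENNReal.ofReal_ne_top)) hμ.ne'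
  have hbound : ∀ n, ∀ a : ℝ≥0∞,
      (∀ s : unitInterval, sbar ≤ s → a ≤ ENNReal.ofReal C * spectralEnergy (s : ℝ) (u n).fn) →
      a ≤ K := fun n a ha => by
    rw [ENNReal.le_div_iff_mul_le (Or.inl hμ.ne') (Or.inl hM)]
    refine (mul_measure_le_energyNorm_sq hΩ (u n).isAdmissible μp sbar ha).trans ?_
    gcongr
    exact hE n
  have hK1 : ∀ n, eLpNorm (u n).fn 2 ≤ K ^ (1 / 2 : ℝ) := fun n => by
    rw [← enorm_sq_rpow_half (eLpNorm (u n).fn 2 volume)]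
    exact ENNReal.rpow_le_rpow (hbound n _ fun s _ =>
      (h _ (u n).isAdmissible s s s.2.1 le_rfl s.2.2).1) (by norm_num)
  -- The order `s̄` itself may be a null set for `μ⁺`, but its energy is dominated by that of every
  -- higher order.
  have hK2 : ∀ n, spectralEnergy (sbar : ℝ) (u n).fn ≤ K := fun n =>
    hbound n _ fun s hs' => (h _ (u n).isAdmissible sbar s sbar.2.1 hs' s.2.2).2
  -- One constant has to bound both an unsquared norm and a squared energy, hence the maximum.
  obtain ⟨φ, hφ, hc⟩ := exists_subseq_cauchy hΩ (f := fun n => (u n).fn)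
    (fun n => (u n).isAdmissible) (K := max K (K ^ (1 / 2 : ℝ)))
    (max_lt hK.lt_top (ENNReal.rpow_lt_top_of_nonneg (by norm_num) hK)).ne
    (fun n => (hK1 n).trans (le_max_right _ _)) (s := sbar) hs
    fun n => (hK2 n).trans (le_max_left _ _)
  refine ⟨φ, hφ, Metric.cauchySeq_iff.2 fun ε hε => ?_⟩
  obtain ⟨n₀, hn₀⟩ := hc (ENNReal.ofReal ((ε / 2) ^ 2)) (ENNReal.ofReal_pos.2 (by positivity))
  refine ⟨n₀, fun m hm n hn => ?_⟩
  rw [dist_eq_norm, ← map_sub, embL2_apply, X0.norm_toL2 hΩm,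
    eLpNorm_congr_ae (X0.fn_sub _ _)]
  have h1 := ENNReal.toReal_mono ENNReal.ofReal_ne_top (hn₀ m hm n hn)
  rw [← ENNReal.toReal_rpow, ENNReal.toReal_ofReal (by positivity), Real.rpow_two] at h1
  have h2 := le_of_sq_le_sq h1 (by positivity)
  linarith

end Embeddings

/-! ### Completeness of `X₀(Ω)`. -/

section Complete

variable {N : ℕ} [NeZero N]

local notation "𝔼" => EuclideanSpace ℝ (Fin N)

variable {Ω : Set (EuclideanSpace ℝ (Fin N))} {μp : Measure unitInterval} {sbar : unitInterval}

/-- Lower semicontinuity of the energy with respect to convergence in `L²`. -/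
theorem energyNorm_sub_le_of_tendsto (hΩ : Bornology.IsBounded Ω) (μ : Measure unitInterval)
    [SFinite μ] {f : ℕ → 𝔼 → ℝ} {v w : 𝔼 → ℝ} (hf : ∀ n, IsAdmissible Ω (f n))
    (hv : IsAdmissible Ω v) (hw : IsAdmissible Ω w)
    (hlim : Tendsto (fun n => eLpNorm (f n - w) 2) atTop (𝓝 0)) {ε : ℝ≥0∞}
    (h : ∀ᶠ n in atTop, energyNorm μ (v - f n) ≤ ε) : energyNorm μ (v - w) ≤ ε := by
  -- On a bounded set `L²` convergence implies `L¹` convergence, hence convergence of the Fourier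
  -- transforms at every frequency; Fatou's lemma then gives the bound.
  have hpt : ∀ ξ, Tendsto (fun n => fourierReal (f n) ξ) atTop (𝓝 (fourierReal w ξ)) := by
    intro ξ
    rw [tendsto_iff_edist_tendsto_0]
    have h1 : Tendsto (fun n => eLpNorm (f n - w) 2 * volume (closure Ω) ^ (1 / 2 : ℝ)) atTop
        (𝓝 0) := by
      have := ENNReal.Tendsto.mul_const hlim (b := volume (closure Ω) ^ (1 / 2 : ℝ))
        (Or.inr (ENNReal.rpow_ne_top_of_nonneg (by norm_num)
          (hΩ.closure.measure_lt_top (μ := volume)).ne))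
      simpa using this
    have h2 : ∀ n, edist (fourierReal (f n) ξ) (fourierReal w ξ) ≤
        eLpNorm (f n - w) 2 * volume (closure Ω) ^ (1 / 2 : ℝ) := fun n => by
      have h3 := congrFun ((hf n).fourierReal_sub hΩ hw) ξ
      rw [edist_eq_enorm_sub, ← Pi.sub_apply, ← h3]
      exact (enorm_fourierReal_le _ ξ).trans (lintegral_enorm_le ((hf n).sub hw))
    exact tendsto_of_tendsto_of_tendsto_of_le_of_le tendsto_const_nhds h1 (fun _ => zero_le) h2
  rw [energyNorm_eq_eLpNorm hΩ (hv.sub hw), hv.fourierReal_sub hΩ hw]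
  refine (Lp.eLpNorm_lim_le_liminf_eLpNorm (f := fun n => fourierReal v - fourierReal (f n))
    (fun n => ((hv.continuous_fourierReal hΩ).sub
      ((hf n).continuous_fourierReal hΩ)).aestronglyMeasurable) _
    (ae_of_all _ fun ξ => tendsto_const_nhds.sub (hpt ξ))).trans ?_
  refine liminf_le_of_le (by isBoundedDefault) fun b hb => ?_
  obtain ⟨n, hn1, hn2⟩ := (hb.and h).exists
  refine hn1.trans ?_
  rwa [energyNorm_eq_eLpNorm hΩ (hv.sub (hf n)), hv.fourierReal_sub hΩ (hf n)] at hn2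

variable {hΩ : Bornology.IsBounded Ω} {hμ : 0 < μp (Icc sbar 1)}

/-- The `L²(Ω)` limit, extended by zero, is the candidate. Lower semicontinuity of the energy lets
`m → ∞` in the Cauchy condition for `u n - u m`. -/
theorem X0.completeSpace [IsFiniteMeasure μp] (hΩm : MeasurableSet Ω) :
    CompleteSpace (X0 hΩ hμ) := by
  refine Metric.complete_of_cauchySeq_tendsto fun u hu => ?_
  obtain ⟨y, hy⟩ := cauchySeq_tendsto_of_complete
    ((embL2 hΩ hμ hΩm).uniformContinuous.comp_cauchySeq hu)
  set w : 𝔼 → ℝ := Ω.indicator y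
  have hw0 : ∀ x, x ∉ Ω → w x = 0 := fun x hx => indicator_of_notMem hx _
  have hw : IsAdmissible Ω w :=
    ⟨(Lp.stronglyMeasurable y).measurable.indicator hΩm,
      (memLp_indicator_iff_restrict hΩm).2 (Lp.memLp y), ae_of_all _ hw0⟩
  have hlim : Tendsto (fun n => eLpNorm ((u n).fn - w) 2) atTop (𝓝 0) := by
    refine ((Lp.tendsto_Lp_iff_tendsto_eLpNorm' _ _).1 hy).congr fun n => ?_
    rw [← eLpNorm_restrict_of_vanishing hΩm ((u n).isAdmissible.sub hw).vanishing]
    refine eLpNorm_congr_ae ?_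
    filter_upwards [X0.coeFn_toL2 (u n), ae_restrict_mem hΩm] with x h1 h2
    change X0.toL2 (u n) x - y x = (u n).fn x - w x
    rw [h1, show w x = y x from indicator_of_mem h2 _]
  have hkey : ∀ ε : ℝ, 0 < ε → ∃ n₀, ∀ n ≥ n₀,
      energyNorm μp ((u n).fn - w) ≤ ENNReal.ofReal ε := by
    intro ε hε
    obtain ⟨n₀, hn₀⟩ := Metric.cauchySeq_iff.1 hu ε hε
    refine ⟨n₀, fun n hn => ?_⟩
    refine energyNorm_sub_le_of_tendsto hΩ μp (f := fun m => (u m).fn) (fun m => (u m).isAdmissible)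
      (u n).isAdmissible hw hlim ?_
    filter_upwards [eventually_ge_atTop n₀] with m hm
    rw [← energyNorm_congr μp (X0.fn_sub (u n) (u m)),
      ← ENNReal.ofReal_toReal (u n - u m).energyNorm_lt_top.ne]
    refine ENNReal.ofReal_le_ofReal ?_
    have := hn₀ n hn m hm
    rw [dist_eq_norm] at this
    exact this.le
  have hwt : energyNorm μp w < ⊤ := by
    obtain ⟨n, hn⟩ := hkey 1 one_pos
    have h1 : w = (u n).fn + (-1 : ℝ) • ((u n).fn - w) := by
      funext x
      simp
    rw [h1]
    refine (energyNorm_add_le μp (u n).isAdmissible.1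
      (((u n).isAdmissible.sub hw).1.const_smul _)).trans_lt ?_
    refine ENNReal.add_lt_top.2 ⟨(u n).energyNorm_lt_top, ?_⟩
    refine (energyNorm_smul_le μp _ _).trans_lt (ENNReal.mul_lt_top enorm_lt_top ?_)
    exact (hn n le_rfl).trans_lt ENNReal.ofReal_lt_top
  have hWm := hw.1.aestronglyMeasurable (μ := volume)
  have hWw : AEEqFun.mk w hWm =ᵐ[volume] w := AEEqFun.coeFn_mk w hWm
  let W : X0 hΩ hμ := ⟨AEEqFun.mk w hWm, by
    filter_upwards [hWw] with x hx hxΩ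
    rw [hx, hw0 x hxΩ], by
    rw [energyNorm_congr μp hWw]
    exact hwt⟩
  refine ⟨W, Metric.tendsto_atTop.2 fun ε hε => ?_⟩
  obtain ⟨n₀, hn₀⟩ := hkey (ε / 2) (half_pos hε)
  refine ⟨n₀, fun n hn => ?_⟩
  have h1 : (u n - W).fn =ᵐ[volume] (u n).fn - w := by
    filter_upwards [X0.fn_sub (u n) W, hWw] with x h1 h2
    rw [h1, Pi.sub_apply, Pi.sub_apply, ← h2]
    rfl
  rw [dist_eq_norm, X0.norm_def, energyNorm_congr μp h1]
  have h2 := ENNReal.toReal_mono ENNReal.ofReal_ne_top (hn₀ n hn)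
  rw [ENNReal.toReal_ofReal (half_pos hε).le] at h2
  linarith

end Complete

/-! ### Continuity of the superposed forms. -/

section Form

variable {N : ℕ} [NeZero N]

variable {Ω : Set (EuclideanSpace ℝ (Fin N))} {μp : Measure unitInterval} {sbar : unitInterval}
  {hΩ : Bornology.IsBounded Ω} {hμ : 0 < μp (Icc sbar 1)}

/-- The superposed form is continuous if its energy is dominated by that of `μ⁺`. -/
theorem exists_continuous_form {μ : Measure unitInterval} [SFinite μ]
    (h : ∀ u : X0 hΩ hμ, energyNorm μ u.fn ≤ energyNorm μp u.fn) :
    ∃ B : X0 hΩ hμ →L[ℝ] X0 hΩ hμ →L[ℝ] ℝ,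
      (∀ u v, B u v = ∫ s : unitInterval, gagliardoForm (s : ℝ) u.fn v.fn ∂μ) ∧
      (∀ u v, B u v = B v u) ∧ ∀ u, B u u = (energyNorm μ u.fn).toReal ^ 2 := by
  have h' : ∀ u : X0 hΩ hμ, energyNorm μ u.fn < ⊤ := fun u => (h u).trans_lt u.energyNorm_lt_top
  -- The form is the `L²` inner product pulled back along the Fourier transform, which is a
  -- contraction by the assumed domination.
  let T : X0 hΩ hμ →L[ℝ] Lp ℂ 2 (spectralMeasure N μ) :=
    (X0.fourierMap μ h').mkContinuous 1 fun u => by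
      rw [one_mul, X0.norm_fourierMap h', X0.norm_def]
      exact ENNReal.toReal_mono u.energyNorm_lt_top.ne (h u)
  refine ⟨innerForm T, fun u v => X0.inner_fourierMap h' u v, fun u v => ?_, fun u => ?_⟩
  · rw [innerForm_apply, innerForm_apply, real_inner_comm]
  · rw [innerForm_apply, real_inner_self_eq_norm_sq, ← X0.norm_fourierMap h']
    rfl

end Form

end Superposition

/-! ### The main theorem. -/

theorem mainTheorem3 (N : ℕ) [NeZero N] (_hN : 2 ≤ N) (Ω : Set (EuclideanSpace ℝ (Fin N)))
    (_hΩo : IsOpen Ω) (hΩ : Bornology.IsBounded Ω) :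
    ∃ γ₀ : ℝ, 0 < γ₀ ∧
      ∀ (μp μm : Measure unitInterval) [IsFiniteMeasure μp] [IsFiniteMeasure μm]
        (sbar : unitInterval) (γ : ℝ) (hμa : 0 < μp (Icc sbar 1)),
        0 < sbar → 0 ≤ γ → γ ≤ γ₀ →
        μm.restrict (Icc sbar 1) = 0 →
        μm (Icc 0 sbar) ≤ ENNReal.ofReal γ * μp (Icc sbar 1) →
        ∀ f : EuclideanSpace ℝ (Fin N) → ℝ → ℝ,
          IsCaratheodory Ω f →
          -- (f₁)
          (∀ τ : ℝ, 0 < τ →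
            MemLp (fun x => ⨆ t : Icc (-τ) τ, |f x t|) ⊤ (volume.restrict Ω)) →
          -- (f₂)
          (∀ ε : ℝ, 0 < ε → ∃ R : ℝ, 0 < R ∧
            ∀ᵐ x ∂(volume.restrict Ω), ∀ t : ℝ, R ≤ |t| → |f x t / t| < ε) →
          ∀ lam : ℝ, lam ∉ dirichletSpectrum hΩ hμa μm →
            ContDiff ℝ 1 (energyFunctional hΩ hμa μm lam f) ∧
              ∀ c : ℝ, PalaisSmaleAt (energyFunctional hΩ hμa μm lam f) c := by
  obtain ⟨C, hC, hcmp⟩ := exists_spectralEnergy_le (N := N) hΩ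
  -- With this choice `Cγ ≤ 1/2`, so the form of `μ⁻` takes away at most half of the energy of `μ⁺`.
  refine ⟨1 / (2 * C), by positivity, ?_⟩
  intro μp μm _ _ sbar γ hμ hs hγ0 hγ _ hμm f hf hf1 hf2 lam hlam
  have hΩm : MeasurableSet Ω := _hΩo.measurableSet
  have : CompleteSpace (X0 hΩ hμ) := X0.completeSpace hΩm
  have : IsFiniteMeasure (volume.restrict Ω) :=
    ⟨by rw [Measure.restrict_apply_univ]; exact hΩ.measure_lt_top⟩
  have hCγ : C * γ ≤ 1 / 2 := by
    rw [le_div_iff₀ (by positivity)] at hγ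
    linarith
  have hneg : ∀ u : X0 hΩ hμ, energyNorm (μm.restrict (Icc 0 sbar)) u.fn ^ (2 : ℝ) ≤
      ENNReal.ofReal (1 / 2) * energyNorm μp u.fn ^ (2 : ℝ) := fun u =>
    (energyNorm_restrict_sq_le hΩ u.isAdmissible hμ
      (fun s s' h0 h1 h2 => (hcmp u.fn u.isAdmissible s s' h0 h1 h2).2) hC.le hμm).trans
      (mul_le_mul' (ENNReal.ofReal_le_ofReal hCγ) le_rfl)
  have hnegr : ∀ u : X0 hΩ hμ,
      (energyNorm (μm.restrict (Icc 0 sbar)) u.fn).toReal ^ 2 ≤ 1 / 2 * ‖u‖ ^ 2 := fun u => by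
    have h1 := ENNReal.toReal_mono (ENNReal.mul_ne_top ENNReal.ofReal_ne_top
      (ENNReal.rpow_ne_top_of_nonneg zero_le_two u.energyNorm_lt_top.ne)) (hneg u)
    rwa [ENNReal.toReal_mul, ← ENNReal.toReal_rpow, ← ENNReal.toReal_rpow, ← X0.norm_def,
      ENNReal.toReal_ofReal (by norm_num), Real.rpow_two, Real.rpow_two] at h1
  obtain ⟨Bp, hBp, hBps, hBpn⟩ := exists_continuous_form (hΩ := hΩ) (hμ := hμ) (μ := μp)
    fun u => le_rfl
  obtain ⟨Bm, hBm, hBms, hBmn⟩ := exists_continuous_form (hΩ := hΩ) (hμ := hμ)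
    (μ := μm.restrict (Icc 0 sbar)) fun u => by
      refine (ENNReal.rpow_le_rpow_iff two_pos).1 ((hneg u).trans ?_)
      refine (mul_le_mul' (ENNReal.ofReal_le_ofReal (q := 1) (by norm_num)) le_rfl).trans_eq ?_
      rw [ENNReal.ofReal_one, one_mul]
  set ι := embL2 hΩ hμ hΩm
  have hι : ∀ u v, innerForm ι u v = ∫ x in Ω, u.fn x * v.fn x := X0.inner_toL2
  -- The nonlinearity is replaced by a jointly measurable version; `J` does not see the difference.
  obtain ⟨g, hg, hgc, hfg⟩ := exists_measurable_caratheodory hf.1 hf.2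
  have hgrowth : ∀ ε : ℝ, 0 < ε →
      ∃ D : ℝ, ∀ᵐ x ∂(volume.restrict Ω), ∀ t, |g x t| ≤ D + ε * |t| := fun ε hε => by
    obtain ⟨D, hD⟩ := exists_growth_bound hf.2 hf1 hf2 hε
    refine ⟨D, ?_⟩
    filter_upwards [hD, hfg] with x h1 h2
    rwa [← h2]
  have hB : ∀ u v, (Bp - Bm - lam • innerForm ι) u v =
      posForm u v - negForm μm u v - lam * ∫ x in Ω, u.fn x * v.fn x := fun u v => by
    rw [← hι, posForm, negForm, ← hBp, ← hBm]
    rfl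
  -- The coefficient `1/2` is what remains of `‖u‖²` after `μ⁻`, and `|λ̄|` compensates the `L²`
  -- term whatever the sign of `λ̄`.
  refine contDiff_and_palaisSmale (B := Bp - Bm - lam • innerForm ι) (ι := ι) (c := 1 / 2)
    (K := |lam|) (fun u v => ?_) (by norm_num) (abs_nonneg lam) (fun u => ?_)
    (fun u R hu => exists_subseq_cauchySeq_embL2 hΩm hs u R hu) (fun u hu => ?_)
    (continuous_superposition hg hgc (hgrowth 1 one_pos))
    (hasFDerivAt_integral_primitive hg hgc (hgrowth 1 one_pos)) (fun ε hε => ?_) (fun u => ?_)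
  · change Bp u v - Bm u v - lam * innerForm ι u v = Bp v u - Bm v u - lam * innerForm ι v u
    rw [hBps u v, hBms u v, innerForm_apply, innerForm_apply, real_inner_comm]
  · change _ ≤ Bp u u - Bm u u - lam * innerForm ι u u + _
    rw [hBpn, hBmn, innerForm_apply, real_inner_self_eq_norm_sq, ← X0.norm_def]
    nlinarith [hnegr u, le_abs_self lam, sq_nonneg ‖ι u‖]
  -- A nonzero element of the kernel of the form is an eigenfunction for `λ̄`.
  · by_contra hne
    refine hlam ⟨u, hne, fun v => ?_⟩
    have h1 := hB u v
    rw [hu] at h1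
    change (0 : ℝ) = _ at h1
    linarith
  · obtain ⟨D, hD⟩ := hgrowth ε hε
    exact norm_superposition_le hg (hgrowth 1 one_pos) hε.le hD
  · rw [hB, energyFunctional]
    have h1 : ∫ x in Ω, ∫ τ in (0 : ℝ)..(u.fn x), f x τ =
        ∫ x in Ω, ∫ τ in (0 : ℝ)..(ι u x), g x τ := by
      refine integral_congr_ae ?_
      filter_upwards [hfg, X0.coeFn_toL2 u] with x h2 h3
      change _ = ∫ τ in (0 : ℝ)..(X0.toL2 u x), g x τ
      rw [h2, h3]
    rw [h1]
    simp only [sq]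
    ring
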